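/- A concurrent interpolation search tree (C-IST) is a leaf-oriented search tree in shared memory. Its leaves hold at most one key. An inner node of degree $d$ has $d-1$ immutable routing keys, $d$ mutable child pointers, the number initSize of keys below it when it was created, an update counter count (initially $0$), and a status, which is clean until a rebuild marks the node. A fixed root node, which is never rebuilt, has a single child, initially an empty leaf. *Updates.* To insert or delete a key, a thread searches from the root for the leaf responsible for the key and replaces it by an atomic double-compare-single-swap (DCSS), which succeeds only if the child pointer is unchanged and the status of the parent is clean. An insertion replaces an empty leaf by a leaf with the new key, and a leaf with a different key by an inner node of degree $2$ over two leaves (if the leaf already holds the key, by a leaf with the same key and the new value). A deletion replaces the leaf with the key by an empty leaf; it returns without change if the key is absent. If the child pointer has changed, the thread retries from the same node; if the status is not clean, it retries from the root. After a success, it atomically increments count in each inner node on its search path below the root, from the top down; then it goes through these nodes again from the top, and at the first one with $\mathrm{count}\ge\frac14\,\mathrm{initSize}$, if any, it tries once to start a rebuild. *Rebuilding.* To start a rebuild of the node $v$, the thread inserts a Rebuild descriptor between $v$ and its parent by a DCSS of the same kind (giving up if it fails), and then executes the rebuild. Every updating thread whose search meets a descriptor also executes that rebuild, and then restarts from the root.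 Executing the rebuild means: traverse the subtree of $v$, marking the status of each inner node before reading its children, and counting the keys; create a new tree with the same keys; try to replace the descriptor by the new tree by a DCSS of the same kind. The new tree is ideal: a tree with no key or one key is a leaf, and the root of a tree with $m\ge2$ keys has degree $\lfloor\sqrt m\rfloor$ or $\lceil\sqrt m\rceil$, and at least $2$, each of its subtrees being ideal with $\lfloor\sqrt m\rfloor$ or $\lceil\sqrt m\rceil$ keys. In the variant with collaborative rebuilding, helping threads share the marking of the children of nodes of degree more than $48$, and the root of a rebuilt tree with $m\ge48$ keys has $\lfloor\sqrt m\rfloor$ ideal subtrees whose numbers of keys differ by at most one. **Lemma.** There is an absolute constant $C$ such that the following holds, with or without collaborative rebuilding. Let $p\ge1$ threads concurrently perform arbitrary sequences of insertions and deletions on an initially empty C-IST, their atomic steps being interleaved by an arbitrary scheduler (threads may also stall forever). At every moment of every such execution, if the C-IST contains $n$ keys, then its depth, i.e. the largest number of pointers on a path from the root (child pointers, and pointers from Rebuild descriptors to the subtree being rebuilt), is at most $C\,(p+\log n)$, where $\log 0$ is read as $0$. -/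

import Mathlib

universe u v

namespace CIST

/-! ### Search trees as values

A `Tree` is the content of a block of freshly allocated nodes that only the allocating thread can
see: the result of creating a leaf, a two-key node, or an ideal tree. It becomes part of the shared
memory when it is published. -/

/-- `inner ks d ch` is an inner node of degree `d` with keys `ks` and children `ch 0, …, ch (d-1)`;
the keys with their values are stored in the `single` leaves. -/
inductive Tree (K : Type u) (V : Type v) : Type (max u v)
  | empty : Tree K V
  | single : K → V → Tree K V
  | inner : List K → (d : ℕ) → (Fin d → Tree K V) → Tree K V

/-- The key-value pairs in the leaves, from left to right. -/
def Tree.toList {K : Type u} {V : Type v} : Tree K V → List (K × V)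
  | .empty => []
  | .single k x => [(k, x)]
  | .inner _ _ ch => (List.ofFn fun i => (ch i).toList).flatten

/-- The number of keys in the leaves. -/
def Tree.size {K : Type u} {V : Type v} (t : Tree K V) : ℕ := t.toList.length

/-- The subtree at a position, given as a list of child indices. -/
def Tree.subtree {K : Type u} {V : Type v} : Tree K V → List ℕ → Option (Tree K V)
  | t, [] => some t
  | .inner _ d ch, i :: pos => if h : i < d then (ch ⟨i, h⟩).subtree pos else none
  | .empty, _ :: _ => none
  | .single _ _, _ :: _ => none

/-- The list `ks = [k₀, …, k_{d-2}]` separates the `d` children: the keys of child `i` are smaller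
than `kᵢ`, and those of child `i + 1` are at least `kᵢ`. -/
def Separates {K : Type u} {V : Type v} [LinearOrder K]
    (ks : List K) (d : ℕ) (ch : Fin d → Tree K V) : Prop :=
  ks.length + 1 = d ∧
    ∀ (i : ℕ) (hi : i < ks.length) (hd : i + 1 < d),
      (∀ e ∈ (ch ⟨i, by omega⟩).toList, e.1 < ks[i]) ∧
      (∀ e ∈ (ch ⟨i + 1, hd⟩).toList, ks[i] ≤ e.1)

/-- Ideal interpolation search trees. A tree with no key is an `empty` leaf and a tree with one key
is a `single` leaf. A tree with `n ≥ 2` keys has a root of degree `⌊√n⌋` or `⌈√n⌉` (and at least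
`2`), and each subtree of the root is ideal and has `⌊√n⌋` or `⌈√n⌉` keys. -/
def Tree.IsIdeal {K : Type u} {V : Type v} [LinearOrder K] : Tree K V → Prop
  | .empty => True
  | .single _ _ => True
  | .inner ks d ch =>
    let n := (Tree.inner ks d ch).size
    2 ≤ n ∧ 2 ≤ d ∧ (d = Nat.sqrt n ∨ d = ⌈Real.sqrt n⌉₊) ∧ Separates ks d ch ∧
      ∀ i, ((ch i).size = Nat.sqrt n ∨ (ch i).size = ⌈Real.sqrt n⌉₊) ∧ (ch i).IsIdeal

/-- `COLLABORATION_THRESHOLD`. -/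
def collaborationThreshold : ℕ := 48

/-- What collaborative building makes out of at least `collaborationThreshold` keys: a root of
degree `d = ⌊√n⌋` whose children are ideal trees, the first `n % d` of them with `⌊n / d⌋ + 1` keys
and the others with `⌊n / d⌋` keys. -/
def Tree.IsCollaborative {K : Type u} {V : Type v} [LinearOrder K] : Tree K V → Prop
  | .empty => False
  | .single _ _ => False
  | .inner ks d ch =>
    let n := (Tree.inner ks d ch).size
    d = Nat.sqrt n ∧ Separates ks d ch ∧
      ∀ i : Fin d, (ch i).size = n / d + (if i.1 < n % d then 1 else 0) ∧ (ch i).IsIdeal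

/-- The trees that rebuilding may create. The flag tells whether rebuilding is collaborative. -/
def Tree.IsRebuilt {K : Type u} {V : Type v} [LinearOrder K] (collab : Bool) (t : Tree K V) :
    Prop :=
  if collab = true ∧ collaborationThreshold ≤ t.size then t.IsCollaborative else t.IsIdeal

/-! ### Shared memory -/

/-- An address: the number of the allocation, and the position of the node in the tree that was
allocated. Addresses are never reused. -/
abbrev Addr : Type := ℕ × List ℕ

/-- The `status` field: key count, `finished`, `started`. -/
abbrev Status : Type := ℕ × Bool × Bool

/-- `[0, ⊥, ⊥]`: the node is not being rebuilt. -/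
def Status.clean : Status := (0, false, false)

/-- `[0, ⊥, ⊤]`: marking has started. -/
def Status.started : Status := (0, false, true)

/-- `[n, ⊤, ⊤]`: marking has finished, and there are `n` keys in the subtree. -/
def Status.finished (n : ℕ) : Status := (n, true, true)

/-- The fields of an `Inner` node; its degree is the length of `children`. -/
structure Inner (K : Type u) where
  initSize : ℕ
  keys : List K
  children : List Addr
  status : Status
  count : ℕ
  nextMark : ℕ

/-- The four kinds of nodes. -/
inductive Node (K : Type u) (V : Type v) : Type (max u v)
  | empty : Node K V
  | single : K → V → Node K V
  | inner : Inner K → Node K V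
  | rebuild (target parent : Addr) (index : ℕ) : Node K V

/-- The shared memory: the nodes, and the number of the next allocation. -/
structure Mem (K : Type u) (V : Type v) where
  node : Addr → Option (Node K V)
  next : ℕ

/-- The node at position `pos` of allocation `b`, when the subtree there is the given one. -/
def Tree.toNode {K : Type u} {V : Type v} (b : ℕ) (pos : List ℕ) : Tree K V → Node K V
  | .empty => .empty
  | .single k x => .single k x
  | .inner ks d ch => .inner
      { initSize := (Tree.inner ks d ch).size
        keys := ks
        children := (List.range d).map fun i => (b, pos ++ [i])
        status := Status.clean
        count := 0
        nextMark := 0 }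

/-- Store a tree as a fresh block; its root gets the address `(m.next, [])`. -/
def Mem.publish {K : Type u} {V : Type v} (m : Mem K V) (t : Tree K V) : Mem K V where
  node a := if a.1 = m.next then (t.subtree a.2).map (Tree.toNode a.1 a.2) else m.node a
  next := m.next + 1

/-- Store a fresh `Rebuild` descriptor at the address `(m.next, [])`. -/
def Mem.descriptor {K : Type u} {V : Type v} (m : Mem K V) (target parent : Addr) (index : ℕ) :
    Mem K V where
  node := Function.update m.node (m.next, []) (some (.rebuild target parent index))
  next := m.next + 1

/-- Overwrite the fields of an inner node. -/
def Mem.write {K : Type u} {V : Type v} (m : Mem K V) (a : Addr) (I : Inner K) : Mem K V where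
  node := Function.update m.node a (some (.inner I))
  next := m.next

/-- The address of the `root` node. -/
def rootAddr : Addr := (0, [])

/-- The initial memory: the `root` node has a single child, an `Empty` leaf. The root itself is
never rebuilt. -/
def Mem.init (K : Type u) (V : Type v) : Mem K V :=
  Mem.publish ⟨fun _ => none, 0⟩ (.inner [] 1 fun _ => .empty)

/-- `Contents m a L`: the leaves below `a` hold the key-value pairs `L`, from left to right. -/
inductive Contents {K : Type u} {V : Type v} (m : Mem K V) : Addr → List (K × V) → Prop
  | empty {a : Addr} : m.node a = some .empty → Contents m a []
  | single {a : Addr} {k : K} {x : V} : m.node a = some (.single k x) → Contents m a [(k, x)]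
  | inner {a : Addr} {I : Inner K} (f : Addr → List (K × V)) :
      m.node a = some (.inner I) → (∀ c ∈ I.children, Contents m c (f c)) →
      Contents m a (I.children.flatMap f)
  | rebuild {a target parent : Addr} {index : ℕ} {L : List (K × V)} :
      m.node a = some (.rebuild target parent index) → Contents m target L → Contents m a L

/-! ### The operations -/

/-- The modifying operations. -/
inductive Cmd (K : Type u) (V : Type v) : Type (max u v)
  | insert : K → V → Cmd K V
  | delete : K → Cmd K V

/-- The key that the operation is about. -/
def Cmd.key {K : Type u} {V : Type v} : Cmd K V → K
  | .insert k _ => k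
  | .delete k => k

/-- The result of interpolation search: the index `i` with `k_{i-1} ≤ key < k_i`. -/
def searchIndex {K : Type u} [LinearOrder K] (ks : List K) (key : K) : ℕ :=
  ks.countP fun k => decide (k ≤ key)

/-- The replacement for a leaf that an operation reaches; `none` when the operation returns without
changing anything. -/
def replacement {K : Type u} {V : Type v} [LinearOrder K] :
    Cmd K V → Node K V → Option (Tree K V)
  | .insert k x, .empty => some (.single k x)
  | .insert k x, .single k₁ x₁ =>
    if k = k₁ then some (.single k x)
    else if k₁ < k then some (.inner [k] 2 ![.single k₁ x₁, .single k x])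
    else some (.inner [k₁] 2 ![.single k x, .single k₁ x₁])
  | .delete k, .single k₁ _ => if k = k₁ then some .empty else none
  | _, _ => none

/-- Stack frames of the marking procedure: `jobs a` is the collaborative pass over the children of
`a`, and `scan a i n` is the counting pass, at child `i`, with `n` keys counted so far. -/
inductive Frame : Type
  | jobs (a : Addr) : Frame
  | scan (a : Addr) (i n : ℕ) : Frame

/-- Local state of a thread: what it is going to do next. In the last six states the thread runs
`helpRebuild op`; afterwards it retries the operation `retry`, if there is one, or returns. -/
inductive Pc (K : Type u) (V : Type v) : Type (max u v)
  /-- between two operations -/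
  | idle : Pc K V
  /-- read the child of `n` that is responsible for the key; `path` lists, from the top, the inner
  nodes visited below the root, each with its index in its parent -/
  | search (c : Cmd K V) (n : Addr) (path : List (Addr × ℕ)) : Pc K V
  /-- the DCSS that replaces the leaf `child` at index `i` of `n` by `t` -/
  | update (c : Cmd K V) (n : Addr) (path : List (Addr × ℕ)) (i : ℕ) (child : Addr)
      (t : Tree K V) : Pc K V
  /-- increment the counts of the nodes in `todo` -/
  | bump (todo path : List (Addr × ℕ)) : Pc K V
  /-- look for the first node in `todo` whose count has reached the threshold -/
  | check (todo : List (Addr × ℕ)) (parent : Addr) : Pc K V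
  /-- the DCSS that puts a `Rebuild` node above `node` -/
  | announce (node parent : Addr) (i : ℕ) : Pc K V
  /-- call the marking procedure on `a` -/
  | markCall (op : Addr) (retry : Option (Cmd K V)) (a : Addr) (stack : List Frame) : Pc K V
  /-- continue the topmost frame of the marking procedure -/
  | markLoop (op : Addr) (retry : Option (Cmd K V)) (stack : List Frame) : Pc K V
  /-- collaborative pass: read child `i` of `a` and mark it -/
  | markJob (op : Addr) (retry : Option (Cmd K V)) (a : Addr) (i : ℕ) (stack : List Frame) : Pc K V
  /-- counting pass: read the status of the inner node `child` -/
  | markStatus (op : Addr) (retry : Option (Cmd K V)) (child : Addr) (stack : List Frame) : Pc K V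
  /-- create an ideal tree from the `n` keys of the marked subtree -/
  | create (op : Addr) (retry : Option (Cmd K V)) (n : ℕ) : Pc K V
  /-- the DCSS that replaces the `Rebuild` node `op` by the new tree `t` -/
  | install (op : Addr) (retry : Option (Cmd K V)) (t : Tree K V) : Pc K V

/-- The state in which an operation starts: at the root, with an empty path. -/
def Pc.start {K : Type u} {V : Type v} (c : Cmd K V) : Pc K V := .search c rootAddr []

/-- The state after `helpRebuild`. -/
def Pc.resume {K : Type u} {V : Type v} : Option (Cmd K V) → Pc K V
  | none => .idle
  | some c => .start c

/-- Return the key count `n` from the marking procedure to its caller. -/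
def Pc.markReturn {K : Type u} {V : Type v} (op : Addr) (retry : Option (Cmd K V)) (n : ℕ) :
    List Frame → Pc K V
  | [] => .create op retry n
  | .jobs a :: s => .markLoop op retry (.jobs a :: s)
  | .scan a i acc :: s => .markLoop op retry (.scan a (i + 1) (acc + n) :: s)

/-- Compare-and-swap on the `status` field. -/
def Inner.casStatus {K : Type u} (I : Inner K) (old new : Status) : Inner K :=
  if I.status = old then { I with status := new } else I

/-- The test `DCSS` makes before writing: child `i` is `old` and the status is `[0, ⊥, ⊥]`. -/
def Inner.Matches {K : Type u} (I : Inner K) (i : ℕ) (old : Addr) : Prop :=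
  I.children[i]? = some old ∧ I.status = Status.clean

/-- The value written by a successful `DCSS`. -/
def Inner.setChild {K : Type u} (I : Inner K) (i : ℕ) (new : Addr) : Inner K :=
  { I with children := I.children.set i new }

/-- `Step collab m s m' s'`: a thread in state `s` can make one atomic step that changes the memory
from `m` to `m'` and leads to state `s'`. -/
inductive Step {K : Type u} {V : Type v} [LinearOrder K] (collab : Bool) :
    Mem K V → Pc K V → Mem K V → Pc K V → Prop
  | invoke {m} (c : Cmd K V) : Step collab m .idle m (.start c)
  -- `insert` and `delete`: the search loop
  | searchInner {m c n path I child J} :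
      m.node n = some (.inner I) →
      I.children[searchIndex I.keys c.key]? = some child →
      m.node child = some (.inner J) →
      Step collab m (.search c n path)
        m (.search c child (path ++ [(child, searchIndex I.keys c.key)]))
  | searchRebuild {m c n path I child target parent i} :
      m.node n = some (.inner I) →
      I.children[searchIndex I.keys c.key]? = some child →
      m.node child = some (.rebuild target parent i) →
      Step collab m (.search c n path) m (.markCall child (some c) target [])
  | searchLeaf {m c n path I child leaf t} :
      m.node n = some (.inner I) →
      I.children[searchIndex I.keys c.key]? = some child →
      m.node child = some leaf →
      replacement c leaf = some t →
      Step collab m (.search c n path) m (.update c n path (searchIndex I.keys c.key) child t)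
  | searchDone {m c n path I child leaf} :
      m.node n = some (.inner I) →
      I.children[searchIndex I.keys c.key]? = some child →
      m.node child = some leaf →
      (leaf = .empty ∨ ∃ k x, leaf = .single k x) →
      replacement c leaf = none →
      Step collab m (.search c n path) m .idle
  | updateSuccess {m c n path i child t I} :
      m.node n = some (.inner I) → I.Matches i child →
      Step collab m (.update c n path i child t)
        ((m.publish t).write n (I.setChild i (m.next, []))) (.bump path path)
  | updateFailedMain {m c n path i child t I} :
      m.node n = some (.inner I) → I.children[i]? ≠ some child →
      Step collab m (.update c n path i child t) m (.search c n path)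
  | updateFailedAux {m c n path i child t I} :
      m.node n = some (.inner I) → I.children[i]? = some child → I.status ≠ Status.clean →
      Step collab m (.update c n path i child t) m (.start c)
  -- `insert` and `delete`: updating the counts, and testing `count ≥ 0.25 * initSize`
  | bumpNext {m a i todo path I} :
      m.node a = some (.inner I) →
      Step collab m (.bump ((a, i) :: todo) path)
        (m.write a { I with count := I.count + 1 }) (.bump todo path)
  | bumpDone {m path} : Step collab m (.bump [] path) m (.check path rootAddr)
  | checkNext {m a i todo parent I} :
      m.node a = some (.inner I) → (I.count : ℚ) < 1 / 4 * I.initSize →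
      Step collab m (.check ((a, i) :: todo) parent) m (.check todo a)
  | checkFound {m a i todo parent I} :
      m.node a = some (.inner I) → 1 / 4 * I.initSize ≤ (I.count : ℚ) →
      Step collab m (.check ((a, i) :: todo) parent) m (.announce a parent i)
  | checkDone {m parent} : Step collab m (.check [] parent) m .idle
  -- `rebuild`
  | announceSuccess {m a parent i I} :
      m.node parent = some (.inner I) → I.Matches i a →
      Step collab m (.announce a parent i)
        ((m.descriptor a parent i).write parent (I.setChild i (m.next, [])))
        (.markCall (m.next, []) none a [])
  | announceFailed {m a parent i I} :
      m.node parent = some (.inner I) → ¬ I.Matches i a →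
      Step collab m (.announce a parent i) m .idle
  -- `markAndCount`
  | markEmpty {m op retry a s} :
      m.node a = some .empty →
      Step collab m (.markCall op retry a s) m (.markReturn op retry 0 s)
  | markSingle {m op retry a s k x} :
      m.node a = some (.single k x) →
      Step collab m (.markCall op retry a s) m (.markReturn op retry 1 s)
  | markRebuild {m op retry a s target parent i} :
      m.node a = some (.rebuild target parent i) →
      Step collab m (.markCall op retry a s) m (.markCall op retry target s)
  | markInner {m op retry a s I} :
      m.node a = some (.inner I) →
      Step collab m (.markCall op retry a s)
        (m.write a (I.casStatus Status.clean Status.started))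
        (.markLoop op retry
          ((if collab = true ∧ collaborationThreshold < I.children.length then .jobs a
            else .scan a 0 0) :: s))
  | jobTake {m op retry a s I} :
      m.node a = some (.inner I) →
      Step collab m (.markLoop op retry (.jobs a :: s))
        (m.write a { I with nextMark := I.nextMark + 1 })
        (if I.nextMark < I.children.length then .markJob op retry a I.nextMark (.jobs a :: s)
          else .markLoop op retry (.scan a 0 0 :: s))
  | jobRead {m op retry a i s I child} :
      m.node a = some (.inner I) → I.children[i]? = some child →
      Step collab m (.markJob op retry a i s) m (.markCall op retry child s)
  | scanEmpty {m op retry a i n s I child} :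
      m.node a = some (.inner I) → I.children[i]? = some child →
      m.node child = some .empty →
      Step collab m (.markLoop op retry (.scan a i n :: s))
        m (.markLoop op retry (.scan a (i + 1) n :: s))
  | scanSingle {m op retry a i n s I child k x} :
      m.node a = some (.inner I) → I.children[i]? = some child →
      m.node child = some (.single k x) →
      Step collab m (.markLoop op retry (.scan a i n :: s))
        m (.markLoop op retry (.scan a (i + 1) (n + 1) :: s))
  | scanInner {m op retry a i n s I child J} :
      m.node a = some (.inner I) → I.children[i]? = some child →
      m.node child = some (.inner J) →
      Step collab m (.markLoop op retry (.scan a i n :: s))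
        m (.markStatus op retry child (.scan a i n :: s))
  | scanRebuild {m op retry a i n s I child target parent j} :
      m.node a = some (.inner I) → I.children[i]? = some child →
      m.node child = some (.rebuild target parent j) →
      Step collab m (.markLoop op retry (.scan a i n :: s))
        m (.markCall op retry child (.scan a i n :: s))
  | statusFinished {m op retry child s J} :
      m.node child = some (.inner J) → J.status.2.1 = true →
      Step collab m (.markStatus op retry child s) m (.markReturn op retry J.status.1 s)
  | statusUnfinished {m op retry child s J} :
      m.node child = some (.inner J) → J.status.2.1 = false →
      Step collab m (.markStatus op retry child s) m (.markCall op retry child s)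
  | scanDone {m op retry a i n s I} :
      m.node a = some (.inner I) → I.children.length ≤ i →
      Step collab m (.markLoop op retry (.scan a i n :: s))
        (m.write a (I.casStatus Status.started (Status.finished n))) (.markReturn op retry n s)
  -- `createIdeal`, applied to the first `n` keys of the old subtree
  | createIdeal {m op retry n target parent i L t} :
      m.node op = some (.rebuild target parent i) → Contents m target L →
      t.toList = L.take n → t.IsRebuilt collab →
      Step collab m (.create op retry n) m (.install op retry t)
  | installSuccess {m op retry t target parent i I} :
      m.node op = some (.rebuild target parent i) →
      m.node parent = some (.inner I) → I.Matches i op →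
      Step collab m (.install op retry t)
        ((m.publish t).write parent (I.setChild i (m.next, []))) (.resume retry)
  | installFailed {m op retry t target parent i I} :
      m.node op = some (.rebuild target parent i) →
      m.node parent = some (.inner I) → ¬ I.Matches i op →
      Step collab m (.install op retry t) m (.resume retry)

/-! ### Executions with `p` threads -/

/-- A state of the system: the shared memory, and the local state of each of the `p` threads. -/
structure State (K : Type u) (V : Type v) (p : ℕ) where
  mem : Mem K V
  thread : Fin p → Pc K V

/-- The initial state: an empty C-IST, with no operation running. -/
def State.init (K : Type u) (V : Type v) (p : ℕ) : State K V p := ⟨Mem.init K V, fun _ => .idle⟩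

/-- One step of one thread; the scheduler is arbitrary. -/
def State.Next {K : Type u} {V : Type v} [LinearOrder K] {p : ℕ} (collab : Bool)
    (S S' : State K V p) : Prop :=
  ∃ j : Fin p, ∃ s : Pc K V,
    Step collab S.mem (S.thread j) S'.mem s ∧ S'.thread = Function.update S.thread j s

/-- The states that occur in executions. -/
def State.Reachable {K : Type u} {V : Type v} [LinearOrder K] {p : ℕ} (collab : Bool)
    (S : State K V p) : Prop :=
  Relation.ReflTransGen (State.Next collab) (State.init K V p) S

/-! ### Depth and keys -/

/-- `Mem.Path m d a`: there is a path of `d` pointers from the root to `a`. Besides the pointers to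
children, the pointers from `Rebuild` nodes to their targets count. -/
inductive Mem.Path {K : Type u} {V : Type v} (m : Mem K V) : ℕ → Addr → Prop
  | root : Mem.Path m 0 rootAddr
  | child {d : ℕ} {a c : Addr} {I : Inner K} :
      Mem.Path m d a → m.node a = some (.inner I) → c ∈ I.children → Mem.Path m (d + 1) c
  | target {d : ℕ} {a target parent : Addr} {i : ℕ} :
      Mem.Path m d a → m.node a = some (.rebuild target parent i) → Mem.Path m (d + 1) target

/-- The depth of the tree is `d`: the longest path from the root has `d` pointers. -/
def Mem.HasDepth {K : Type u} {V : Type v} (m : Mem K V) (d : ℕ) : Prop :=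
  IsGreatest {l : ℕ | ∃ a, m.Path l a} d

/-- The keys that the C-IST contains. -/
def Mem.keySet {K : Type u} {V : Type v} (m : Mem K V) : Set K :=
  {k | ∃ l a x, m.Path l a ∧ m.node a = some (.single k x)}

end CIST

namespace CIST

variable {K : Type u} {V : Type v}

/-! ### Shapes of freshly built trees -/

section Trees

/-! For an inner node v let s be its initial size and w the number of updates made below it since
its creation. An update counts from its successful DCSS on, even before its thread has incremented
the count fields (`upd`). The depth bound follows from two facts about s and w.

Few updates: 4w ≤ s + 8p at all times. An updating thread stays responsible for v until it reads a
count of v below the threshold, or until v lies below a descriptor. As long as v is not below one,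
the bound 4w ≤ s + 4·(number of responsible threads) persists: a new update brings a new responsible
thread, and a thread that drops out after reading a small count certifies that the counted updates
number at most s/4, while the uncounted ones are owed by threads that are still responsible. If
instead the thread finds a large count at some node, its announcement, successful or not, leaves
that node and the rest of its path covered. Once v is covered, every search that starts at the root
meets a descriptor before v, so only the at most p threads already inside can still update, once
each. This is the content of `Inv.free` and `Inv.enter`, preserved by `Effect.inv`.

Balance: s + w bounds the number of keys below v from above and s − w bounds it from below, and each
child has potential s' + w' smaller than s + w and at most √s + 3 + w. The shape of new trees gives
this at birth. An update raises w by one along its path and changes one slot of each node there by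
one (`Graft.pot_update`). A rebuild installs a tree whose number of keys lies between the two
potentials of the node it replaces, so the parent's inequalities survive (`Graft.pot_install`).

Together, the potential drops at every inner node of a path and is halved whenever it exceeds 16p +
120 (`levels_lt`), so a path has O(p + log) inner nodes, each preceded by at most one descriptor. At
the top, s − w ≤ n and the first fact give s + w ≤ 2n + 6p.

Concurrency enters through freezing. A DCSS needs a clean parent, so the pointers of a marked node
are final, and a completely marked subtree is immutable; hence all helpers copy the same keys. A
path remembered by a thread can be outdated only where it is frozen, and the parent in a successful
DCSS is not frozen, so at that moment the remembered path is the real one (`Chain.strong`). Finally,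
every key in a leaf is routed to that leaf by the search keys, so the leaves carry distinct keys and
n is their number (`Route.nodup`). -/

theorem Tree.size_inner (ks : List K) (d : ℕ) (ch : Fin d → Tree K V) :
    (Tree.inner ks d ch).size = ∑ i, (ch i).size := by
  simp only [Tree.size, Tree.toList, List.length_flatten, List.map_ofFn, List.sum_ofFn,
    Function.comp_apply]

theorem Tree.size_lt_of_pos {ks : List K} {d : ℕ} {ch : Fin d → Tree K V} (hd : 2 ≤ d)
    (hpos : ∀ i, 0 < (ch i).size) (i : Fin d) :
    (ch i).size + 1 ≤ (Tree.inner ks d ch).size := by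
  rw [Tree.size_inner]
  obtain ⟨j, hj⟩ : ∃ j : Fin d, j ≠ i := by
    have : Nontrivial (Fin d) := Fin.nontrivial_iff_two_le.2 hd
    exact exists_ne i
  have := Finset.add_le_sum (f := fun i => (ch i).size) (s := Finset.univ) (fun _ _ => Nat.zero_le _)
    (Finset.mem_univ i) (Finset.mem_univ j) hj.symm
  have := hpos j
  omega

theorem ceil_sqrt_le (n : ℕ) : ⌈Real.sqrt n⌉₊ ≤ Nat.sqrt n + 1 := by
  rw [Nat.ceil_le, Real.sqrt_le_left (by positivity)]
  have := Nat.lt_succ_sqrt n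
  rw [Nat.succ_eq_add_one] at this
  have h2 : (n : ℝ) ≤ ((Nat.sqrt n + 1) * (Nat.sqrt n + 1) : ℕ) := by exact_mod_cast this.le
  rw [sq]
  exact_mod_cast h2

theorem sqrt_le_ceil_sqrt (n : ℕ) : Nat.sqrt n ≤ ⌈Real.sqrt n⌉₊ := by
  have : (Nat.sqrt n : ℝ) ≤ Real.sqrt n := Real.nat_sqrt_le_real_sqrt
  exact_mod_cast this.trans (Nat.le_ceil _)

variable [LinearOrder K]

/-- Trees in which every subtree is properly smaller than the tree around it and not much larger
than the square root of its size, and in which every key is found by searching. -/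
def Tree.Good : Tree K V → Prop
  | .empty => True
  | .single _ _ => True
  | .inner ks d ch => ∀ i, (ch i).size + 1 ≤ (Tree.inner ks d ch).size ∧
      (ch i).size ≤ Nat.sqrt (Tree.inner ks d ch).size + 3 ∧
      (∀ e ∈ (ch i).toList, searchIndex ks e.1 = i) ∧ (ch i).Good

theorem searchIndex_eq_of_forall (ks : List K) (key : K) (i : ℕ) (hi : i ≤ ks.length)
    (h : ∀ (j : ℕ) (hj : j < ks.length), ks[j] ≤ key ↔ j < i) : searchIndex ks key = i := by
  have h1 : (ks.take i).countP (fun k => decide (k ≤ key)) = i := by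
    have : (ks.take i).countP (fun k => decide (k ≤ key)) = (ks.take i).length := by
      rw [List.countP_eq_length]
      intro a ha
      obtain ⟨j, hj, rfl⟩ := List.getElem_of_mem ha
      rw [List.length_take] at hj
      simpa using (h j (by omega)).2 (by omega)
    rw [this, List.length_take]
    omega
  have h2 : (ks.drop i).countP (fun k => decide (k ≤ key)) = 0 := by
    rw [List.countP_eq_zero]
    intro a ha
    obtain ⟨j, hj, rfl⟩ := List.getElem_of_mem ha
    rw [List.length_drop] at hj
    have := (h (i + j) (by omega)).not.2 (by omega)
    simpa using this
  rw [searchIndex, ← List.take_append_drop i ks, List.countP_append, h1, h2,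
    add_zero]

/-- The list `ks` is not assumed sorted, so a comparison with a distant separator is carried through
one stored key of each child in between. This is why all children have to be nonempty. -/
theorem Separates.searchIndex_eq {ks : List K} {d : ℕ} {ch : Fin d → Tree K V}
    (h : Separates ks d ch) (hpos : ∀ i, 0 < (ch i).size) (i : Fin d) :
    ∀ e ∈ (ch i).toList, searchIndex ks e.1 = i := by
  obtain ⟨hlen, hsep⟩ := h
  have hlow : ∀ (i : ℕ) (hi : i < d) (j : ℕ) (hj : j < i),
      ∀ e ∈ (ch ⟨i, hi⟩).toList, ks[j]'(by omega) ≤ e.1 := by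
    intro i
    induction i with
    | zero => intro _ j hj; omega
    | succ i ih =>
      intro hi j hj e he
      rcases Nat.lt_succ_iff_lt_or_eq.1 hj with hj | rfl
      · obtain ⟨e', he'⟩ := List.exists_mem_of_length_pos (hpos ⟨i, by omega⟩)
        exact (ih (by omega) j hj e' he').trans
          (((hsep i (by omega) hi).1 e' he').le.trans ((hsep i (by omega) hi).2 e he))
      · exact (hsep j (by omega) hi).2 e he
  have hup : ∀ (i : ℕ) (hi : i < d) (l : ℕ) (hl : i + l < ks.length),
      ∀ e ∈ (ch ⟨i, hi⟩).toList, e.1 < ks[i + l] := by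
    intro i hi l
    induction l with
    | zero => intro hl e he; exact (hsep i (by simpa using hl) (by omega)).1 e he
    | succ l ih =>
      intro hl e he
      obtain ⟨e', he'⟩ := List.exists_mem_of_length_pos (hpos ⟨i + l + 1, by omega⟩)
      exact ((ih (by omega) e he).trans_le ((hsep (i + l) (by omega) (by omega)).2 e' he')).trans
        ((hsep (i + l + 1) (by omega) (by omega)).1 e' he')
  intro e he
  refine searchIndex_eq_of_forall ks e.1 i (by omega) fun j hj => ⟨fun hle => ?_, fun hlt => ?_⟩
  · by_contra hij
    obtain ⟨l, rfl⟩ := Nat.exists_eq_add_of_le (not_lt.1 hij)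
    exact absurd (hup i i.2 l hj e he) (not_lt.2 hle)
  · exact hlow i i.2 j hlt e he

theorem Tree.IsIdeal.good : ∀ {t : Tree K V}, t.IsIdeal → t.Good
  | .empty, _ => trivial
  | .single _ _, _ => trivial
  | .inner ks d ch, h => by
    obtain ⟨hn, hd, -, hsep, hch⟩ := h
    have h1 : 1 ≤ Nat.sqrt (Tree.inner ks d ch).size := by
      rw [Nat.le_sqrt]; omega
    have hpos : ∀ i, 0 < (ch i).size := fun i => by
      have := sqrt_le_ceil_sqrt (Tree.inner ks d ch).size
      rcases (hch i).1 with h | h <;> omega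
    refine fun i => ⟨Tree.size_lt_of_pos hd hpos i, ?_, hsep.searchIndex_eq hpos i, (hch i).2.good⟩
    have := ceil_sqrt_le (Tree.inner ks d ch).size
    rcases (hch i).1 with h | h <;> omega

/-- With d = ⌊√n⌋ the even split gives parts of at most ⌊n/d⌋ + 1 keys, and ⌊n/d⌋ ≤ d + 2. This case
is the reason for the constant 3 in `Tree.Good`; ideal trees only need 1. -/
theorem Tree.IsCollaborative.good {t : Tree K V} (h : t.IsCollaborative)
    (hn : collaborationThreshold ≤ t.size) : t.Good := by
  match t, h with
  | .inner ks d ch, h =>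
    obtain ⟨hd, hsep, hch⟩ := h
    set n := (Tree.inner ks d ch).size with hn'
    have h48 : 48 ≤ n := hn
    have h6 : 6 ≤ d := by rw [hd, Nat.le_sqrt]; omega
    have hle : d * d ≤ n := by rw [hd]; exact Nat.sqrt_le n
    have hlt : n < (d + 1) * (d + 1) := by rw [hd]; exact Nat.lt_succ_sqrt n
    have h1 : d ≤ n / d := (Nat.le_div_iff_mul_le (by omega)).2 hle
    -- From n < (d + 1)² = d² + 2d + 1 ≤ d² + 3d.
    have h2 : n / d < d + 3 := (Nat.div_lt_iff_lt_mul (by omega)).2 (by nlinarith)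
    have hpos : ∀ i, 0 < (ch i).size := fun i => by
      rw [(hch i).1]; omega
    refine fun i => ⟨Tree.size_lt_of_pos (by omega) hpos i, ?_, hsep.searchIndex_eq hpos i,
      (hch i).2.good⟩
    rw [← hn', ← hd, (hch i).1]
    split_ifs <;> omega

theorem Tree.IsRebuilt.good {collab : Bool} {t : Tree K V} (h : t.IsRebuilt collab) : t.Good := by
  unfold Tree.IsRebuilt at h
  split_ifs at h with hc
  · exact h.good hc.2
  · exact h.good

/-- Leaves. -/
def Node.IsLeaf : Node K V → Prop
  | .empty => True
  | .single _ _ => True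
  | _ => False

/-- The number of keys in a leaf. -/
def Node.leafSize : Node K V → ℕ
  | .single _ _ => 1
  | _ => 0

/-- The two size bounds say that one update moves the potential of a slot by at most one in either
direction. The last clause serves routing: a replacement holds only the key that was searched for
and the key that was already there. -/
theorem replacement_good {c : Cmd K V} {leaf : Node K V} {t : Tree K V}
    (h : replacement c leaf = some t) :
    leaf.IsLeaf ∧ t.Good ∧ t.size ≤ leaf.leafSize + 1 ∧ leaf.leafSize ≤ t.size + 1 ∧
      ∀ e ∈ t.toList, e.1 = c.key ∨ ∃ x, leaf = .single e.1 x := by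
  have hs : ∀ (k : K) (x : V), (Tree.single k x).size = 1 := fun _ _ => rfl
  have hs0 : (Tree.empty : Tree K V).size = 0 := rfl
  have hgood : ∀ (k k' : K) (x x' : V), k < k' →
      (Tree.inner [k'] 2 ![.single k x, .single k' x']).Good := by
    intro k k' x x' hlt i
    have hsz : (Tree.inner [k'] 2 ![Tree.single k x, .single k' x']).size = 2 := by
      simp [Tree.size_inner, hs]
    rw [hsz]
    fin_cases i <;> simp [hs, Tree.toList, searchIndex, Tree.Good, hlt]
  rcases c with ⟨k, x⟩ | k <;> rcases leaf with _ | ⟨k₁, x₁⟩ | _ | _ <;>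
    simp only [replacement, reduceCtorEq, Option.some.injEq] at h
  · subst h; simp [Node.IsLeaf, Node.leafSize, Tree.Good, hs, Tree.toList, Cmd.key]
  · split_ifs at h with h1 h2 <;> simp only [Option.some.injEq] at h <;> subst h
    · simp [Node.IsLeaf, Node.leafSize, Tree.Good, hs, Tree.toList, Cmd.key]
    · refine ⟨trivial, hgood _ _ _ _ h2, ?_, ?_, ?_⟩ <;>
        simp [Node.leafSize, Tree.size_inner, hs, Tree.toList, Cmd.key]
    · refine ⟨trivial, hgood _ _ _ _ (lt_of_le_of_ne (not_lt.1 h2) h1), ?_, ?_, ?_⟩ <;>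
        simp [Node.leafSize, Tree.size_inner, hs, Tree.toList, Cmd.key]
  · split_ifs at h
    simp only [Option.some.injEq] at h
    subst h
    simp [Node.IsLeaf, Node.leafSize, Tree.Good, hs0, Tree.toList]

end Trees

/-! ### Marking, covering, and the evolution of pointers -/

section Relations

/-- The node at `a` is an inner node. -/
def IsInner (m : Mem K V) (a : Addr) : Prop := ∃ I, m.node a = some (.inner I)

/-- The node at `a` is a leaf. -/
def IsLeaf (m : Mem K V) (a : Addr) : Prop := ∃ nd, m.node a = some nd ∧ nd.IsLeaf

/-- Slot `i` of `b` is a pointer to `c`; a descriptor has one slot. -/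
def Ptr (m : Mem K V) (b : Addr) (i : ℕ) (c : Addr) : Prop :=
  (∃ I, m.node b = some (.inner I) ∧ I.children[i]? = some c) ∨
    (i = 0 ∧ ∃ parent j, m.node b = some (.rebuild c parent j))

/-- `Frozen m a L`: the leaves below `a` hold `L`, and all inner nodes below `a` are marked. -/
inductive Frozen (m : Mem K V) : Addr → List (K × V) → Prop
  | empty {a : Addr} : m.node a = some .empty → Frozen m a []
  | single {a : Addr} {k : K} {x : V} : m.node a = some (.single k x) → Frozen m a [(k, x)]
  | inner {a : Addr} {I : Inner K} (f : Addr → List (K × V)) :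
      m.node a = some (.inner I) → I.status ≠ Status.clean →
      (∀ c ∈ I.children, Frozen m c (f c)) → Frozen m a (I.children.flatMap f)
  | rebuild {a target parent : Addr} {index : ℕ} {L : List (K × V)} :
      m.node a = some (.rebuild target parent index) → Frozen m target L → Frozen m a L

/-- The inner node at `a` lies below a descriptor. -/
inductive Covered (m : Mem K V) : Addr → Prop
  | target {a D parent : Addr} {j : ℕ} : m.node D = some (.rebuild a parent j) → Covered m a
  | child {b c : Addr} {I : Inner K} : Covered m b → m.node b = some (.inner I) →
      c ∈ I.children → IsInner m c → Covered m c

/-- Slot `i` of `b` leads to `a`, either directly or through a descriptor. -/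
def SLink (m : Mem K V) (b : Addr) (i : ℕ) (a : Addr) : Prop :=
  ∃ I c, m.node b = some (.inner I) ∧ I.children[i]? = some c ∧
    (c = a ∨ ∃ parent j, m.node c = some (.rebuild a parent j))

/-- Slot `i` of `b` leads to `a`, unless `a` is frozen. -/
def FLink (m : Mem K V) (b : Addr) (i : ℕ) (a : Addr) : Prop :=
  (∃ L, Frozen m a L) ∨ SLink m b i a

/-- The path leads from `b` to `n`, as far as it is not frozen. -/
def Chain (m : Mem K V) : Addr → List (Addr × ℕ) → Addr → Prop
  | b, [], n => b = n
  | b, (a, i) :: q, n => FLink m b i a ∧ IsInner m a ∧ Chain m a q n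

/-- The path leads from `b` to `n`. -/
def SChain (m : Mem K V) : Addr → List (Addr × ℕ) → Addr → Prop
  | b, [], n => b = n
  | b, (a, i) :: q, n => SLink m b i a ∧ IsInner m a ∧ SChain m a q n

/-- How a child pointer may change from `c` to `c'`. -/
def SlotEvolves (m m' : Mem K V) (c c' : Addr) : Prop :=
  c' = c ∨ IsLeaf m c ∨ (IsInner m c ∧ ∃ parent j, m'.node c' = some (.rebuild c parent j)) ∨
    ∃ t parent j L, m.node c = some (.rebuild t parent j) ∧ Frozen m t L

/-- How the memory may change. -/
structure Evolve (m m' : Mem K V) : Prop where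
  outer : ∀ {a nd}, m.node a = some nd → (∀ I, nd ≠ .inner I) → m'.node a = some nd
  inner : ∀ {a} {I : Inner K}, m.node a = some (.inner I) → ∃ I' : Inner K, m'.node a = some (.inner I') ∧
    I'.keys = I.keys ∧ I'.initSize = I.initSize ∧ I'.children.length = I.children.length ∧
    (I.status ≠ Status.clean → I'.status ≠ Status.clean ∧ I'.children = I.children) ∧
    ∀ (i : ℕ) (c : Addr), I.children[i]? = some c → ∃ c', I'.children[i]? = some c' ∧ SlotEvolves m m' c c'

theorem Evolve.refl (m : Mem K V) : Evolve m m :=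
  ⟨fun h _ => h, fun {_ I} h => ⟨I, h, rfl, rfl, rfl, fun hs => ⟨hs, rfl⟩,
    fun _ c hc => ⟨c, hc, .inl rfl⟩⟩⟩

variable {m m' : Mem K V}

theorem Evolve.rebuild (h : Evolve m m') {a t q : Addr} {j : ℕ}
    (ha : m.node a = some (.rebuild t q j)) : m'.node a = some (.rebuild t q j) :=
  h.outer ha (by simp)

theorem Evolve.isInner (h : Evolve m m') {a : Addr} (ha : IsInner m a) : IsInner m' a := by
  obtain ⟨I, hI⟩ := ha
  obtain ⟨I', hI', -⟩ := h.inner hI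
  exact ⟨I', hI'⟩

theorem Evolve.isInner_iff (h : Evolve m m') {a : Addr} {nd : Node K V} (hnd : m.node a = some nd) :
    IsInner m' a ↔ IsInner m a := by
  refine ⟨fun ⟨I', hI'⟩ => ?_, h.isInner⟩
  by_cases hin : ∃ I, nd = .inner I
  · obtain ⟨I, rfl⟩ := hin
    exact ⟨I, hnd⟩
  · have := h.outer hnd fun I hI => hin ⟨I, hI⟩
    rw [hI'] at this
    exact absurd ⟨I', (Option.some.inj this).symm⟩ hin

/-- Marked nodes stay marked and keep their children, and leaves and descriptors never change, so a
frozen region is immutable. -/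
theorem Frozen.mono (h : Evolve m m') {a : Addr} {L : List (K × V)} (hL : Frozen m a L) :
    Frozen m' a L := by
  induction hL with
  | empty ha => exact .empty (h.outer ha (by simp))
  | single ha => exact .single (h.outer ha (by simp))
  | rebuild ha _ ih => exact .rebuild (h.rebuild ha) ih
  | inner f ha hs _ ih =>
    obtain ⟨I', hI', -, -, -, hst, -⟩ := h.inner ha
    obtain ⟨hs', hch⟩ := hst hs
    rw [← hch]
    exact .inner f hI' hs' fun c hc => ih c (hch ▸ hc)

theorem Frozen.contents {a : Addr} {L : List (K × V)} (hL : Frozen m a L) : Contents m a L := by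
  induction hL with
  | empty ha => exact .empty ha
  | single ha => exact .single ha
  | rebuild ha _ ih => exact .rebuild ha ih
  | inner f ha hs _ ih => exact .inner f ha ih

theorem Contents.unique {a : Addr} {L L' : List (K × V)} (hL : Contents m a L)
    (hL' : Contents m a L') : L = L' := by
  induction hL generalizing L' with
  | empty ha => cases hL' <;> simp_all
  | single ha => cases hL' <;> simp_all
  | rebuild ha _ ih =>
    cases hL' with
    | rebuild ha' h' =>
      rw [ha] at ha'
      cases ha'
      exact ih h'
    | _ => simp_all
  | inner f ha hf ih =>
    cases hL' with
    | inner f' ha' hf' =>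
      rw [ha] at ha'
      cases ha'
      exact List.flatMap_congr fun c hc => ih c hc (hf' c hc)
    | _ => simp_all

theorem Frozen.unique {a : Addr} {L L' : List (K × V)} (hL : Frozen m a L)
    (hL' : Frozen m a L') : L = L' :=
  hL.contents.unique hL'.contents

theorem Frozen.marked {a : Addr} {L : List (K × V)} {I : Inner K} (hL : Frozen m a L)
    (ha : m.node a = some (.inner I)) : I.status ≠ Status.clean := by
  cases hL <;> simp_all

/-- Freezing is inherited downwards. Read backwards, this spreads "not frozen" from the end of a
path up to its beginning. -/
theorem Frozen.slink {a b : Addr} {i : ℕ} {L : List (K × V)} (hL : Frozen m b L)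
    (h : SLink m b i a) : ∃ L, Frozen m a L := by
  obtain ⟨I, c, hb, hc, h⟩ := h
  cases hL with
  | inner f hb' hs hf =>
    rw [hb] at hb'
    cases hb'
    have hfc := hf c (List.mem_of_getElem? hc)
    rcases h with rfl | ⟨q, j, h⟩
    · exact ⟨_, hfc⟩
    · generalize f c = Lc at hfc
      cases hfc with
      | rebuild h' h'' => rw [h] at h'; cases h'; exact ⟨_, h''⟩
      | _ => simp_all
  | _ => simp_all

/-- A slot that points directly to an inner node can change only by the insertion of a descriptor,
and then that node is itself a target. A replaced descriptor does no harm, since the descriptor node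
stays in memory. -/
theorem Covered.mono (h : Evolve m m') {a : Addr} (ha : Covered m a) : Covered m' a := by
  induction ha with
  | target hD => exact .target (h.rebuild hD)
  | child hb hI hc hin ih =>
    obtain ⟨I', hI', -, -, -, -, hslot⟩ := h.inner hI
    obtain ⟨i, hi⟩ := List.getElem?_of_mem hc
    obtain ⟨c', hc', hev⟩ := hslot _ _ hi
    have hin' := hin
    obtain ⟨J, hJ⟩ := hin
    rcases hev with rfl | ⟨nd, hnd, hl⟩ | ⟨-, q, j, hq⟩ | ⟨t, q, j, L, hq, -⟩
    · exact .child ih hI' (List.mem_of_getElem? hc') (h.isInner hin')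
    · rw [hJ] at hnd; cases hnd; exact hl.elim
    · exact .target hq
    · rw [hJ] at hq; cases hq

/-- A link to an inner node is lost only when a descriptor above it is replaced, and by then its
target is frozen. The frozen alternative in `FLink` thus makes the relation stable under all steps.
-/
theorem FLink.mono (h : Evolve m m') {b a : Addr} {i : ℕ} (ha : IsInner m a)
    (hl : FLink m b i a) : FLink m' b i a := by
  rcases hl with ⟨L, hL⟩ | ⟨I, c, hI, hc, hca⟩
  · exact .inl ⟨L, hL.mono h⟩
  obtain ⟨I', hI', -, -, -, -, hslot⟩ := h.inner hI
  obtain ⟨c', hc', hev⟩ := hslot _ _ hc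
  obtain ⟨J, hJ⟩ := ha
  rcases hca with rfl | ⟨q, j, hq⟩
  · rcases hev with rfl | ⟨nd, hnd, hl⟩ | ⟨-, q, j, hq⟩ | ⟨t, q, j, L, hq, -⟩
    · exact .inr ⟨I', _, hI', hc', .inl rfl⟩
    · rw [hJ] at hnd; cases hnd; exact hl.elim
    · exact .inr ⟨I', _, hI', hc', .inr ⟨q, j, hq⟩⟩
    · rw [hJ] at hq; cases hq
  · rcases hev with rfl | ⟨nd, hnd, hl⟩ | ⟨⟨J', hJ'⟩, -⟩ | ⟨t, q', j', L, hq', hL⟩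
    · exact .inr ⟨I', _, hI', hc', .inr ⟨q, j, h.rebuild hq⟩⟩
    · rw [hq] at hnd; cases hnd; exact hl.elim
    · rw [hq] at hJ'; cases hJ'
    · rw [hq] at hq'
      cases hq'
      exact .inl ⟨L, hL.mono h⟩

theorem Chain.mono (h : Evolve m m') {b n : Addr} {path : List (Addr × ℕ)}
    (hc : Chain m b path n) : Chain m' b path n := by
  induction path generalizing b with
  | nil => exact hc
  | cons x q ih => exact ⟨hc.1.mono h hc.2.1, h.isInner hc.2.1, ih hc.2.2⟩

theorem Chain.snoc {b n a : Addr} {i : ℕ} {path : List (Addr × ℕ)} (hc : Chain m b path n)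
    (hl : FLink m n i a) (ha : IsInner m a) : Chain m b (path ++ [(a, i)]) a := by
  induction path generalizing b with
  | nil => cases hc; exact ⟨hl, ha, rfl⟩
  | cons x q ih => exact ⟨hc.1, hc.2.1, ih hc.2.2⟩

theorem Chain.isInner_of_mem {b n a : Addr} {path : List (Addr × ℕ)} (hc : Chain m b path n)
    (ha : a ∈ path.map Prod.fst) : IsInner m a := by
  induction path generalizing b with
  | nil => simp at ha
  | cons x q ih =>
    rcases List.mem_cons.1 ha with rfl | ha
    · exact hc.2.1
    · exact ih hc.2.2 ha

/-- Everything before an unfrozen end is linked. -/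
theorem Chain.strong {b n : Addr} {path : List (Addr × ℕ)} (hc : Chain m b path n)
    (hn : ¬ ∃ L, Frozen m n L) : SChain m b path n ∧ ¬ ∃ L, Frozen m b L := by
  induction path generalizing b with
  | nil => cases hc; exact ⟨rfl, hn⟩
  | cons x q ih =>
    obtain ⟨h1, h2⟩ := ih hc.2.2
    have hs := hc.1.resolve_left h2
    exact ⟨⟨hs, hc.2.1, h1⟩, fun ⟨L, hL⟩ => h2 (hL.slink hs)⟩

end Relations

/-! ### Pointer structure under grafts and field writes -/

section Memory

/-- The invariants of the shared memory. -/
structure MemInv (m : Mem K V) : Prop where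
  alloc : ∀ {a : Addr} {nd}, m.node a = some nd → a.1 < m.next
  ptr_alloc : ∀ {b c : Addr} {i : ℕ}, Ptr m b i c → ∃ nd, m.node c = some nd
  ptr_unique : ∀ {b b' c : Addr} {i i' : ℕ}, Ptr m b i c → Ptr m b' i' c → b = b' ∧ i = i'
  root : ∃ I c, m.node rootAddr = some (.inner I) ∧ I.children = [c]
  root_ptr : ∀ {b : Addr} {i : ℕ}, ¬ Ptr m b i rootAddr
  target_inner : ∀ {D t q : Addr} {j : ℕ}, m.node D = some (.rebuild t q j) → IsInner m t
  marked : ∀ {a : Addr} {I : Inner K}, m.node a = some (.inner I) → I.status ≠ Status.clean →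
    Covered m a
  finished : ∀ {a : Addr} {I : Inner K}, m.node a = some (.inner I) → I.status.2.1 = true →
    ∃ L, Frozen m a L ∧ L.length = I.status.1

/-- `m'` arises from `m` by storing the nodes `fresh` in a new block, and redirecting slot `i` of
`n` from `c` to the new block. -/
structure Graft (m m' : Mem K V) (n : Addr) (I : Inner K) (i : ℕ) (c : Addr)
    (fresh : List ℕ → Option (Node K V)) : Prop where
  hn : m.node n = some (.inner I)
  hm : I.Matches i c
  lt : n.1 < m.next
  hn' : m'.node n = some (.inner (I.setChild i (m.next, [])))
  old : ∀ {x : Addr}, x ≠ n → x.1 ≠ m.next → m'.node x = m.node x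
  new : ∀ pos, m'.node (m.next, pos) = fresh pos
  next : m'.next = m.next + 1

/-- The nodes of a descriptor's block. -/
def descriptorBlock (K : Type u) (V : Type v) (c n : Addr) (i : ℕ) (pos : List ℕ) :
    Option (Node K V) :=
  if pos = [] then some (.rebuild c n i) else none

/-- The nodes of a tree's block. -/
def treeBlock (t : Tree K V) (b : ℕ) (pos : List ℕ) : Option (Node K V) :=
  (t.subtree pos).map (Tree.toNode b pos)

variable {m m' : Mem K V} {n c : Addr} {I : Inner K} {i : ℕ}
  {fresh : List ℕ → Option (Node K V)}

theorem Graft.publish (hinv : MemInv m) (t : Tree K V) (hn : m.node n = some (.inner I))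
    (hm : I.Matches i c) :
    Graft m ((m.publish t).write n (I.setChild i (m.next, []))) n I i c (treeBlock t m.next) := by
  have hlt := hinv.alloc hn
  refine ⟨hn, hm, hlt, by simp [Mem.write], fun hx hx' => ?_, fun pos => ?_, rfl⟩
  · simp [Mem.write, Mem.publish, hx, hx']
  · have : (m.next, pos) ≠ n := fun h => by rw [← h] at hlt; exact lt_irrefl _ hlt
    simp [Mem.write, Mem.publish, this, treeBlock]

theorem Graft.descriptor (hinv : MemInv m) (hn : m.node n = some (.inner I))
    (hm : I.Matches i c) :
    Graft m ((m.descriptor c n i).write n (I.setChild i (m.next, []))) n I i c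
      (descriptorBlock K V c n i) := by
  have hlt := hinv.alloc hn
  refine ⟨hn, hm, hlt, by simp [Mem.write], fun {x} hx hx' => ?_, fun pos => ?_, rfl⟩
  · have : x ≠ (m.next, []) := fun h => hx' (by rw [h])
    simp [Mem.write, Mem.descriptor, hx, this]
  · have : (m.next, pos) ≠ n := fun h => by rw [← h] at hlt; exact lt_irrefl _ hlt
    by_cases hp : pos = []
    · subst hp
      simp [Mem.write, Mem.descriptor, this, descriptorBlock]
    · have hnone : m.node (m.next, pos) = none := by
        by_contra h
        obtain ⟨nd, hnd⟩ := Option.ne_none_iff_exists'.1 h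
        exact lt_irrefl _ (hinv.alloc hnd)
      simp [Mem.write, Mem.descriptor, this, descriptorBlock, hp, hnone]

theorem Tree.subtree_snoc {t : Tree K V} {pos : List ℕ} {ks : List K} {d : ℕ}
    {ch : Fin d → Tree K V} (h : t.subtree pos = some (.inner ks d ch)) {j : ℕ} (hj : j < d) :
    t.subtree (pos ++ [j]) = some (ch ⟨j, hj⟩) := by
  induction pos generalizing t with
  | nil =>
    simp only [Tree.subtree, Option.some.injEq] at h
    subst h
    simp [Tree.subtree, hj]
  | cons x pos ih =>
    cases t with
    | inner ks' d' ch' =>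
      simp only [Tree.subtree, List.cons_append] at h ⊢
      split_ifs at h ⊢ with hx
      exact ih h
    | _ => simp [Tree.subtree] at h

theorem treeBlock_inner {t : Tree K V} {b : ℕ} {pos : List ℕ} {J : Inner K}
    (h : treeBlock t b pos = some (.inner J)) : ∃ ks d ch,
      t.subtree pos = some (.inner ks d ch) ∧ J.keys = ks ∧
      J.children = (List.range d).map (fun i => (b, pos ++ [i])) ∧ J.status = Status.clean ∧
      J.count = 0 ∧ J.initSize = (Tree.inner ks d ch).size := by
  rw [treeBlock, Option.map_eq_some_iff] at h
  obtain ⟨s, hs, h⟩ := h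
  cases s with
  | inner ks d ch =>
    cases h
    exact ⟨ks, d, ch, hs, rfl, rfl, rfl, rfl, rfl⟩
  | _ => cases h

theorem treeBlock_rebuild {t : Tree K V} {b : ℕ} {pos : List ℕ} {a q : Addr} {j : ℕ} :
    treeBlock t b pos ≠ some (.rebuild a q j) := by
  intro h
  rw [treeBlock, Option.map_eq_some_iff] at h
  obtain ⟨s, hs, h⟩ := h
  cases s <;> cases h

theorem Graft.slot (g : Graft m m' n I i c fresh) : Ptr m n i c := .inl ⟨I, g.hn, g.hm.1⟩

theorem Graft.ptr_old (g : Graft m m' n I i c fresh) {x y : Addr} {j : ℕ} (hx : x.1 ≠ m.next)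
    (h : Ptr m' x j y) :
    (Ptr m x j y ∧ ¬ (x = n ∧ j = i)) ∨ (x = n ∧ j = i ∧ y = (m.next, [])) := by
  by_cases hxn : x = n
  · subst hxn
    rcases h with ⟨J, hJ, hj⟩ | ⟨-, q, l, hq⟩
    · rw [g.hn'] at hJ
      cases hJ
      rw [Inner.setChild] at hj
      by_cases hji : j = i
      · subst hji
        rw [List.getElem?_set] at hj
        split_ifs at hj with h1 h2
        · exact .inr ⟨rfl, rfl, (Option.some.inj hj).symm⟩
        · exact absurd rfl h1
      · rw [List.getElem?_set_ne (Ne.symm hji)] at hj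
        exact .inl ⟨.inl ⟨I, g.hn, hj⟩, fun h => hji h.2⟩
    · rw [g.hn'] at hq
      cases hq
  · refine .inl ⟨?_, fun h => hxn h.1⟩
    unfold Ptr at h ⊢
    rwa [g.old hxn hx] at h

/-- Only `n` changes among the old nodes, and the DCSS has found its status clean, so the clause
about marked nodes is vacuous there. -/
theorem Graft.evolve (g : Graft m m' n I i c fresh) (hinv : MemInv m)
    (hev : SlotEvolves m m' c (m.next, [])) : Evolve m m' := by
  constructor
  · intro a nd ha hnd
    rw [g.old _ (hinv.alloc ha).ne, ha]
    rintro rfl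
    rw [g.hn] at ha
    cases ha
    exact hnd I rfl
  · intro a J hJ
    by_cases ha : a = n
    · subst ha
      rw [g.hn] at hJ
      cases hJ
      refine ⟨_, g.hn', rfl, rfl, by simp [Inner.setChild], fun hs => absurd g.hm.2 hs,
        fun l d hl => ?_⟩
      by_cases hli : l = i
      · subst hli
        rw [g.hm.1] at hl
        cases hl
        have hlen := (List.getElem?_eq_some_iff.1 g.hm.1).1
        exact ⟨_, by simp [Inner.setChild, hlen], hev⟩
      · exact ⟨d, by simp [Inner.setChild, List.getElem?_set_ne (Ne.symm hli), hl], .inl rfl⟩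
    · exact ⟨J, by rw [g.old ha (hinv.alloc hJ).ne, hJ], rfl, rfl, rfl, fun hs => ⟨hs, rfl⟩,
        fun l d hl => ⟨d, hl, .inl rfl⟩⟩

/-- The hypothesis `hptr` covers both kinds of blocks: a tree points only into itself, and a
descriptor has one pointer, to `c`. The latter does not spoil uniqueness of incoming pointers,
because the only old pointer to `c` is the one just redirected. -/
theorem Graft.memInv (g : Graft m m' n I i c fresh) (hinv : MemInv m)
    (hev : SlotEvolves m m' c (m.next, []))
    (h0 : ∃ nd, m'.node (m.next, []) = some nd)
    (hptr : ∀ pos j y, Ptr m' (m.next, pos) j y →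
      (y = (m.next, pos ++ [j]) ∧ ∃ nd, m'.node y = some nd) ∨ (y = c ∧ pos = [] ∧ j = 0))
    (htarget : ∀ pos t q j, m'.node (m.next, pos) = some (.rebuild t q j) → IsInner m' t)
    (hclean : ∀ pos J, m'.node (m.next, pos) = some (.inner J) → J.status = Status.clean) :
    MemInv m' := by
  have ev := g.evolve hinv hev
  have hold : ∀ {x : Addr} {nd}, m.node x = some nd → ∃ nd', m'.node x = some nd' := by
    intro x nd hx
    by_cases hxn : x = n
    · exact ⟨_, hxn ▸ g.hn'⟩
    · exact ⟨nd, by rw [g.old hxn (hinv.alloc hx).ne, hx]⟩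
  -- the pointers of `m'`
  have key : ∀ {x y : Addr} {j : ℕ}, Ptr m' x j y →
      (Ptr m x j y ∧ ¬ (x = n ∧ j = i) ∧ y.1 ≠ m.next) ∨ (x = n ∧ j = i ∧ y = (m.next, [])) ∨
      (∃ pos, x = (m.next, pos) ∧ y = (m.next, pos ++ [j]) ∧ ∃ nd, m'.node y = some nd) ∨
      (y = c ∧ x = (m.next, []) ∧ j = 0) := by
    intro x y j h
    by_cases hx : x.1 = m.next
    · obtain ⟨b, pos⟩ := x
      simp only at hx
      subst hx
      rcases hptr pos j y h with ⟨h1, h2⟩ | ⟨h1, rfl, h2⟩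
      · exact .inr (.inr (.inl ⟨pos, rfl, h1, h2⟩))
      · exact .inr (.inr (.inr ⟨h1, rfl, h2⟩))
    · rcases g.ptr_old hx h with ⟨h1, h2⟩ | h1
      · obtain ⟨nd, hnd⟩ := hinv.ptr_alloc h1
        exact .inl ⟨h1, h2, (hinv.alloc hnd).ne⟩
      · exact .inr (.inl h1)
  obtain ⟨ndc, hndc⟩ := hinv.ptr_alloc g.slot
  have hc : c.1 ≠ m.next := (hinv.alloc hndc).ne
  have hroot0 : rootAddr.1 ≠ m.next := by
    obtain ⟨J, -, hJ, -⟩ := hinv.root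
    exact (hinv.alloc hJ).ne
  constructor
  · intro a nd ha
    rw [g.next]
    by_cases hx : a.1 = m.next
    · omega
    · by_cases han : a = n
      · exact han ▸ g.lt.trans (Nat.lt_succ_self _)
      · rw [g.old han hx] at ha
        exact (hinv.alloc ha).trans (Nat.lt_succ_self _)
  · intro b y j h
    rcases key h with ⟨h, -⟩ | ⟨-, -, rfl⟩ | ⟨-, -, -, h⟩ | ⟨rfl, -⟩
    · obtain ⟨nd, hnd⟩ := hinv.ptr_alloc h
      exact hold hnd
    · exact h0
    · exact h
    · exact hold hndc
  · intro b b' y j j' h h'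
    rcases key h with ⟨h1, h2, h3⟩ | ⟨rfl, rfl, rfl⟩ | ⟨pos, rfl, rfl, -⟩ | ⟨rfl, rfl, rfl⟩ <;>
      rcases key h' with ⟨h1', h2', h3'⟩ | ⟨rfl, rfl, hy⟩ | ⟨pos', rfl, hy, -⟩ | ⟨hy, rfl, rfl⟩
    · exact hinv.ptr_unique h1 h1'
    · exact absurd (by rw [hy]) h3
    · exact absurd (by rw [hy]) h3
    · exact absurd (hinv.ptr_unique (hy ▸ h1) g.slot) h2
    · exact absurd rfl h3'
    · exact ⟨rfl, rfl⟩
    · simp at hy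
    · exact absurd (by rw [← hy]) hc
    · exact absurd rfl h3'
    · simp at hy
    · simp only [Prod.mk.injEq, true_and] at hy
      obtain ⟨h1, h2⟩ := List.append_inj' hy rfl
      exact ⟨by rw [h1], by simpa using h2⟩
    · exact absurd (by rw [← hy]) hc
    · exact absurd (hinv.ptr_unique h1' g.slot) h2'
    · exact absurd (by rw [hy]) hc
    · exact absurd (by rw [hy]) hc
    · exact ⟨rfl, rfl⟩
  · obtain ⟨J, d, hJ, hd⟩ := hinv.root
    obtain ⟨J', hJ', -, -, hlen, -⟩ := ev.inner hJ
    rw [hd] at hlen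
    obtain ⟨d', hd'⟩ := List.length_eq_one_iff.1 hlen
    exact ⟨J', d', hJ', hd'⟩
  · intro b j h
    rcases key h with ⟨h, -⟩ | ⟨-, -, h⟩ | ⟨pos, -, h, -⟩ | ⟨h, -⟩
    · exact hinv.root_ptr h
    · exact hroot0 (by rw [h])
    · exact hroot0 (by rw [h])
    · exact hinv.root_ptr (h ▸ g.slot)
  · intro D t q j hD
    by_cases hx : D.1 = m.next
    · exact htarget D.2 t q j (by rw [← hx]; exact hD)
    · by_cases hDn : D = n
      · rw [hDn, g.hn'] at hD
        cases hD
      · rw [g.old hDn hx] at hD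
        exact ev.isInner (hinv.target_inner hD)
  · intro a J hJ hs
    by_cases hx : a.1 = m.next
    · exact absurd (hclean a.2 J (by rw [← hx]; exact hJ)) hs
    · by_cases han : a = n
      · rw [han, g.hn'] at hJ
        cases hJ
        exact absurd g.hm.2 hs
      · rw [g.old han hx] at hJ
        exact (hinv.marked hJ hs).mono ev
  · intro a J hJ hs
    by_cases hx : a.1 = m.next
    · rw [hclean a.2 J (by rw [← hx]; exact hJ)] at hs
      cases hs
    · by_cases han : a = n
      · rw [han, g.hn'] at hJ
        cases hJ
        rw [Inner.setChild, g.hm.2] at hs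
        cases hs
      · rw [g.old han hx] at hJ
        obtain ⟨L, hL, hlen⟩ := hinv.finished hJ hs
        exact ⟨L, hL.mono ev, hlen⟩

theorem Graft.treeBlock_ptr {t : Tree K V} (g : Graft m m' n I i c (treeBlock t m.next))
    {pos : List ℕ} {j : ℕ} {y : Addr} (h : Ptr m' (m.next, pos) j y) :
    y = (m.next, pos ++ [j]) ∧ ∃ ks d ch, ∃ hj : j < d,
      t.subtree pos = some (.inner ks d ch) ∧
      m'.node y = some (Tree.toNode m.next (pos ++ [j]) (ch ⟨j, hj⟩)) := by
  rcases h with ⟨J, hJ, hj⟩ | ⟨-, q, l, hq⟩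
  · rw [g.new] at hJ
    obtain ⟨ks, d, ch, hs, -, hch, -⟩ := treeBlock_inner hJ
    rw [hch, List.getElem?_map, Option.map_eq_some_iff] at hj
    obtain ⟨l, hl, rfl⟩ := hj
    obtain ⟨hlt, hl⟩ := List.getElem?_eq_some_iff.1 hl
    rw [List.length_range] at hlt
    rw [List.getElem_range] at hl
    subst hl
    refine ⟨rfl, ks, d, ch, hlt, hs, ?_⟩
    rw [g.new, treeBlock, Tree.subtree_snoc hs hlt, Option.map_some]
  · rw [g.new] at hq
    exact absurd hq treeBlock_rebuild

theorem Graft.memInv_publish {t : Tree K V} (g : Graft m m' n I i c (treeBlock t m.next))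
    (hinv : MemInv m) (hev : SlotEvolves m m' c (m.next, [])) : MemInv m' := by
  refine g.memInv hinv hev ?_ ?_ ?_ ?_
  · rw [g.new]
    cases t <;> exact ⟨_, rfl⟩
  · intro pos j y h
    obtain ⟨h1, ks, d, ch, hj, -, h2⟩ := g.treeBlock_ptr h
    exact .inl ⟨h1, _, h2⟩
  · intro pos a q j h
    rw [g.new] at h
    exact absurd h treeBlock_rebuild
  · intro pos J h
    rw [g.new] at h
    obtain ⟨-, -, -, -, -, -, h, -⟩ := treeBlock_inner h
    exact h

theorem Graft.descriptor_slotEvolves (g : Graft m m' n I i c (descriptorBlock K V c n i))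
    (hc : IsInner m c) : SlotEvolves m m' c (m.next, []) :=
  .inr (.inr (.inl ⟨hc, n, i, by rw [g.new, descriptorBlock, if_pos rfl]⟩))

theorem Graft.memInv_descriptor (g : Graft m m' n I i c (descriptorBlock K V c n i))
    (hinv : MemInv m) (hc : IsInner m c) : MemInv m' := by
  have hev := g.descriptor_slotEvolves hc
  have ev := g.evolve hinv hev
  refine g.memInv hinv hev ?_ ?_ ?_ ?_
  · exact ⟨_, by rw [g.new, descriptorBlock, if_pos rfl]⟩
  · intro pos j y h
    rcases h with ⟨J, hJ, hj⟩ | ⟨rfl, q, l, hq⟩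
    · rw [g.new, descriptorBlock] at hJ
      split_ifs at hJ
      cases hJ
    · rw [g.new, descriptorBlock] at hq
      split_ifs at hq with hp
      cases hq
      exact .inr ⟨rfl, hp, rfl⟩
  · intro pos a q j h
    rw [g.new, descriptorBlock] at h
    split_ifs at h with hp
    cases h
    exact ev.isInner hc
  · intro pos J h
    rw [g.new, descriptorBlock] at h
    split_ifs at h with hp
    cases h

/-- `I'` differs from `I` in the auxiliary fields only. -/
structure Inner.Same (I I' : Inner K) : Prop where
  keys : I'.keys = I.keys
  initSize : I'.initSize = I.initSize
  children : I'.children = I.children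
  status : I.status ≠ Status.clean → I'.status ≠ Status.clean

theorem Evolve.write {a : Addr} {I I' : Inner K} (ha : m.node a = some (.inner I))
    (h : I.Same I') : Evolve m (m.write a I') := by
  constructor
  · intro b nd hb hnd
    have : b ≠ a := by
      rintro rfl
      rw [ha] at hb
      cases hb
      exact hnd I rfl
    simpa [Mem.write, this] using hb
  · intro b J hJ
    by_cases hb : b = a
    · subst hb
      rw [ha] at hJ
      cases hJ
      exact ⟨I', by simp [Mem.write], h.keys, h.initSize, by rw [h.children],
        fun hs => ⟨h.status hs, h.children⟩, fun l d hl => ⟨d, by rw [h.children, hl], .inl rfl⟩⟩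
    · exact ⟨J, by simpa [Mem.write, hb] using hJ, rfl, rfl, rfl, fun hs => ⟨hs, rfl⟩,
        fun l d hl => ⟨d, hl, .inl rfl⟩⟩

theorem ptr_write {a : Addr} {I I' : Inner K} (ha : m.node a = some (.inner I))
    (h : I.Same I') {b y : Addr} {j : ℕ} : Ptr (m.write a I') b j y ↔ Ptr m b j y := by
  by_cases hb : b = a
  · subst hb
    simp [Ptr, Mem.write, ha, h.children]
  · simp [Ptr, Mem.write, hb]

/-- Auxiliary fields are irrelevant to the pointer structure. Only a new status needs justification:
marking requires the node to be covered, and finishing requires its subtree to be frozen with the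
recorded number of keys. -/
theorem MemInv.write (hinv : MemInv m) {a : Addr} {I I' : Inner K}
    (ha : m.node a = some (.inner I)) (h : I.Same I')
    (hcov : I'.status ≠ Status.clean → Covered m a)
    (hfin : I'.status.2.1 = true →
      ∃ L, Frozen (m.write a I') a L ∧ L.length = I'.status.1) : MemInv (m.write a I') := by
  have ev := Evolve.write ha h
  have hnode : ∀ {b : Addr}, b ≠ a → (m.write a I').node b = m.node b := fun hb => by
    simp [Mem.write, hb]
  have hnode' : (m.write a I').node a = some (.inner I') := by simp [Mem.write]
  constructor
  · intro b nd hb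
    by_cases hba : b = a
    · rw [hba]
      exact hinv.alloc ha
    · exact hinv.alloc (hnode hba ▸ hb)
  · intro b y j hp
    rw [ptr_write ha h] at hp
    obtain ⟨nd, hnd⟩ := hinv.ptr_alloc hp
    by_cases hy : y = a
    · exact ⟨.inner I', by rw [hy, hnode']⟩
    · exact ⟨nd, by rw [hnode hy, hnd]⟩
  · intro b b' y j j' hp hp'
    rw [ptr_write ha h] at hp hp'
    exact hinv.ptr_unique hp hp'
  · obtain ⟨J, d, hJ, hd⟩ := hinv.root
    obtain ⟨J', hJ', -, -, hlen, -⟩ := ev.inner hJ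
    rw [hd] at hlen
    obtain ⟨d', hd'⟩ := List.length_eq_one_iff.1 hlen
    exact ⟨J', d', hJ', hd'⟩
  · intro b j hp
    rw [ptr_write ha h] at hp
    exact hinv.root_ptr hp
  · intro D t q j hD
    have hDa : D ≠ a := by
      rintro rfl
      rw [hnode'] at hD
      cases hD
    rw [hnode hDa] at hD
    exact ev.isInner (hinv.target_inner hD)
  · intro b J hJ hs
    by_cases hba : b = a
    · subst hba
      rw [hnode'] at hJ
      cases hJ
      exact (hcov hs).mono ev
    · rw [hnode hba] at hJ
      exact (hinv.marked hJ hs).mono ev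
  · intro b J hJ hs
    by_cases hba : b = a
    · subst hba
      rw [hnode'] at hJ
      cases hJ
      exact hfin hs
    · rw [hnode hba] at hJ
      obtain ⟨L, hL, hlen⟩ := hinv.finished hJ hs
      exact ⟨L, hL.mono ev, hlen⟩

/-- Writing fields other than the status. -/
theorem MemInv.write_of_status (hinv : MemInv m) {a : Addr} {I I' : Inner K}
    (ha : m.node a = some (.inner I)) (h : I.Same I') (hs : I'.status = I.status) :
    MemInv (m.write a I') :=
  hinv.write ha h (fun h' => hinv.marked ha (hs ▸ h')) fun h' => by
    rw [hs] at h' ⊢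
    obtain ⟨L, hL, hlen⟩ := hinv.finished ha h'
    exact ⟨L, hL.mono (Evolve.write ha h), hlen⟩

end Memory

/-! ### Local states of threads and correctness of marking -/

section Threads

/-- What the caller on top of the stack expects from a marking call on `a`. -/
def Expect (m : Mem K V) (op : Addr) : List Frame → Addr → Prop
  | [], a => ∃ q j, m.node op = some (.rebuild a q j)
  | .jobs _ :: _, _ => True
  | .scan b i _ :: _, a =>
    SLink m b i a ∧ ∃ I, m.node b = some (.inner I) ∧ I.status ≠ Status.clean

/-- The invariant of the marking stack. -/
def StackInv (m : Mem K V) (op : Addr) : List Frame → Prop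
  | [] => True
  | .jobs a :: s => Covered m a ∧ (∃ I, m.node a = some (.inner I) ∧ I.status ≠ Status.clean) ∧
      Expect m op s a ∧ StackInv m op s
  | .scan a i n :: s => Covered m a ∧ (∃ I, m.node a = some (.inner I) ∧
      I.status ≠ Status.clean ∧ ∃ f : Addr → List (K × V),
        (∀ c ∈ I.children.take i, Frozen m c (f c)) ∧
        n = ((I.children.take i).flatMap f).length) ∧ Expect m op s a ∧ StackInv m op s

/-- The invariant of the local state of a thread. -/
def ThreadInv [LinearOrder K] (m : Mem K V) : Pc K V → Prop
  | .idle => True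
  | .search _ n path => Chain m rootAddr path n ∧ IsInner m n
  | .update c n path i child t => Chain m rootAddr path n ∧
      (∃ leaf, m.node child = some leaf ∧ replacement c leaf = some t) ∧
      ∃ I, m.node n = some (.inner I) ∧ i = searchIndex I.keys c.key
  | .bump todo path => (∃ n, Chain m rootAddr path n) ∧ todo <:+ path ∧
      (path.map Prod.fst).Nodup
  | .check todo parent => ∃ n, Chain m parent todo n
  | .announce a parent i => FLink m parent i a ∧ IsInner m a
  | .markCall op _ a stack => StackInv m op stack ∧ Expect m op stack a ∧
      (∃ nd, m.node a = some nd) ∧ (IsInner m a → Covered m a)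
  | .markLoop op _ stack => StackInv m op stack
  | .markJob op _ a _ stack => StackInv m op stack ∧ Covered m a ∧ ∃ s, stack = .jobs a :: s
  | .markStatus op _ child stack => StackInv m op stack ∧ Expect m op stack child ∧
      Covered m child
  | .create op _ n => ∃ t q j L, m.node op = some (.rebuild t q j) ∧ Frozen m t L ∧
      L.length = n
  | .install op _ t => ∃ a q j L, m.node op = some (.rebuild a q j) ∧ Frozen m a L ∧
      t.toList = L ∧ t.Good

variable {m m' : Mem K V}

theorem Evolve.marked_inner (h : Evolve m m') {a : Addr} {I : Inner K}
    (ha : m.node a = some (.inner I)) (hs : I.status ≠ Status.clean) :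
    ∃ I', m'.node a = some (.inner I') ∧ I'.status ≠ Status.clean ∧ I'.children = I.children := by
  obtain ⟨I', hI', -, -, -, hst, -⟩ := h.inner ha
  exact ⟨I', hI', hst hs⟩

theorem Evolve.alloc (h : Evolve m m') {a : Addr} {nd : Node K V} (ha : m.node a = some nd) :
    ∃ nd', m'.node a = some nd' := by
  by_cases hin : ∃ I, nd = .inner I
  · obtain ⟨I, rfl⟩ := hin
    obtain ⟨I', hI', -⟩ := h.inner ha
    exact ⟨_, hI'⟩
  · exact ⟨nd, h.outer ha fun I hI => hin ⟨I, hI⟩⟩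

/-- In the scanning case the calling node is already marked, so the slot it has read cannot change
any more. -/
theorem Expect.mono (h : Evolve m m') {op a : Addr} {s : List Frame} (he : Expect m op s a) :
    Expect m' op s a := by
  match s, he with
  | [], ⟨q, j, hq⟩ => exact ⟨q, j, h.rebuild hq⟩
  | .jobs _ :: _, _ => trivial
  | .scan b i _ :: _, ⟨⟨I, c, hI, hc, hca⟩, I', hI', hs⟩ =>
    rw [hI] at hI'
    cases hI'
    obtain ⟨J, hJ, hs', hch⟩ := h.marked_inner hI hs
    refine ⟨⟨J, c, hJ, by rw [hch, hc], hca.imp_right ?_⟩, J, hJ, hs'⟩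
    rintro ⟨q, j, hq⟩
    exact ⟨q, j, h.rebuild hq⟩

theorem StackInv.mono (h : Evolve m m') {op : Addr} {s : List Frame} (hs : StackInv m op s) :
    StackInv m' op s := by
  induction s with
  | nil => trivial
  | cons f s ih =>
    cases f with
    | jobs a =>
      obtain ⟨hc, ⟨I, hI, hI'⟩, he, hs⟩ := hs
      obtain ⟨J, hJ, hJ', -⟩ := h.marked_inner hI hI'
      exact ⟨hc.mono h, ⟨J, hJ, hJ'⟩, he.mono h, ih hs⟩
    | scan a i n =>
      obtain ⟨hc, ⟨I, hI, hI', f, hf, hn⟩, he, hs⟩ := hs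
      obtain ⟨J, hJ, hJ', hch⟩ := h.marked_inner hI hI'
      exact ⟨hc.mono h, ⟨J, hJ, hJ', f, fun c hc => (hf c (hch ▸ hc)).mono h, hch ▸ hn⟩,
        he.mono h, ih hs⟩

variable [LinearOrder K]

theorem replacement_isLeaf {c : Cmd K V} {leaf : Node K V} {t : Tree K V}
    (h : replacement c leaf = some t) (I : Inner K) : leaf ≠ .inner I := by
  rintro rfl
  exact (replacement_good h).1

theorem ThreadInv.mono (h : Evolve m m') {s : Pc K V} (hs : ThreadInv m s) : ThreadInv m' s := by
  cases s with
  | idle => trivial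
  | search c n path => exact ⟨hs.1.mono h, h.isInner hs.2⟩
  | update c n path i child t =>
    obtain ⟨h1, ⟨leaf, h2, h3⟩, I, hI, hi⟩ := hs
    obtain ⟨J, hJ, hk, -⟩ := h.inner hI
    exact ⟨h1.mono h, ⟨leaf, h.outer h2 (replacement_isLeaf h3), h3⟩, J, hJ, hk ▸ hi⟩
  | bump todo path =>
    obtain ⟨⟨n, h1⟩, h2⟩ := hs
    exact ⟨⟨n, h1.mono h⟩, h2⟩
  | check todo parent =>
    obtain ⟨n, h1⟩ := hs
    exact ⟨n, h1.mono h⟩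
  | announce a parent i => exact ⟨hs.1.mono h hs.2, h.isInner hs.2⟩
  | markCall op retry a stack =>
    obtain ⟨h1, h2, ⟨nd, h3⟩, h4⟩ := hs
    exact ⟨h1.mono h, h2.mono h, h.alloc h3, fun hin => (h4 ((h.isInner_iff h3).1 hin)).mono h⟩
  | markLoop op retry stack => exact StackInv.mono h hs
  | markJob op retry a i stack => exact ⟨hs.1.mono h, hs.2.1.mono h, hs.2.2⟩
  | markStatus op retry child stack => exact ⟨hs.1.mono h, hs.2.1.mono h, hs.2.2.mono h⟩
  | create op retry n =>
    obtain ⟨t, q, j, L, h1, h2, h3⟩ := hs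
    exact ⟨t, q, j, L, h.rebuild h1, h2.mono h, h3⟩
  | install op retry t =>
    obtain ⟨a, q, j, L, h1, h2, h3⟩ := hs
    exact ⟨a, q, j, L, h.rebuild h1, h2.mono h, h3⟩

theorem MemInv.start (hinv : MemInv m) (c : Cmd K V) : ThreadInv m (.start c) := by
  obtain ⟨I, -, hI, -⟩ := hinv.root
  exact ⟨rfl, I, hI⟩

theorem MemInv.resume (hinv : MemInv m) : ∀ r : Option (Cmd K V), ThreadInv m (.resume r)
  | none => trivial
  | some c => hinv.start c

-- The lists of the scanned children are chosen per address, and `c` is added by overwriting one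
-- value. If the address occurred before, its old list agrees with the new one because frozen
-- contents are unique.
omit [LinearOrder K] in
theorem StackInv.advance {op a c : Addr} {i n : ℕ} {s : List Frame} {I : Inner K}
    {L : List (K × V)} (hs : StackInv m op (.scan a i n :: s)) (ha : m.node a = some (.inner I))
    (hc : I.children[i]? = some c) (hL : Frozen m c L) :
    StackInv m op (.scan a (i + 1) (n + L.length) :: s) := by
  obtain ⟨hcov, ⟨I', hI', hst, f, hf, hn⟩, hrest⟩ := hs
  rw [ha] at hI'
  cases hI'
  have htake : I.children.take (i + 1) = I.children.take i ++ [c] := by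
    rw [List.take_add_one, hc, Option.toList_some]
  have heq : ∀ d ∈ I.children.take i, Function.update f c L d = f d := by
    intro d hd
    by_cases hdc : d = c
    · subst hdc
      rw [Function.update_self]
      exact hL.unique (hf _ hd)
    · rw [Function.update_of_ne hdc]
  refine ⟨hcov, ⟨I, ha, hst, Function.update f c L, fun d hd => ?_, ?_⟩, hrest⟩
  · rw [htake, List.mem_append, List.mem_singleton] at hd
    rcases hd with hd | rfl
    · rw [heq d hd]
      exact hf d hd
    · rwa [Function.update_self]
  · rw [htake, List.flatMap_append, List.length_append, List.flatMap_congr heq, hn]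
    simp

/-- A returned count is correct for the caller because it is the length of a frozen list. The
collaborative pass ignores returned counts; only the scan that follows it accumulates them. -/
theorem StackInv.markReturn {op a : Addr} {r : Option (Cmd K V)} {s : List Frame}
    {L : List (K × V)} (hs : StackInv m op s) (he : Expect m op s a) (hL : Frozen m a L) :
    ThreadInv m (.markReturn op r L.length s) := by
  match s, hs, he with
  | [], _, ⟨q, j, hq⟩ => exact ⟨a, q, j, L, hq, hL, rfl⟩
  | .jobs b :: s, hs, _ => exact hs
  | .scan b i n :: s, hs, ⟨⟨I, c, hI, hc, hca⟩, _⟩ =>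
    refine hs.advance hI hc ?_
    rcases hca with rfl | ⟨q, j, hq⟩
    · exact hL
    · exact .rebuild hq hL

omit [LinearOrder K] in
theorem Inner.casStatus_same (I : Inner K) {old new : Status} (h : new ≠ Status.clean) :
    I.Same (I.casStatus old new) := by
  unfold Inner.casStatus
  split_ifs
  · exact ⟨rfl, rfl, rfl, fun _ => h⟩
  · exact ⟨rfl, rfl, rfl, id⟩

/-- A step preserves the invariants of the memory and of the thread. -/
theorem step_inv {collab : Bool} {s s' : Pc K V} (hinv : MemInv m) (hs : ThreadInv m s)
    (hnodup : ∀ {path n}, SChain m rootAddr path n → (path.map Prod.fst).Nodup)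
    (h : Step collab m s m' s') : Evolve m m' ∧ MemInv m' ∧ ThreadInv m' s' := by
  cases h with
  | invoke c => exact ⟨.refl _, hinv, hinv.start c⟩
  | searchInner hn hc hJ =>
    exact ⟨.refl _, hinv, hs.1.snoc (.inr ⟨_, _, hn, hc, .inl rfl⟩) ⟨_, hJ⟩, _, hJ⟩
  | searchRebuild hn hc hr =>
    obtain ⟨J, hJ⟩ := hinv.target_inner hr
    exact ⟨.refl _, hinv, trivial, ⟨_, _, hr⟩, ⟨_, hJ⟩, fun _ => .target hr⟩
  | searchLeaf hn hc hl ht => exact ⟨.refl _, hinv, hs.1, ⟨_, hl, ht⟩, _, hn, rfl⟩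
  | searchDone => exact ⟨.refl _, hinv, trivial⟩
  | @updateSuccess c n path i child t I hn hm =>
    obtain ⟨h1, ⟨leaf, h2, h3⟩, -⟩ := hs
    have g := Graft.publish hinv t hn hm
    have hev : ∀ m', SlotEvolves m m' child (m.next, []) := fun _ => .inr (.inl ⟨leaf, h2, (replacement_good h3).1⟩)
    have ev := g.evolve hinv (hev _)
    refine ⟨ev, g.memInv_publish hinv (hev _), ⟨n, h1.mono ev⟩, List.suffix_rfl, ?_⟩
    -- The DCSS found `n` clean, hence not frozen, so the remembered path is a real one and visits
    -- no node twice.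
    exact hnodup (h1.strong fun ⟨L, hL⟩ => hL.marked hn hm.2).1
  | updateFailedMain hn hc => exact ⟨.refl _, hinv, hs.1, _, hn⟩
  | updateFailedAux => exact ⟨.refl _, hinv, hinv.start _⟩
  | @bumpNext a i todo path I ha =>
    obtain ⟨⟨n, h1⟩, h2, h3⟩ := hs
    have hsame : I.Same { I with count := I.count + 1 } := ⟨rfl, rfl, rfl, id⟩
    have ev := Evolve.write ha hsame
    exact ⟨ev, hinv.write_of_status ha hsame rfl, ⟨n, h1.mono ev⟩,
      (List.suffix_cons _ _).trans h2, h3⟩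
  | bumpDone => exact ⟨.refl _, hinv, hs.1⟩
  | checkNext =>
    obtain ⟨n, hn⟩ := hs
    exact ⟨.refl _, hinv, n, hn.2.2⟩
  | checkFound =>
    obtain ⟨n, hn⟩ := hs
    exact ⟨.refl _, hinv, hn.1, hn.2.1⟩
  | checkDone => exact ⟨.refl _, hinv, trivial⟩
  | @announceSuccess a parent i I hp hm =>
    have g := Graft.descriptor hinv hp hm
    have ev := g.evolve hinv (g.descriptor_slotEvolves hs.2)
    have hD : (Mem.write (m.descriptor a parent i) parent (I.setChild i (m.next, []))).node
        (m.next, []) = some (.rebuild a parent i) := by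
      rw [g.new, descriptorBlock, if_pos rfl]
    obtain ⟨J, hJ⟩ := ev.isInner hs.2
    exact ⟨ev, g.memInv_descriptor hinv hs.2, trivial, ⟨_, _, hD⟩, ⟨_, hJ⟩, fun _ => .target hD⟩
  | announceFailed => exact ⟨.refl _, hinv, trivial⟩
  | markEmpty ha => exact ⟨.refl _, hinv, StackInv.markReturn hs.1 hs.2.1 (.empty ha)⟩
  | markSingle ha => exact ⟨.refl _, hinv, StackInv.markReturn hs.1 hs.2.1 (.single ha)⟩
  | @markRebuild op r a s target q j ha =>
    obtain ⟨J, hJ⟩ := hinv.target_inner ha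
    refine ⟨.refl _, hinv, hs.1, ?_, ⟨_, hJ⟩, fun _ => .target ha⟩
    have h2 := hs.2.1
    match s, h2 with
    -- Targets are inner nodes, so no descriptor sits directly below another one.
    | [], ⟨q', j', hq'⟩ =>
      obtain ⟨J', hJ'⟩ := hinv.target_inner hq'
      rw [ha] at hJ'
      cases hJ'
    | .jobs _ :: _, _ => trivial
    | .scan b i _ :: _, ⟨⟨I, c, hI, hc, hca⟩, hb⟩ =>
      rcases hca with rfl | ⟨q', j', hq'⟩
      · exact ⟨⟨I, _, hI, hc, .inr ⟨_, _, ha⟩⟩, hb⟩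
      · obtain ⟨J', hJ'⟩ := hinv.target_inner hq'
        rw [ha] at hJ'
        cases hJ'
  | @markInner op r a s I ha =>
    obtain ⟨h1, h2, -, h4⟩ := hs
    have hcov := h4 ⟨I, ha⟩
    have hsame := I.casStatus_same (old := Status.clean) (new := Status.started) (by decide)
    have ev := Evolve.write ha hsame
    have hst : (I.casStatus Status.clean Status.started).status ≠ Status.clean := by
      unfold Inner.casStatus
      split_ifs with h
      · show Status.started ≠ Status.clean
        decide
      · exact h
    have hnode : (m.write a (I.casStatus Status.clean Status.started)).node a =
      some (.inner (I.casStatus Status.clean Status.started)) := by simp [Mem.write]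
    refine ⟨ev, hinv.write ha hsame (fun _ => hcov) fun hf => ?_, ?_⟩
    · by_cases h : I.status = Status.clean
      · rw [Inner.casStatus, if_pos h] at hf
        cases hf
      · have hcas : I.casStatus Status.clean Status.started = I := by rw [Inner.casStatus, if_neg h]
        rw [hcas] at hf ev ⊢
        obtain ⟨L, hL, hlen⟩ := hinv.finished ha hf
        exact ⟨L, hL.mono ev, hlen⟩
    · have h1' := h1.mono ev
      have h2' := h2.mono ev
      split_ifs
      · exact ⟨hcov.mono ev, ⟨_, hnode, hst⟩, h2', h1'⟩
      · exact ⟨hcov.mono ev, ⟨_, hnode, hst, fun _ => [], by simp, by simp⟩, h2', h1'⟩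
  | @jobTake op r a s I ha =>
    have hsame : I.Same { I with nextMark := I.nextMark + 1 } := ⟨rfl, rfl, rfl, id⟩
    have ev := Evolve.write ha hsame
    have hs' := StackInv.mono ev hs
    refine ⟨ev, hinv.write_of_status ha hsame rfl, ?_⟩
    split_ifs
    · exact ⟨hs', hs'.1, _, rfl⟩
    · obtain ⟨hcov, ⟨J, hJ, hst⟩, h2⟩ := hs'
      exact ⟨hcov, ⟨J, hJ, hst, fun _ => [], by simp, by simp⟩, h2⟩
  | @jobRead op r a i s I child ha hc =>
    obtain ⟨h1, h2, s, rfl⟩ := hs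
    exact ⟨.refl _, hinv, h1, trivial, hinv.ptr_alloc (.inl ⟨_, ha, hc⟩),
      fun hin => .child h2 ha (List.mem_of_getElem? hc) hin⟩
  | scanEmpty ha hc he => exact ⟨.refl _, hinv, hs.advance ha hc (.empty he)⟩
  | scanSingle ha hc he => exact ⟨.refl _, hinv, hs.advance ha hc (.single he)⟩
  | scanInner ha hc hJ =>
    obtain ⟨J, hJ', hst, -⟩ := hs.2.1
    exact ⟨.refl _, hinv, hs, ⟨⟨_, _, ha, hc, .inl rfl⟩, J, hJ', hst⟩,
      .child hs.1 ha (List.mem_of_getElem? hc) ⟨_, hJ⟩⟩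
  | scanRebuild ha hc hr =>
    obtain ⟨J, hJ', hst, -⟩ := hs.2.1
    refine ⟨.refl _, hinv, hs, ⟨⟨_, _, ha, hc, .inl rfl⟩, J, hJ', hst⟩, ⟨_, hr⟩, ?_⟩
    rintro ⟨J, hJ⟩
    rw [hr] at hJ
    cases hJ
  | statusFinished hJ hf =>
    obtain ⟨L, hL, hlen⟩ := hinv.finished hJ hf
    exact ⟨.refl _, hinv, hlen ▸ StackInv.markReturn hs.1 hs.2.1 hL⟩
  | statusUnfinished hJ hf => exact ⟨.refl _, hinv, hs.1, hs.2.1, ⟨_, hJ⟩, fun _ => hs.2.2⟩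
  | @scanDone op r a i n s I ha hlen =>
    obtain ⟨hcov, ⟨I', hI', hst, f, hf, rfl⟩, he, hs⟩ := hs
    rw [ha] at hI'
    cases hI'
    rw [List.take_of_length_le hlen] at hf ⊢
    have hfr := Frozen.inner f ha hst hf
    have hsame := I.casStatus_same (old := Status.started)
      (new := Status.finished (I.children.flatMap f).length) (by simp [Status.finished, Status.clean])
    have ev := Evolve.write ha hsame
    have hmem : MemInv _ := hinv.write ha hsame (fun _ => hcov) fun hf => by
      by_cases h : I.status = Status.started
      · exact ⟨_, hfr.mono ev, by rw [Inner.casStatus, if_pos h]; rfl⟩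
      · have hcas : I.casStatus Status.started
            (Status.finished (I.children.flatMap f).length) = I := by rw [Inner.casStatus, if_neg h]
        rw [hcas] at hf ev ⊢
        obtain ⟨L, hL, hlen⟩ := hinv.finished ha hf
        exact ⟨L, hL.mono ev, hlen⟩
    exact ⟨ev, hmem, StackInv.markReturn (hs.mono ev) (he.mono ev) (hfr.mono ev)⟩
  | createIdeal hop hC ht hreb =>
    obtain ⟨t', q, j, L, h1, h2, h3⟩ := hs
    rw [hop] at h1
    cases h1
    -- The keys read now are those of the frozen list, whose length is the count, so taking the
    -- first `n` of them drops nothing.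
    obtain rfl := h2.contents.unique hC
    exact ⟨.refl _, hinv, _, _, _, _, hop, h2, by rw [ht, List.take_of_length_le h3.le], hreb.good⟩
  | @installSuccess op r t target parent i I hop hp hm =>
    obtain ⟨t', q, j, L, h1, h2, h3⟩ := hs
    rw [hop] at h1
    cases h1
    have g := Graft.publish hinv t hp hm
    have hev : ∀ m', SlotEvolves m m' op (m.next, []) := fun _ => .inr (.inr (.inr ⟨_, _, _, _, hop, h2⟩))
    have hmem := g.memInv_publish hinv (hev _)
    exact ⟨g.evolve hinv (hev _), hmem, hmem.resume r⟩
  | installFailed => exact ⟨.refl _, hinv, hinv.resume _⟩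

end Threads

/-! ### Potentials: initial size plus or minus the updates -/

section Potential

/-- `c` is the node `a` or a descriptor of it. -/
def Leads (m : Mem K V) (c a : Addr) : Prop :=
  c = a ∨ ∃ parent j, m.node c = some (.rebuild a parent j)

/-- The initial number of keys below `c`, plus `σ` times the number of updates below `c`. -/
def pot (m : Mem K V) (w : Addr → ℕ) (σ : ℤ) (c : Addr) : ℤ :=
  match m.node c with
  | some .empty => 0
  | some (.single _ _) => 1
  | some (.inner I) => I.initSize + σ * w c
  | some (.rebuild t _ _) =>
    match m.node t with
    | some (.inner I) => I.initSize + σ * w t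
    | _ => 0
  | none => 0

/-- The inequalities at an inner node with initial size `s`, `x` updates and the given children. -/
structure PotAt (m : Mem K V) (w : Addr → ℕ) (s x : ℕ) (children : List Addr) : Prop where
  lt : ∀ c ∈ children, pot m w 1 c + 1 ≤ s + x
  le : ∀ c ∈ children, pot m w 1 c ≤ Nat.sqrt s + 3 + x
  sum_le : (children.map (pot m w 1)).sum ≤ s + x
  le_sum : (s : ℤ) - x ≤ (children.map (pot m w (-1))).sum

/-- The inequalities hold at all inner nodes below the root. -/
def Pot (m : Mem K V) (w : Addr → ℕ) : Prop :=
  ∀ a I, a ≠ rootAddr → m.node a = some (.inner I) → PotAt m w I.initSize (w a) I.children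

variable {m m' : Mem K V} {w w' : Addr → ℕ}

theorem pot_leads {c a : Addr} {I : Inner K} (h : Leads m c a) (ha : m.node a = some (.inner I))
    (σ : ℤ) : pot m w σ c = I.initSize + σ * w a := by
  rcases h with rfl | ⟨q, j, h⟩
  · simp [pot, ha]
  · simp [pot, h, ha]

theorem pot_leaf {c : Addr} {nd : Node K V} (hc : m.node c = some nd) (h : nd.IsLeaf) (σ : ℤ) :
    pot m w σ c = nd.leafSize := by
  cases nd with
  | inner I => exact h.elim
  | rebuild => exact h.elim
  | _ => simp [pot, hc, Node.leafSize]

theorem MemInv.leaf_or_leads (hinv : MemInv m) {c : Addr} {nd : Node K V}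
    (hc : m.node c = some nd) : nd.IsLeaf ∨ ∃ a, Leads m c a ∧ IsInner m a := by
  cases nd with
  | inner I => exact .inr ⟨c, .inl rfl, I, hc⟩
  | rebuild t q j => exact .inr ⟨t, .inr ⟨q, j, hc⟩, hinv.target_inner hc⟩
  | _ => exact .inl trivial

theorem Node.IsLeaf.ne_inner {nd : Node K V} (h : nd.IsLeaf) (I : Inner K) : nd ≠ .inner I := by
  rintro rfl
  exact h

theorem Leads.mono (ev : Evolve m m') {c a : Addr} (h : Leads m c a) : Leads m' c a :=
  h.imp_right fun ⟨q, j, hq⟩ => ⟨q, j, ev.rebuild hq⟩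

/-- Initial sizes are immutable, so the potential of an inner node moves only with its number of
updates. -/
theorem Evolve.pot_leads (ev : Evolve m m') {c a : Addr} (h : Leads m c a) (ha : IsInner m a)
    (σ : ℤ) : pot m' w' σ c = pot m w σ c + σ * (w' a - w a) := by
  obtain ⟨I, hI⟩ := ha
  obtain ⟨I', hI', -, hs, -⟩ := ev.inner hI
  rw [CIST.pot_leads h hI, CIST.pot_leads (h.mono ev) hI', hs]
  ring

theorem Evolve.pot_leaf (ev : Evolve m m') {c : Addr} {nd : Node K V} (hc : m.node c = some nd)
    (h : nd.IsLeaf) (σ : ℤ) : pot m' w' σ c = pot m w σ c := by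
  rw [CIST.pot_leaf hc h, CIST.pot_leaf (ev.outer hc h.ne_inner) h]

theorem Evolve.pot_eq (ev : Evolve m m') (hinv : MemInv m) {c : Addr} {nd : Node K V}
    (hc : m.node c = some nd) (hw : ∀ a, IsInner m a → w' a = w a) (σ : ℤ) :
    pot m' w' σ c = pot m w σ c := by
  rcases hinv.leaf_or_leads hc with h | ⟨a, h, ha⟩
  · exact ev.pot_leaf hc h σ
  · rw [ev.pot_leads (w := w) h ha, hw a ha]
    ring

theorem sum_map_le {f g : Addr → ℤ} (e : ℕ → ℤ) : ∀ l l' : List Addr, l'.length = l.length →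
    (∀ (j : ℕ) c c', l[j]? = some c → l'[j]? = some c' → f c' ≤ g c + e j) →
    (l'.map f).sum ≤ (l.map g).sum + ∑ j ∈ Finset.range l.length, e j
  | [], [], _, _ => by simp
  | c :: l, c' :: l', hlen, h => by
    have h1 := h 0 c c' rfl rfl
    have h2 := sum_map_le (f := f) (g := g) (fun j => e (j + 1)) l l' (by simpa using hlen)
      fun j c c' hc hc' => h (j + 1) c c' (by simpa using hc) (by simpa using hc')
    rw [List.length_cons, Finset.sum_range_succ', List.map_cons, List.sum_cons, List.map_cons,
      List.sum_cons]
    linarith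

/-- The inequalities survive when the number of updates grows by `δ` and at most one slot changes
its potential, by at most `δ`. -/
theorem PotAt.change {s x δ i₀ : ℕ} {l l' : List Addr} (h : PotAt m w s x l)
    (hlen : l'.length = l.length)
    (hup : ∀ (j : ℕ) c c', l[j]? = some c → l'[j]? = some c' →
      pot m' w' 1 c' ≤ pot m w 1 c + if j = i₀ then (δ : ℤ) else 0)
    (hlow : ∀ (j : ℕ) c c', l[j]? = some c → l'[j]? = some c' →
      pot m w (-1) c ≤ pot m' w' (-1) c' + if j = i₀ then (δ : ℤ) else 0) :
    PotAt m' w' s (x + δ) l' := by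
  -- Only slot `i₀` contributes, so the whole sum over the children moves by at most `δ`, which the
  -- growth of `x` absorbs.
  have hite : ∀ n : ℕ, ∑ j ∈ Finset.range n, (if j = i₀ then (δ : ℤ) else 0) ≤ δ := fun n => by
    rw [Finset.sum_ite_eq']
    split_ifs <;> simp
  have hmem : ∀ c' ∈ l', ∃ c ∈ l, pot m' w' 1 c' ≤ pot m w 1 c + δ := by
    intro c' hc'
    obtain ⟨j, hj⟩ := List.getElem?_of_mem hc'
    obtain ⟨hj', -⟩ := List.getElem?_eq_some_iff.1 hj
    rw [hlen] at hj'
    refine ⟨l[j], List.getElem_mem hj', ?_⟩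
    have := hup j _ c' (List.getElem?_eq_getElem hj') hj
    split_ifs at this <;> omega
  refine ⟨fun c' hc' => ?_, fun c' hc' => ?_, ?_, ?_⟩
  · obtain ⟨c, hc, h'⟩ := hmem c' hc'
    have := h.lt c hc
    push_cast
    linarith
  · obtain ⟨c, hc, h'⟩ := hmem c' hc'
    have := h.le c hc
    push_cast
    linarith
  · have := sum_map_le _ l l' hlen hup
    have := hite l.length
    have := h.sum_le
    push_cast
    linarith
  · have := sum_map_le _ l' l hlen.symm fun j c c' hc hc' => hlow j c' c hc' hc
    have := hite l'.length
    have := h.le_sum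
    push_cast
    linarith

/-- Potentials do not depend on the auxiliary fields. -/
theorem Pot.write (h : Pot m w) (hinv : MemInv m) {a : Addr} {I I' : Inner K}
    (ha : m.node a = some (.inner I)) (hsame : I.Same I') (hw : ∀ a, w' a = w a) :
    Pot (m.write a I') w' := by
  have ev := Evolve.write ha hsame
  intro b J hb hJ
  obtain ⟨J₀, hJ₀, hs, hch⟩ : ∃ J₀, m.node b = some (.inner J₀) ∧ J.initSize = J₀.initSize ∧
      J.children = J₀.children := by
    by_cases hba : b = a
    · subst hba
      simp only [Mem.write, Function.update_self, Option.some.injEq, Node.inner.injEq] at hJ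
      exact ⟨I, ha, hJ ▸ hsame.initSize, hJ ▸ hsame.children⟩
    · simp only [Mem.write, Function.update_of_ne hba] at hJ
      exact ⟨J, hJ, rfl, rfl⟩
  rw [hs, hch, hw]
  have hpot : ∀ (σ : ℤ) (j : ℕ) c c', J₀.children[j]? = some c → J₀.children[j]? = some c' →
      pot (m.write a I') w' σ c' = pot m w σ c := by
    intro σ j c c' hc hc'
    rw [hc] at hc'
    cases hc'
    obtain ⟨nd, hnd⟩ := hinv.ptr_alloc (.inl ⟨J₀, hJ₀, hc⟩)
    exact ev.pot_eq hinv hnd (fun a _ => hw a) σ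
  refine (h b J₀ hb hJ₀).change (δ := 0) (i₀ := 0) rfl (fun j c c' hc hc' => ?_)
    fun j c c' hc hc' => ?_
  · rw [hpot 1 j c c' hc hc']; simp
  · rw [hpot (-1) j c c' hc hc']; simp

theorem Tree.Good.subtree [LinearOrder K] {t s : Tree K V} {pos : List ℕ} (ht : t.Good)
    (h : t.subtree pos = some s) : s.Good := by
  induction pos generalizing t with
  | nil => simp only [Tree.subtree, Option.some.injEq] at h; exact h ▸ ht
  | cons x pos ih =>
    cases t with
    | inner ks d ch =>
      simp only [Tree.subtree] at h
      split_ifs at h with hx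
      exact ih (ht ⟨x, hx⟩).2.2.2 h
    | _ => simp [Tree.subtree] at h

variable {n c : Addr} {I : Inner K} {i : ℕ}

theorem Graft.pot_fresh {t s : Tree K V} (g : Graft m m' n I i c (treeBlock t m.next))
    {pos : List ℕ} (hw : w' (m.next, pos) = 0) (hs : t.subtree pos = some s) (σ : ℤ) :
    pot m' w' σ (m.next, pos) = s.size := by
  have h := g.new pos
  rw [treeBlock, hs, Option.map_some] at h
  cases s with
  | empty => rw [pot_leaf h trivial]; rfl
  | single k x => rw [pot_leaf h trivial]; rfl
  | inner ks d ch => rw [pot_leads (.inl rfl) h, hw]; simp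

/-- Without updates both potentials are the number of keys, and the inequalities reduce to
`Tree.Good` and the additivity of sizes. -/
theorem Graft.potAt_fresh [LinearOrder K] {t : Tree K V} {pos : List ℕ} {J : Inner K}
    (g : Graft m m' n I i c (treeBlock t m.next)) (ht : t.Good)
    (hw : ∀ pos, w' (m.next, pos) = 0) (hJ : m'.node (m.next, pos) = some (.inner J)) :
    PotAt m' w' J.initSize (w' (m.next, pos)) J.children := by
  rw [g.new] at hJ
  obtain ⟨ks, d, ch, hs, -, hch, -, -, hsz⟩ := treeBlock_inner hJ
  have hgood := ht.subtree hs
  have hpot : ∀ (σ : ℤ) (j : Fin d), pot m' w' σ (m.next, pos ++ [j.1]) = (ch j).size :=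
    fun σ j => g.pot_fresh (hw _) (Tree.subtree_snoc hs j.2) σ
  have hmem : ∀ c ∈ J.children, ∃ j : Fin d, pot m' w' 1 c = (ch j).size := by
    intro c hc
    rw [hch, List.mem_map] at hc
    obtain ⟨j, hj, rfl⟩ := hc
    exact ⟨⟨j, List.mem_range.1 hj⟩, hpot 1 ⟨j, List.mem_range.1 hj⟩⟩
  have hsum : ∀ σ : ℤ, (J.children.map (pot m' w' σ)).sum = J.initSize := by
    intro σ
    rw [hch, hsz, Tree.size_inner, List.map_map, Nat.cast_sum]
    have : ((List.range d).map (pot m' w' σ ∘ fun i => (m.next, pos ++ [i]))).sum =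
      ∑ j ∈ Finset.range d, pot m' w' σ (m.next, pos ++ [j]) := rfl
    rw [this, Finset.sum_range]
    exact Finset.sum_congr rfl fun j _ => hpot σ j
  rw [hw]
  refine ⟨fun c hc => ?_, fun c hc => ?_, by rw [hsum]; simp, by rw [hsum]; simp⟩
  · obtain ⟨j, hj⟩ := hmem c hc
    rw [hj, hsz]
    have := (hgood j).1
    push_cast
    omega
  · obtain ⟨j, hj⟩ := hmem c hc
    rw [hj, hsz]
    have := (hgood j).2.1
    push_cast
    omega

/-- The slots of an old node after a graft. -/
theorem Graft.slots {fresh : List ℕ → Option (Node K V)} (g : Graft m m' n I i c fresh)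
    {b : Addr} {J' : Inner K} (hb : b.1 ≠ m.next)
    (hJ' : m'.node b = some (.inner J')) : ∃ J, m.node b = some (.inner J) ∧
      J'.initSize = J.initSize ∧ J'.keys = J.keys ∧ J'.children.length = J.children.length ∧
      ∀ (j : ℕ) d d', J.children[j]? = some d → J'.children[j]? = some d' →
        (d' = d ∧ ¬ (b = n ∧ j = i)) ∨ (b = n ∧ j = i ∧ d = c ∧ d' = (m.next, [])) := by
  by_cases hbn : b = n
  · subst hbn
    have h2 := g.hn'
    rw [hJ'] at h2
    cases h2
    refine ⟨I, g.hn, rfl, rfl, by simp [Inner.setChild], fun j d d' hd hd' => ?_⟩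
    rcases g.ptr_old hb (.inl ⟨_, hJ', hd'⟩) with ⟨h1, h2⟩ | ⟨-, rfl, h2⟩
    · obtain ⟨J, hJ, hj⟩ | ⟨-, q, l, hq⟩ := h1
      · rw [g.hn] at hJ
        cases hJ
        rw [hd] at hj
        cases hj
        exact .inl ⟨rfl, h2⟩
      · rw [g.hn] at hq
        cases hq
    · rw [g.hm.1] at hd
      cases hd
      exact .inr ⟨rfl, rfl, rfl, h2⟩
  · rw [g.old hbn hb] at hJ'
    refine ⟨J', hJ', rfl, rfl, rfl, fun j d d' hd hd' => ?_⟩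
    rw [hd] at hd'
    cases hd'
    exact .inl ⟨rfl, fun h => hbn h.1⟩

/-- Replacing a descriptor by a tree with the right number of keys. -/
theorem Graft.pot_install [LinearOrder K] {t : Tree K V}
    (g : Graft m m' n I i c (treeBlock t m.next)) (ev : Evolve m m') (hinv : MemInv m)
    (h : Pot m w) (ht : t.Good) (hw : ∀ a, IsInner m a → w' a = w a)
    (hw0 : ∀ pos, w' (m.next, pos) = 0)
    (hup : (t.size : ℤ) ≤ pot m w 1 c) (hlow : pot m w (-1) c ≤ t.size) : Pot m' w' := by
  intro b J' hbr hJ'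
  by_cases hb : b.1 = m.next
  · obtain ⟨b, pos⟩ := b
    simp only at hb
    subst hb
    exact g.potAt_fresh ht hw0 hJ'
  obtain ⟨J, hJ, hs, -, hlen, hslots⟩ := g.slots hb hJ'
  rw [hs, hw b ⟨J, hJ⟩]
  have hroot : ∀ σ, pot m' w' σ (m.next, []) = t.size := fun σ =>
    g.pot_fresh (hw0 []) (by cases t <;> rfl) σ
  refine (h b J hbr hJ).change (δ := 0) (i₀ := 0) hlen (fun j d d' hd hd' => ?_)
    fun j d d' hd hd' => ?_
  all_goals
    obtain ⟨nd, hnd⟩ := hinv.ptr_alloc (.inl ⟨J, hJ, hd⟩)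
    rcases hslots j d d' hd hd' with ⟨rfl, -⟩ | ⟨-, -, rfl, rfl⟩
    · rw [ev.pot_eq hinv hnd hw]; simp
    · rw [hroot]; simpa using by assumption

/-- Putting a descriptor above a node. -/
theorem Graft.pot_announce (g : Graft m m' n I i c (descriptorBlock K V c n i))
    (hinv : MemInv m) (h : Pot m w) (hc : IsInner m c) (hw : ∀ a, IsInner m a → w' a = w a) :
    Pot m' w' := by
  have ev := g.evolve hinv (g.descriptor_slotEvolves hc)
  intro b J' hbr hJ'
  by_cases hb : b.1 = m.next
  · obtain ⟨b, pos⟩ := b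
    simp only at hb
    subst hb
    rw [g.new, descriptorBlock] at hJ'
    split_ifs at hJ'
    cases hJ'
  obtain ⟨J, hJ, hs, -, hlen, hslots⟩ := g.slots hb hJ'
  rw [hs, hw b ⟨J, hJ⟩]
  have hpot : ∀ (σ : ℤ) (j : ℕ) d d', J.children[j]? = some d → J'.children[j]? = some d' →
      pot m' w' σ d' = pot m w σ d := by
    intro σ j d d' hd hd'
    obtain ⟨nd, hnd⟩ := hinv.ptr_alloc (.inl ⟨J, hJ, hd⟩)
    rcases hslots j d d' hd hd' with ⟨rfl, -⟩ | ⟨-, -, rfl, rfl⟩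
    · exact ev.pot_eq hinv hnd hw σ
    · rw [← ev.pot_eq (w' := w') hinv hnd hw σ]
      obtain ⟨C, hC⟩ := ev.isInner hc
      rw [pot_leads (.inl rfl) hC,
        pot_leads (.inr ⟨n, i, by rw [g.new, descriptorBlock, if_pos rfl]⟩) hC]
  refine (h b J hbr hJ).change (δ := 0) (i₀ := 0) hlen (fun j d d' hd hd' => ?_)
    fun j d d' hd hd' => ?_
  · rw [hpot 1 j d d' hd hd']; simp
  · rw [hpot (-1) j d d' hd hd']; simp

/-- Incoming pointers are unique, and a node cannot be reached both directly and through a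
descriptor, since one node would then be both inner and a descriptor. -/
theorem MemInv.slink_unique (hinv : MemInv m) {a b b' : Addr} {j j' : ℕ} (h : SLink m b j a)
    (h' : SLink m b' j' a) : b = b' ∧ j = j' := by
  obtain ⟨I, d, hI, hd, h⟩ := h
  obtain ⟨I', d', hI', hd', h'⟩ := h'
  have hp : Ptr m b j d := .inl ⟨I, hI, hd⟩
  have hp' : Ptr m b' j' d' := .inl ⟨I', hI', hd'⟩
  rcases h with rfl | ⟨q, l, h⟩ <;> rcases h' with rfl | ⟨q', l', h'⟩
  · exact hinv.ptr_unique hp hp'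
  · obtain ⟨rfl, -⟩ := hinv.ptr_unique hp (.inr ⟨rfl, q', l', h'⟩)
    rw [hI] at h'
    cases h'
  · obtain ⟨rfl, -⟩ := hinv.ptr_unique hp' (.inr ⟨rfl, q, l, h⟩)
    rw [hI'] at h
    cases h
  · obtain ⟨rfl, -⟩ := hinv.ptr_unique (.inr ⟨rfl, q, l, h⟩) (.inr ⟨rfl, q', l', h'⟩)
    exact hinv.ptr_unique hp hp'

theorem SChain.exists_pred {b a : Addr} {path : List (Addr × ℕ)} (h : SChain m b path n)
    (ha : a ∈ path.map Prod.fst) : ∃ b' ∈ b :: path.map Prod.fst, ∃ j, SLink m b' j a := by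
  induction path generalizing b with
  | nil => simp at ha
  | cons x q ih =>
    rw [List.map_cons, List.mem_cons] at ha
    rcases ha with rfl | ha
    · exact ⟨b, List.mem_cons_self, _, h.1⟩
    · obtain ⟨b', hb', h'⟩ := ih h.2.2 ha
      exact ⟨b', List.mem_cons_of_mem _ hb', h'⟩

theorem SChain.end_mem {b : Addr} {path : List (Addr × ℕ)} (h : SChain m b path n) :
    n ∈ b :: path.map Prod.fst := by
  induction path generalizing b with
  | nil => cases h; exact List.mem_cons_self
  | cons x q ih => exact List.mem_cons_of_mem _ (ih h.2.2)

/-- A node on a path has at most one slot that leads to a node on the path. -/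
theorem SChain.slot_unique (hinv : MemInv m) {b : Addr} {path : List (Addr × ℕ)}
    (h : SChain m b path n) (hnd : (b :: path.map Prod.fst).Nodup) (a : Addr) :
    ∃ i₀, ∀ (j : ℕ) d, d ∈ path.map Prod.fst → SLink m a j d → j = i₀ ∧ a ≠ n := by
  induction path generalizing b with
  | nil => exact ⟨0, by simp⟩
  | cons x q ih =>
    rw [List.map_cons, List.nodup_cons] at hnd
    by_cases hab : a = b
    · subst hab
      refine ⟨x.2, fun j d hd hl => ⟨?_, ?_⟩⟩
      · rw [List.map_cons, List.mem_cons] at hd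
        rcases hd with rfl | hd
        · exact (hinv.slink_unique hl h.1).2
        · obtain ⟨b', hb', j', hl'⟩ := h.2.2.exists_pred hd
          obtain ⟨rfl, -⟩ := hinv.slink_unique hl hl'
          exact absurd hb' hnd.1
      · rintro rfl
        exact hnd.1 h.2.2.end_mem
    · obtain ⟨i₀, hi₀⟩ := ih h.2.2 hnd.2
      refine ⟨i₀, fun j d hd hl => ?_⟩
      rw [List.map_cons, List.mem_cons] at hd
      rcases hd with rfl | hd
      · exact absurd (hinv.slink_unique hl h.1).1 hab
      · exact hi₀ j d hd hl

theorem Pot.slink_lt (h : Pot m w) {b a : Addr} {j : ℕ} (hb : b ≠ rootAddr)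
    (hl : SLink m b j a) (ha : IsInner m a) : pot m w 1 a < pot m w 1 b := by
  obtain ⟨I, d, hI, hd, hda⟩ := hl
  obtain ⟨J, hJ⟩ := ha
  have := (h b I hb hI).lt d (List.mem_of_getElem? hd)
  rw [pot_leads hda hJ] at this
  rw [pot_leads (.inl rfl) hJ, pot_leads (.inl rfl) hI]
  linarith

theorem MemInv.slink_ne_root (hinv : MemInv m) {b : Addr} {j : ℕ} : ¬ SLink m b j rootAddr := by
  rintro ⟨I, d, hI, hd, rfl | ⟨q, l, h⟩⟩
  · exact hinv.root_ptr (.inl ⟨I, hI, hd⟩)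
  · exact hinv.root_ptr (.inr ⟨rfl, q, l, h⟩)

theorem SChain.root_notMem (hinv : MemInv m) {b : Addr} {path : List (Addr × ℕ)}
    (h : SChain m b path n) : rootAddr ∉ path.map Prod.fst := fun hr => by
  obtain ⟨b', -, j, hl⟩ := h.exists_pred hr
  exact hinv.slink_ne_root hl

theorem SChain.pot_lt (hinv : MemInv m) (hp : Pot m w) {b : Addr} {path : List (Addr × ℕ)}
    (hb : b ≠ rootAddr) (h : SChain m b path n) :
    ∀ a ∈ path.map Prod.fst, pot m w 1 a < pot m w 1 b := by
  induction path generalizing b with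
  | nil => simp
  | cons x q ih =>
    intro a ha
    have h1 := hp.slink_lt hb h.1 h.2.1
    rw [List.map_cons, List.mem_cons] at ha
    rcases ha with rfl | ha
    · exact h1
    · have hx : x.1 ≠ rootAddr := fun hx => hinv.slink_ne_root (hx ▸ h.1)
      exact (ih hx h.2.2 a ha).trans h1

/-- Potentials strictly decrease along links below the root, so no node can recur. The start `b` may
be the root, where no inequality is available; therefore it is left out of the list. -/
theorem SChain.nodup (hinv : MemInv m) (hp : Pot m w) {b : Addr} {path : List (Addr × ℕ)}
    (h : SChain m b path n) : (path.map Prod.fst).Nodup := by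
  induction path generalizing b with
  | nil => simp
  | cons x q ih =>
    rw [List.map_cons, List.nodup_cons]
    have hx : x.1 ≠ rootAddr := fun hx => hinv.slink_ne_root (hx ▸ h.1)
    exact ⟨fun hm => lt_irrefl _ (h.2.2.pot_lt hinv hp hx _ hm), ih h.2.2⟩

/-- Replacing a leaf, and counting this as an update at all nodes of the path. -/
theorem Graft.pot_update [LinearOrder K] {t : Tree K V} {path : List (Addr × ℕ)} {leaf : Node K V}
    (g : Graft m m' n I i c (treeBlock t m.next)) (ev : Evolve m m') (hinv : MemInv m)
    (h : Pot m w) (ht : t.Good) (hpath : SChain m rootAddr path n)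
    (hw : ∀ a, IsInner m a → w' a = w a + if a ∈ path.map Prod.fst then 1 else 0)
    (hw0 : ∀ pos, w' (m.next, pos) = 0) (hc : m.node c = some leaf) (hleaf : leaf.IsLeaf)
    (hup : t.size ≤ leaf.leafSize + 1) (hlow : leaf.leafSize ≤ t.size + 1) : Pot m' w' := by
  intro b J' hbr hJ'
  by_cases hb : b.1 = m.next
  · obtain ⟨b, pos⟩ := b
    simp only at hb
    subst hb
    exact g.potAt_fresh ht hw0 hJ'
  obtain ⟨J, hJ, hs, -, hlen, hslots⟩ := g.slots hb hJ'
  rw [hs, hw b ⟨J, hJ⟩]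
  have hroot : ∀ σ, pot m' w' σ (m.next, []) = t.size := fun σ =>
    g.pot_fresh (hw0 []) (by cases t <;> rfl) σ
  -- The exceptional slot of `b` is the one through which the path continues; at the end `n` of the
  -- path it is the redirected slot `i` instead.
  obtain ⟨i₁, hi₁⟩ := hpath.slot_unique hinv
    (List.nodup_cons.2 ⟨hpath.root_notMem hinv, hpath.nodup hinv h⟩) b
  have hn : b = n → b ∈ path.map Prod.fst := by
    rintro rfl
    exact (List.mem_cons.1 hpath.end_mem).resolve_left hbr
  have main : ∀ (j : ℕ) d d', J.children[j]? = some d → J'.children[j]? = some d' →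
      pot m' w' 1 d' ≤ pot m w 1 d + (if j = (if b = n then i else i₁) then
        ((if b ∈ path.map Prod.fst then 1 else 0 : ℕ) : ℤ) else 0) ∧
      pot m w (-1) d ≤ pot m' w' (-1) d' + (if j = (if b = n then i else i₁) then
        ((if b ∈ path.map Prod.fst then 1 else 0 : ℕ) : ℤ) else 0) := by
    intro j d d' hd hd'
    obtain ⟨nd, hnd⟩ := hinv.ptr_alloc (.inl ⟨J, hJ, hd⟩)
    rcases hslots j d d' hd hd' with ⟨rfl, -⟩ | ⟨rfl, rfl, rfl, rfl⟩
    · have hnn : (0 : ℤ) ≤ (if j = (if b = n then i else i₁) then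
        ((if b ∈ path.map Prod.fst then 1 else 0 : ℕ) : ℤ) else 0) := by split_ifs <;> simp
      rcases hinv.leaf_or_leads hnd with hl | ⟨a, hl, ha⟩
      · rw [ev.pot_leaf (w := w) (w' := w') hnd hl, ev.pot_leaf (w := w) (w' := w') hnd hl]
        exact ⟨by linarith, by linarith⟩
      · rw [ev.pot_leads (w := w) (w' := w') hl ha, ev.pot_leads (w := w) (w' := w') hl ha,
          hw a ha]
        -- If the child's count of updates grows, its unique predecessor `b` is on the path too and
        -- its own count grows along.
        by_cases hap : a ∈ path.map Prod.fst
        · have hsl : SLink m b j a := ⟨J, _, hJ, hd, hl⟩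
          obtain ⟨rfl, hbn⟩ := hi₁ j a hap hsl
          obtain ⟨b', hb', j', hl'⟩ := hpath.exists_pred hap
          obtain ⟨rfl, -⟩ := hinv.slink_unique hsl hl'
          rw [if_pos hap, if_neg hbn, if_pos rfl,
            if_pos ((List.mem_cons.1 hb').resolve_left hbr)]
          push_cast
          exact ⟨by linarith, by linarith⟩
        · rw [if_neg hap]
          simp only [add_zero, sub_self, mul_zero]
          exact ⟨by linarith, by linarith⟩
    · rw [hroot, hroot, pot_leaf hc hleaf, pot_leaf hc hleaf, if_pos rfl, if_pos rfl,
        if_pos (hn rfl)]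
      push_cast
      exact ⟨by exact_mod_cast hup, by exact_mod_cast hlow⟩
  exact (h b J hbr hJ).change hlen (fun j d d' hd hd' => (main j d d' hd hd').1)
    fun j d d' hd hd' => (main j d d' hd hd').2

/-- The number of keys below a node. -/
theorem Pot.contents (h : Pot m w) (hinv : MemInv m) {a : Addr} {L : List (K × V)}
    (hL : Contents m a L) (ha : a ≠ rootAddr) :
    (L.length : ℤ) ≤ pot m w 1 a ∧ pot m w (-1) a ≤ L.length := by
  induction hL with
  | empty hnd => simp [pot, hnd]
  | single hnd => simp [pot, hnd]
  | @rebuild a t q j L hq hL ih =>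
    have ht : t ≠ rootAddr := by
      rintro rfl
      exact hinv.root_ptr (.inr ⟨rfl, q, j, hq⟩)
    obtain ⟨J, hJ⟩ := hinv.target_inner hq
    have := ih ht
    rw [pot_leads (.inl rfl) hJ, pot_leads (.inl rfl) hJ] at this
    rwa [pot_leads (.inr ⟨q, j, hq⟩) hJ, pot_leads (.inr ⟨q, j, hq⟩) hJ]
  | @inner a I f hI hf ih =>
    have hp := h a I ha hI
    have hne : ∀ c ∈ I.children, c ≠ rootAddr := by
      rintro c hc rfl
      obtain ⟨j, hj⟩ := List.getElem?_of_mem hc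
      exact hinv.root_ptr (.inl ⟨I, hI, hj⟩)
    have hlen : ((I.children.flatMap f).length : ℤ) =
        (I.children.map fun c => ((f c).length : ℤ)).sum := by
      rw [List.length_flatMap]
      simp [Nat.cast_list_sum, List.map_map, Function.comp_def]
    rw [hlen, pot_leads (.inl rfl) hI, pot_leads (.inl rfl) hI]
    constructor
    · have := List.sum_le_sum (l := I.children) (f := fun c => ((f c).length : ℤ))
        (g := pot m w 1) fun c hc => (ih c hc (hne c hc)).1
      have := hp.sum_le
      linarith
    · have := List.sum_le_sum (l := I.children) (g := fun c => ((f c).length : ℤ))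
        (f := pot m w (-1)) fun c hc => (ih c hc (hne c hc)).2
      have := hp.le_sum
      linarith

end Potential

/-! ### Counting threads and updates -/

section Counting

/-- The thread still has to increment the count of the node. -/
def Pc.Owes : Pc K V → Addr → Prop
  | .bump todo _, a => a ∈ todo.map Prod.fst
  | _, _ => False

/-- The thread has updated below the node and is still going to compare its count, or to announce
the rebuilding of the node or one above it. -/
def Resp (m : Mem K V) : Pc K V → Addr → Prop
  | .bump _ path, a => a ∈ path.map Prod.fst
  | .check todo _, a => a ∈ todo.map Prod.fst
  | .announce b _ _, a => ∃ q n, Chain m b q n ∧ a ∈ b :: q.map Prod.fst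
  | _, _ => False

/-- `b` has a child pointer to `c`. -/
def DLink (m : Mem K V) (b c : Addr) : Prop :=
  ∃ (I : Inner K) (i : ℕ), m.node b = some (.inner I) ∧ I.children[i]? = some c

/-- The thread may come to update below the node without restarting. -/
def Enter (m : Mem K V) : Pc K V → Addr → Prop
  | .search _ n path, a => Relation.ReflTransGen (DLink m) n a ∨ a ∈ path.map Prod.fst
  | .update _ n path _ _ _, a => Relation.ReflTransGen (DLink m) n a ∨ a ∈ path.map Prod.fst
  | _, _ => False

open Classical in
/-- The number of threads with a property. -/
noncomputable def num {p : ℕ} (P : Pc K V → Prop) (th : Fin p → Pc K V) : ℕ :=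
  (Finset.univ.filter fun j => P (th j)).card

theorem num_le {p : ℕ} (P : Pc K V → Prop) (th : Fin p → Pc K V) : num P th ≤ p := by
  classical
  exact (Finset.card_le_univ _).trans_eq (Fintype.card_fin p)

theorem num_mono {p : ℕ} {P Q : Pc K V → Prop} {th : Fin p → Pc K V}
    (h : ∀ j, P (th j) → Q (th j)) : num P th ≤ num Q th := by
  classical
  exact Finset.card_le_card (Finset.monotone_filter_right _ fun j _ => h j)

theorem num_eq_zero {p : ℕ} {P : Pc K V → Prop} {th : Fin p → Pc K V}
    (h : ∀ j, ¬ P (th j)) : num P th = 0 := by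
  classical
  exact Finset.card_eq_zero.2 (Finset.filter_eq_empty_iff.2 fun j _ => h j)

open Classical in
theorem num_eq_sum {p : ℕ} (P : Pc K V → Prop) (th : Fin p → Pc K V) (j : Fin p) :
    num P th = (if P (th j) then 1 else 0) +
      ∑ k ∈ Finset.univ.erase j, if P (th k) then 1 else 0 := by
  rw [num, Finset.card_filter]
  exact (Finset.add_sum_erase _ (fun k => if P (th k) then 1 else 0) (Finset.mem_univ j)).symm

open Classical in
theorem num_update_le {p : ℕ} {P P' : Pc K V → Prop} {th : Fin p → Pc K V} {j : Fin p}
    {s : Pc K V} (h : ∀ k, P' (th k) → P (th k)) :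
    num P' (Function.update th j s) + (if P (th j) then 1 else 0) ≤
      num P th + if P' s then 1 else 0 := by
  rw [num_eq_sum P' _ j, num_eq_sum P th j, Function.update_self]
  have : ∑ k ∈ Finset.univ.erase j, (if P' (Function.update th j s k) then 1 else 0) ≤
      ∑ k ∈ Finset.univ.erase j, if P (th k) then 1 else 0 := by
    refine Finset.sum_le_sum fun k hk => ?_
    rw [Function.update_of_ne (Finset.ne_of_mem_erase hk)]
    by_cases h' : P' (th k)
    · rw [if_pos h', if_pos (h k h')]
    · rw [if_neg h']; exact Nat.zero_le _
  omega

open Classical in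
theorem le_num_update {p : ℕ} {P P' : Pc K V → Prop} {th : Fin p → Pc K V} {j : Fin p}
    {s : Pc K V} (h : ∀ k, P (th k) → P' (th k)) :
    num P th + (if P' s then 1 else 0) ≤
      num P' (Function.update th j s) + if P (th j) then 1 else 0 := by
  rw [num_eq_sum P' _ j, num_eq_sum P th j, Function.update_self]
  have : ∑ k ∈ Finset.univ.erase j, (if P (th k) then 1 else 0) ≤
      ∑ k ∈ Finset.univ.erase j, if P' (Function.update th j s k) then 1 else 0 := by
    refine Finset.sum_le_sum fun k hk => ?_
    rw [Function.update_of_ne (Finset.ne_of_mem_erase hk)]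
    by_cases h' : P (th k)
    · rw [if_pos h', if_pos (h k h')]
    · rw [if_neg h']; exact Nat.zero_le _
  omega

/-- The `count` field of an inner node. -/
def cnt (m : Mem K V) (a : Addr) : ℕ :=
  match m.node a with
  | some (.inner I) => I.count
  | _ => 0

theorem cnt_eq {m : Mem K V} {a : Addr} {I : Inner K} (h : m.node a = some (.inner I)) :
    cnt m a = I.count := by
  simp [cnt, h]

/-- The number of updates below a node, including those that have not been counted yet. -/
noncomputable def upd {p : ℕ} (S : State K V p) (a : Addr) : ℕ :=
  cnt S.mem a + num (fun s => s.Owes a) S.thread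

-- Since only thread `j` moves, the number of updates changes only through the count field and the
-- debt of this thread. In additive form the balance avoids truncated subtraction.
open Classical in
theorem upd_eq {p : ℕ} {S S' : State K V p} {j : Fin p} {s : Pc K V}
    (h : S'.thread = Function.update S.thread j s) (a : Addr) :
    upd S' a + cnt S.mem a + (if (S.thread j).Owes a then 1 else 0) =
      upd S a + cnt S'.mem a + if s.Owes a then 1 else 0 := by
  have h1 := num_update_le (th := S.thread) (j := j) (s := s) (P := fun s => s.Owes a)
    (P' := fun s => s.Owes a) fun _ => id
  have h2 := le_num_update (th := S.thread) (j := j) (s := s) (P := fun s => s.Owes a)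
    (P' := fun s => s.Owes a) fun _ => id
  rw [upd, upd, h]
  omega

end Counting

/-! ### Classification of steps -/

section Quiet

variable {m m' : Mem K V}

/-- The memory changes in auxiliary fields at most. -/
def QuietMem (m m' : Mem K V) : Prop :=
  m' = m ∨ ∃ a I I', m.node a = some (.inner I) ∧ I.Same I' ∧ I'.count = I.count ∧
    m' = m.write a I'

/-- Every key `k` that satisfies `R a k` leads the search through `a`. -/
structure Route [LinearOrder K] (R : Addr → K → Prop) (m : Mem K V) : Prop where
  root : ∀ k, R rootAddr k
  slot : ∀ {b c : Addr} {I : Inner K} {i : ℕ}, m.node b = some (.inner I) →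
    I.children[i]? = some c → ∀ k, R c k ↔ R b k ∧ searchIndex I.keys k = i
  target : ∀ {a t q : Addr} {j : ℕ}, m.node a = some (.rebuild t q j) → ∀ k, R t k ↔ R a k
  single : ∀ {a : Addr} {k : K} {x : V}, m.node a = some (.single k x) → R a k

/-- A searching thread is on the way to its key. -/
def ThreadRoute (R : Addr → K → Prop) : Pc K V → Prop
  | .search c n _ => R n c.key
  | .update c n _ _ _ _ => R n c.key
  | _ => True

/-- A step that changes neither pointers nor the number of updates. -/
structure Quiet [LinearOrder K] (m : Mem K V) (s : Pc K V) (m' : Mem K V) (s' : Pc K V) : Prop where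
  mem : QuietMem m m'
  owes : ∀ a, ¬ s.Owes a
  owes' : ∀ a, ¬ s'.Owes a
  resp : ∀ a, Resp m s a → Resp m s' a ∨ Covered m a ∨
    ∃ I, m.node a = some (.inner I) ∧ 4 * I.count ≤ I.initSize
  enter : ∀ a, Covered m a → Enter m s' a → Enter m s a
  route : ∀ R, Route R m → ThreadRoute R s → ThreadRoute R s'

theorem MemInv.not_covered_root (hinv : MemInv m) : ¬ Covered m rootAddr := by
  intro h
  cases h with
  | target h => exact hinv.root_ptr (.inr ⟨rfl, _, _, h⟩)
  | child hb hI hc =>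
    obtain ⟨j, hj⟩ := List.getElem?_of_mem hc
    exact hinv.root_ptr (.inl ⟨_, hI, hj⟩)

/-- Each node has only one incoming pointer. If it comes from an inner node, then `c` is no target
and can be covered only through its parent; so covered territory is entered through descriptors
alone. -/
theorem MemInv.covered_of_dlink (hinv : MemInv m) {b c : Addr} (h : DLink m b c)
    (hc : Covered m c) : Covered m b := by
  obtain ⟨I, i, hI, hi⟩ := h
  have hp : Ptr m b i c := .inl ⟨I, hI, hi⟩
  cases hc with
  | target h =>
    obtain ⟨rfl, -⟩ := hinv.ptr_unique hp (.inr ⟨rfl, _, _, h⟩)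
    rw [hI] at h
    cases h
  | child hb hI' hc' =>
    obtain ⟨j, hj⟩ := List.getElem?_of_mem hc'
    obtain ⟨rfl, -⟩ := hinv.ptr_unique hp (.inl ⟨_, hI', hj⟩)
    exact hb

theorem MemInv.covered_of_below (hinv : MemInv m) {b c : Addr}
    (h : Relation.ReflTransGen (DLink m) b c) (hc : Covered m c) : Covered m b := by
  induction h with
  | refl => exact hc
  | tail _ h ih => exact ih (hinv.covered_of_dlink h hc)

/-- The root is never covered, and child pointers alone do not lead from an uncovered node to a
covered one. So a thread that restarts is lost to every covered node. -/
theorem MemInv.not_enter_start (hinv : MemInv m) {a : Addr} (ha : Covered m a) (c : Cmd K V) :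
    ¬ Enter m (.start c) a := by
  rintro (h | h)
  · exact hinv.not_covered_root (hinv.covered_of_below h ha)
  · simp at h

theorem MemInv.not_enter_resume (hinv : MemInv m) {a : Addr} (ha : Covered m a) :
    ∀ r : Option (Cmd K V), ¬ Enter m (.resume r) a
  | none => id
  | some c => hinv.not_enter_start ha c

theorem not_owes_resume (r : Option (Cmd K V)) (a : Addr) : ¬ (Pc.resume r).Owes a := by
  cases r <;> exact id

theorem Route.resume [LinearOrder K] {R : Addr → K → Prop} (h : Route R m) (r : Option (Cmd K V)) :
    ThreadRoute R (.resume r) := by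
  cases r with
  | none => trivial
  | some c => exact h.root c.key

theorem markReturn_cases (op : Addr) (r : Option (Cmd K V)) (n : ℕ) (s : List Frame) :
    (∃ l, Pc.markReturn op r n s = .create op r l) ∨
      ∃ s', Pc.markReturn op r n s = .markLoop op r s' := by
  rcases s with - | ⟨f | f, s⟩ <;> simp [Pc.markReturn]

/-- Even where the remembered link is outdated the conclusion holds: the lower node is then frozen,
hence marked, and only covered nodes are marked. -/
theorem MemInv.covered_of_flink (hinv : MemInv m) {b a : Addr} {i : ℕ} (h : FLink m b i a)
    (ha : IsInner m a) (hb : Covered m b) : Covered m a := by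
  rcases h with ⟨L, hL⟩ | ⟨I, c, hI, hc, rfl | ⟨q, j, h⟩⟩
  · obtain ⟨J, hJ⟩ := ha
    exact hinv.marked hJ (hL.marked hJ)
  · exact .child hb hI (List.mem_of_getElem? hc) ha
  · exact .target h

theorem MemInv.covered_of_chain (hinv : MemInv m) {b n a : Addr} {q : List (Addr × ℕ)}
    (h : Chain m b q n) (hb : Covered m b) (ha : a ∈ b :: q.map Prod.fst) : Covered m a := by
  induction q generalizing b with
  | nil => simp only [List.map_nil, List.mem_singleton] at ha; exact ha ▸ hb
  | cons x q ih =>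
    rcases List.mem_cons.1 ha with rfl | ha
    · exact hb
    · exact ih h.2.2 (hinv.covered_of_flink h.1 h.2.1 hb) ha

/-- A thread whose announcement fails finds the node covered. -/
theorem MemInv.covered_of_not_matches (hinv : MemInv m) {b a : Addr} {i : ℕ} {I : Inner K}
    (h : FLink m b i a) (ha : IsInner m a) (hb : m.node b = some (.inner I))
    (hm : ¬ I.Matches i a) : Covered m a := by
  by_cases hs : I.status = Status.clean
  · rcases h with ⟨L, hL⟩ | ⟨I', c, hI', hc, rfl | ⟨q, j, h⟩⟩
    · obtain ⟨J, hJ⟩ := ha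
      exact hinv.marked hJ (hL.marked hJ)
    · rw [hb] at hI'
      cases hI'
      exact absurd ⟨hc, hs⟩ hm
    · exact .target h
  · exact hinv.covered_of_flink h ha (hinv.marked hb hs)

/-- The five kinds of steps. -/
theorem step_kinds [LinearOrder K] {collab : Bool} {s s' : Pc K V} (hinv : MemInv m) (hs : ThreadInv m s)
    (h : Step collab m s m' s') : Quiet m s m' s' ∨
      (∃ c n path i child t I, s = .update c n path i child t ∧ s' = .bump path path ∧
        m.node n = some (.inner I) ∧ I.Matches i child ∧
        m' = (m.publish t).write n (I.setChild i (m.next, []))) ∨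
      (∃ a i todo path I, s = .bump ((a, i) :: todo) path ∧ s' = .bump todo path ∧
        m.node a = some (.inner I) ∧ m' = m.write a { I with count := I.count + 1 }) ∨
      (∃ a parent i I, s = .announce a parent i ∧ s' = .markCall (m.next, []) none a [] ∧
        m.node parent = some (.inner I) ∧ I.Matches i a ∧
        m' = (m.descriptor a parent i).write parent (I.setChild i (m.next, []))) ∨
      ∃ op r t target parent i I, s = .install op r t ∧ s' = .resume r ∧
        m.node op = some (.rebuild target parent i) ∧ m.node parent = some (.inner I) ∧
        I.Matches i op ∧ m' = (m.publish t).write parent (I.setChild i (m.next, [])) := by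
  -- Most steps have no debts or responsibilities to preserve and end in a state that cannot enter
  -- any node; this settles them uniformly.
  have mark : ∀ {s s' : Pc K V}, QuietMem m m' → (∀ a, ¬ s.Owes a) → (∀ a, ¬ s'.Owes a) →
      (∀ a, ¬ Resp m s a) → (∀ a, ¬ Enter m s' a) → (∀ R, ThreadRoute R s') →
      Quiet m s m' s' := fun h1 h2 h3 h4 h5 h6 =>
    ⟨h1, h2, h3, fun a h => absurd h (h4 a), fun a _ h => absurd h (h5 a), fun R _ _ => h6 R⟩
  have ret : ∀ {s : Pc K V} {op : Addr} {r : Option (Cmd K V)} {n : ℕ} {st : List Frame}, QuietMem m m' → (∀ a, ¬ s.Owes a) →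
      (∀ a, ¬ Resp m s a) → Quiet m s m' (.markReturn op r n st) := by
    intro s op r n st h1 h2 h3
    rcases markReturn_cases op r n st with ⟨l, h⟩ | ⟨s, h⟩ <;> rw [h] <;>
      exact mark h1 h2 (fun _ => id) h3 (fun _ => id) fun _ => trivial
  cases h with
  | invoke c =>
    exact .inl ⟨.inl rfl, fun _ => id, fun _ => id, fun _ h => h.elim,
      fun a ha h => absurd h (hinv.not_enter_start ha c), fun R h _ => h.root _⟩
  | @searchInner c n path I child J hn hc hJ =>
    refine .inl ⟨.inl rfl, fun _ => id, fun _ => id, fun _ h => h.elim, ?_, fun R h h' => ?_⟩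
    · rintro a - (h | h)
      · exact .inl (.head ⟨I, _, hn, hc⟩ h)
      · rw [List.map_append, List.mem_append] at h
        rcases h with h | h
        · exact .inr h
        · rw [List.map_singleton, List.mem_singleton] at h
          subst h
          exact .inl (.single ⟨I, _, hn, hc⟩)
    · exact (h.slot hn hc _).2 ⟨h', rfl⟩
  | searchRebuild =>
    exact .inl (mark (.inl rfl) (fun _ => id) (fun _ => id) (fun _ => id) (fun _ => id)
      fun _ => trivial)
  | searchLeaf =>
    exact .inl ⟨.inl rfl, fun _ => id, fun _ => id, fun _ h => h.elim, fun _ _ => id, fun _ _ => id⟩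
  | searchDone =>
    exact .inl (mark (.inl rfl) (fun _ => id) (fun _ => id) (fun _ => id) (fun _ => id)
      fun _ => trivial)
  | updateSuccess hn hm => exact .inr (.inl ⟨_, _, _, _, _, _, _, rfl, rfl, hn, hm, rfl⟩)
  | updateFailedMain =>
    exact .inl ⟨.inl rfl, fun _ => id, fun _ => id, fun _ h => h.elim, fun _ _ => id, fun _ _ => id⟩
  | updateFailedAux =>
    exact .inl ⟨.inl rfl, fun _ => id, fun _ => id, fun _ h => h.elim,
      fun a ha h => absurd h (hinv.not_enter_start ha _), fun R h _ => h.root _⟩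
  | bumpNext ha => exact .inr (.inr (.inl ⟨_, _, _, _, _, rfl, rfl, ha, rfl⟩))
  | bumpDone =>
    exact .inl ⟨.inl rfl, fun _ h => by simp [Pc.Owes] at h, fun _ => id, fun _ h => .inl h,
      fun _ _ h => h.elim, fun _ _ _ => trivial⟩
  | @checkNext a i todo parent I ha hlt =>
    refine .inl ⟨.inl rfl, fun _ => id, fun _ => id, fun b h => ?_, fun _ _ h => h.elim,
      fun _ _ _ => trivial⟩
    rcases List.mem_cons.1 h with rfl | h
    · refine .inr (.inr ⟨I, ha, ?_⟩)
      have : (4 * I.count : ℚ) ≤ I.initSize := by linarith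
      exact_mod_cast this
    · exact .inl h
  | @checkFound a i todo parent I ha hle =>
    obtain ⟨n, hn⟩ := hs
    exact .inl ⟨.inl rfl, fun _ => id, fun _ => id, fun b h => .inl ⟨todo, n, hn.2.2, h⟩,
      fun _ _ h => h.elim, fun _ _ _ => trivial⟩
  | checkDone =>
    exact .inl (mark (.inl rfl) (fun _ => id) (fun _ => id)
      (fun _ h => by simp [Resp] at h) (fun _ => id) fun _ => trivial)
  | announceSuccess hp hm => exact .inr (.inr (.inr (.inl ⟨_, _, _, _, rfl, rfl, hp, hm, rfl⟩)))
  | announceFailed hp hm =>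
    refine .inl ⟨.inl rfl, fun _ => id, fun _ => id, fun b h => .inr (.inl ?_),
      fun _ _ h => h.elim, fun _ _ _ => trivial⟩
    obtain ⟨q, n, hq, hb⟩ := h
    exact hinv.covered_of_chain hq (hinv.covered_of_not_matches hs.1 hs.2 hp hm) hb
  | markEmpty => exact .inl (ret (.inl rfl) (fun _ => id) fun _ => id)
  | markSingle => exact .inl (ret (.inl rfl) (fun _ => id) fun _ => id)
  | markInner ha =>
    refine .inl (mark (.inr ⟨_, _, _, ha, Inner.casStatus_same _ (by decide), ?_, rfl⟩)
      (fun _ => id) (fun _ => id) (fun _ => id) (fun _ => id) fun _ => trivial)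
    unfold Inner.casStatus
    split_ifs <;> rfl
  | @jobTake op r a st I ha =>
    refine .inl (mark (.inr ⟨a, I, { I with nextMark := I.nextMark + 1 }, ha,
      ⟨rfl, rfl, rfl, id⟩, rfl, rfl⟩)
      (fun _ => id) ?_ (fun _ => id) ?_ ?_) <;> split_ifs <;>
      first | exact fun _ => id | exact fun _ => trivial
  | statusFinished => exact .inl (ret (.inl rfl) (fun _ => id) fun _ => id)
  | scanDone ha =>
    refine .inl (ret (.inr ⟨_, _, _, ha, Inner.casStatus_same _ ?_, ?_, rfl⟩)
      (fun _ => id) fun _ => id)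
    · simp [Status.finished, Status.clean]
    · unfold Inner.casStatus
      split_ifs <;> rfl
  | installSuccess hop hp hm =>
    exact .inr (.inr (.inr (.inr ⟨_, _, _, _, _, _, _, rfl, rfl, hop, hp, hm, rfl⟩)))
  | installFailed =>
    exact .inl ⟨.inl rfl, fun _ => id, not_owes_resume _, fun _ h => h.elim,
      fun a ha h => absurd h (hinv.not_enter_resume ha _), fun R h _ => h.resume _⟩
  | _ =>
    exact .inl (mark (.inl rfl) (fun _ => id) (fun _ => id) (fun _ => id) (fun _ => id)
      fun _ => trivial)

end Quiet

/-! ### Routing of keys and distinctness of the leaves -/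

section Routing

variable [LinearOrder K] {m m' : Mem K V} {n c : Addr} {I : Inner K} {i : ℕ}
  {R R' : Addr → K → Prop}

/-- The search for the key visits the position. -/
def Tree.Routes : Tree K V → List ℕ → K → Prop
  | _, [], _ => True
  | .inner ks d ch, j :: pos, k =>
    searchIndex ks k = j ∧ ∀ h : j < d, (ch ⟨j, h⟩).Routes pos k
  | .empty, _ :: _, _ => True
  | .single _ _, _ :: _, _ => True

theorem Tree.routes_snoc {t : Tree K V} {pos : List ℕ} {ks : List K} {d : ℕ}
    {ch : Fin d → Tree K V} (h : t.subtree pos = some (.inner ks d ch)) (j : ℕ) (k : K) :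
    t.Routes (pos ++ [j]) k ↔ t.Routes pos k ∧ searchIndex ks k = j := by
  induction pos generalizing t with
  | nil =>
    simp only [Tree.subtree, Option.some.injEq] at h
    subst h
    simp [Tree.Routes]
  | cons x pos ih =>
    cases t with
    | inner ks' d' ch' =>
      simp only [Tree.subtree] at h
      split_ifs at h with hx
      simp only [List.cons_append, Tree.Routes, hx, forall_true_left, ih h, and_assoc]
    | _ => simp [Tree.subtree] at h

omit [LinearOrder K] in
theorem Tree.mem_toList_inner {ks : List K} {d : ℕ} {ch : Fin d → Tree K V} {e : K × V} :
    e ∈ (Tree.inner ks d ch).toList ↔ ∃ i, e ∈ (ch i).toList := by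
  simp [Tree.toList, List.mem_flatten, List.mem_ofFn]

theorem Tree.Good.routes {t : Tree K V} (ht : t.Good) {pos : List ℕ} {k : K} {x : V}
    (h : t.subtree pos = some (.single k x)) : t.Routes pos k ∧ (k, x) ∈ t.toList := by
  induction pos generalizing t with
  | nil =>
    simp only [Tree.subtree, Option.some.injEq] at h
    subst h
    simp [Tree.Routes, Tree.toList]
  | cons y pos ih =>
    cases t with
    | inner ks d ch =>
      simp only [Tree.subtree] at h
      split_ifs at h with hy
      obtain ⟨-, -, h3, h4⟩ := ht ⟨y, hy⟩
      obtain ⟨h5, h6⟩ := ih h4 h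
      exact ⟨⟨h3 _ h6, fun _ => h5⟩, Tree.mem_toList_inner.2 ⟨_, h6⟩⟩
    | _ => simp [Tree.subtree] at h

omit [LinearOrder K] in
theorem Graft.slots_old {fresh : List ℕ → Option (Node K V)} (g : Graft m m' n I i c fresh)
    {b d' : Addr} {J' : Inner K} {j : ℕ} (hb : b.1 ≠ m.next) (hJ' : m'.node b = some (.inner J'))
    (hj : J'.children[j]? = some d') : ∃ J d, m.node b = some (.inner J) ∧ J'.keys = J.keys ∧
      J.children[j]? = some d ∧ (d' = d ∨ (b = n ∧ j = i ∧ d = c ∧ d' = (m.next, []))) := by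
  obtain ⟨J, hJ, -, hk, hlen, hs⟩ := g.slots hb hJ'
  have hlt := (List.getElem?_eq_some_iff.1 hj).1
  rw [hlen] at hlt
  have hd := List.getElem?_eq_getElem hlt
  exact ⟨J, _, hJ, hk, hd, (hs j _ _ hd hj).imp_left And.left⟩

/-- On the new block, a key is routed to a position if it is routed to the redirected slot and the
search inside the tree visits the position. Nothing changes at old addresses, so the assertions
about other threads remain valid. -/
theorem Route.publish {t : Tree K V} (hR : Route R m) (hinv : MemInv m)
    (g : Graft m m' n I i c (treeBlock t m.next)) (ht : t.Good)
    (hkeys : ∀ e ∈ t.toList, R n e.1 ∧ searchIndex I.keys e.1 = i) :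
    ∃ R', Route R' m' ∧ ∀ a : Addr, a.1 ≠ m.next → R' a = R a := by
  obtain ⟨R', hnew, hold⟩ : ∃ R' : Addr → K → Prop,
      (∀ pos k, R' (m.next, pos) k ↔ (R n k ∧ searchIndex I.keys k = i) ∧ t.Routes pos k) ∧
      ∀ a : Addr, a.1 ≠ m.next → R' a = R a :=
    ⟨fun a k => if a.1 = m.next then (R n k ∧ searchIndex I.keys k = i) ∧ t.Routes a.2 k
      else R a k, fun pos k => by simp, fun a ha => by simp [ha]⟩
  have hne : ∀ {a : Addr} {nd}, m.node a = some nd → a.1 ≠ m.next := fun h => (hinv.alloc h).ne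
  refine ⟨R', ⟨?_, ?_, ?_, ?_⟩, hold⟩
  · obtain ⟨J, -, hJ, -⟩ := hinv.root
    rw [hold _ (hne hJ)]
    exact hR.root
  · intro b d J j hJ hj k
    by_cases hb : b.1 = m.next
    · obtain ⟨b, pos⟩ := b
      simp only at hb
      subst hb
      obtain ⟨rfl, -⟩ := g.treeBlock_ptr (.inl ⟨J, hJ, hj⟩)
      rw [g.new] at hJ
      obtain ⟨ks, d, ch, hs, rfl, -⟩ := treeBlock_inner hJ
      rw [hnew, hnew, Tree.routes_snoc hs]
      simp only [and_assoc]
    · obtain ⟨J₀, d₀, hJ₀, hk, hj₀, rfl | ⟨rfl, rfl, rfl, rfl⟩⟩ := g.slots_old hb hJ hj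
      · obtain ⟨nd, hnd⟩ := hinv.ptr_alloc (.inl ⟨J₀, hJ₀, hj₀⟩)
        rw [hold _ hb, hold _ (hne hnd), hk]
        exact hR.slot hJ₀ hj₀ k
      · rw [g.hn] at hJ₀
        cases hJ₀
        rw [hnew, hold _ hb, hk]
        simp [Tree.Routes]
  · intro a t' q j ha k
    by_cases hx : a.1 = m.next
    · obtain ⟨b, pos⟩ := a
      simp only at hx
      subst hx
      rw [g.new] at ha
      exact absurd ha treeBlock_rebuild
    · have han : a ≠ n := by
        rintro rfl
        rw [g.hn'] at ha
        cases ha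
      rw [g.old han hx] at ha
      obtain ⟨J, hJ⟩ := hinv.target_inner ha
      rw [hold _ hx, hold _ (hne hJ)]
      exact hR.target ha k
  · intro a k x ha
    by_cases hx : a.1 = m.next
    · obtain ⟨b, pos⟩ := a
      simp only at hx
      subst hx
      rw [g.new, treeBlock, Option.map_eq_some_iff] at ha
      obtain ⟨s, hs, ha⟩ := ha
      cases s <;> cases ha
      obtain ⟨h1, h2⟩ := ht.routes hs
      exact (hnew _ _).2 ⟨hkeys _ h2, h1⟩
    · have han : a ≠ n := by
        rintro rfl
        rw [g.hn'] at ha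
        cases ha
      rw [g.old han hx] at ha
      rw [hold _ hx]
      exact hR.single ha

/-- The descriptor inherits the keys of its target, which are those of the slot it now occupies. -/
theorem Route.descriptor (hR : Route R m) (hinv : MemInv m)
    (g : Graft m m' n I i c (descriptorBlock K V c n i)) :
    ∃ R', Route R' m' ∧ ∀ a : Addr, a.1 ≠ m.next → R' a = R a := by
  obtain ⟨R', hnew, hold⟩ : ∃ R' : Addr → K → Prop,
      (∀ pos k, R' (m.next, pos) k ↔ R c k) ∧ ∀ a : Addr, a.1 ≠ m.next → R' a = R a :=
    ⟨fun a k => if a.1 = m.next then R c k else R a k, fun pos k => by simp,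
      fun a ha => by simp [ha]⟩
  have hne : ∀ {a : Addr} {nd}, m.node a = some nd → a.1 ≠ m.next := fun h => (hinv.alloc h).ne
  obtain ⟨ndc, hndc⟩ := hinv.ptr_alloc g.slot
  have hfresh : ∀ pos nd, m'.node (m.next, pos) = some nd → nd = .rebuild c n i := by
    intro pos nd h
    rw [g.new, descriptorBlock] at h
    split_ifs at h
    exact (Option.some.inj h).symm
  refine ⟨R', ⟨?_, ?_, ?_, ?_⟩, hold⟩
  · obtain ⟨J, -, hJ, -⟩ := hinv.root
    rw [hold _ (hne hJ)]
    exact hR.root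
  · intro b d J j hJ hj k
    by_cases hb : b.1 = m.next
    · obtain ⟨b, pos⟩ := b
      simp only at hb
      subst hb
      cases hfresh _ _ hJ
    · obtain ⟨J₀, d₀, hJ₀, hk, hj₀, rfl | ⟨rfl, rfl, rfl, rfl⟩⟩ := g.slots_old hb hJ hj
      · obtain ⟨nd, hnd⟩ := hinv.ptr_alloc (.inl ⟨J₀, hJ₀, hj₀⟩)
        rw [hold _ hb, hold _ (hne hnd), hk]
        exact hR.slot hJ₀ hj₀ k
      · rw [hnew, hold _ hb, hk]
        exact hR.slot hJ₀ hj₀ k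
  · intro a t' q j ha k
    by_cases hx : a.1 = m.next
    · obtain ⟨b, pos⟩ := a
      simp only at hx
      subst hx
      cases hfresh _ _ ha
      rw [hnew, hold _ (hne hndc)]
    · have han : a ≠ n := by
        rintro rfl
        rw [g.hn'] at ha
        cases ha
      rw [g.old han hx] at ha
      obtain ⟨J, hJ⟩ := hinv.target_inner ha
      rw [hold _ hx, hold _ (hne hJ)]
      exact hR.target ha k
  · intro a k x ha
    by_cases hx : a.1 = m.next
    · obtain ⟨b, pos⟩ := a
      simp only at hx
      subst hx
      cases hfresh _ _ ha
    · have han : a ≠ n := by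
        rintro rfl
        rw [g.hn'] at ha
        cases ha
      rw [g.old han hx] at ha
      rw [hold _ hx]
      exact hR.single ha

theorem Route.write (hR : Route R m) {a : Addr} {I I' : Inner K}
    (ha : m.node a = some (.inner I)) (h : I.Same I') : Route R (m.write a I') := by
  have hnode : ∀ {b : Addr} {nd}, (m.write a I').node b = some nd → (∀ J, nd ≠ .inner J) →
      m.node b = some nd := by
    intro b nd hb hnd
    by_cases hba : b = a
    · subst hba
      simp only [Mem.write, Function.update_self, Option.some.injEq] at hb
      exact absurd hb.symm (hnd I')
    · simpa only [Mem.write, Function.update_of_ne hba] using hb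
  refine ⟨hR.root, ?_, fun h => hR.target (hnode h (by simp)),
    fun h => hR.single (hnode h (by simp))⟩
  intro b d J j hJ hj k
  by_cases hba : b = a
  · subst hba
    simp only [Mem.write, Function.update_self, Option.some.injEq, Node.inner.injEq] at hJ
    subst hJ
    rw [h.keys]
    rw [h.children] at hj
    exact hR.slot ha hj k
  · simp only [Mem.write, Function.update_of_ne hba] at hJ
    exact hR.slot hJ hj k

theorem Route.contents (hR : Route R m) {a : Addr} {L : List (K × V)} (hL : Contents m a L) :
    ∀ e ∈ L, R a e.1 := by
  induction hL with
  | empty => simp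
  | single ha => simpa using hR.single ha
  | rebuild ha _ ih => exact fun e he => (hR.target ha _).1 (ih e he)
  | inner f ha _ ih =>
    intro e he
    obtain ⟨c, hc, he⟩ := List.mem_flatMap.1 he
    obtain ⟨j, hj⟩ := List.getElem?_of_mem hc
    exact ((hR.slot ha hj _).1 (ih c hc e he)).1

theorem ThreadRoute.congr {s : Pc K V} (hinv : MemInv m) (hs : ThreadInv m s)
    (h : ThreadRoute R s) (hold : ∀ a : Addr, a.1 ≠ m.next → R' a = R a) : ThreadRoute R' s := by
  cases s with
  | search c n path =>
    obtain ⟨-, J, hJ⟩ := hs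
    rw [ThreadRoute, hold _ (hinv.alloc hJ).ne]
    exact h
  | update c n path i child t =>
    obtain ⟨-, -, J, hJ, -⟩ := hs
    rw [ThreadRoute, hold _ (hinv.alloc hJ).ne]
    exact h
  | _ => trivial

/-- The keys of a leaf are distinct from the keys of the other leaves. -/
theorem Route.nodup (hR : Route R m) {a : Addr} {L : List (K × V)} (hL : Contents m a L) :
    (L.map Prod.fst).Nodup := by
  induction hL with
  | empty => simp
  | single ha => simp
  | rebuild ha _ ih => exact ih
  | @inner a I f ha hf ih =>
    rw [List.map_flatMap, List.nodup_flatMap]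
    refine ⟨ih, List.pairwise_iff_getElem.2 fun i j hi hj hij => ?_⟩
    intro k hk hk'
    obtain ⟨e, he, rfl⟩ := List.mem_map.1 hk
    obtain ⟨e', he', hee⟩ := List.mem_map.1 hk'
    have h1 := hR.contents (hf _ (List.getElem_mem hi)) e he
    have h2 := hR.contents (hf _ (List.getElem_mem hj)) e' he'
    rw [hee] at h2
    have h3 := ((hR.slot ha (List.getElem?_eq_getElem hi) _).1 h1).2
    have h4 := ((hR.slot ha (List.getElem?_eq_getElem hj) _).1 h2).2
    omega

end Routing

/-! ### The global invariant and its preservation -/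

section Invariant

variable [LinearOrder K] {p : ℕ}

/-- The invariant of the system. -/
structure Inv (S : State K V p) : Prop where
  mem : MemInv S.mem
  thread : ∀ j, ThreadInv S.mem (S.thread j)
  pot : Pot S.mem (upd S)
  free : ∀ a I, S.mem.node a = some (.inner I) → ¬ Covered S.mem a →
    4 * upd S a ≤ I.initSize + 4 * num (fun s => Resp S.mem s a) S.thread
  enter : ∀ a I, S.mem.node a = some (.inner I) →
    4 * (upd S a + num (fun s => Enter S.mem s a) S.thread) ≤ I.initSize + 8 * p
  route : ∃ R, Route R S.mem ∧ ∀ j, ThreadRoute R (S.thread j)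

/-- The effect of a step in which the nodes `a` with `δ a = 1` see an update. -/
structure Effect (S S' : State K V p) (j : Fin p) (s' : Pc K V) (δ : Addr → ℕ) : Prop where
  upd_old : ∀ a, IsInner S.mem a → upd S' a = upd S a + δ a
  upd_new : ∀ a, IsInner S'.mem a → ¬ IsInner S.mem a → upd S' a = 0
  pot : Pot S'.mem (upd S')
  le_one : ∀ a, δ a ≤ 1
  resp : ∀ a, δ a = 1 → ¬ Resp S.mem (S.thread j) a ∧ Resp S'.mem s' a
  resp_stays : ∀ a, ¬ Covered S'.mem a → Resp S.mem (S.thread j) a →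
    Resp S'.mem s' a ∨ ∃ I, S'.mem.node a = some (.inner I) ∧ 4 * I.count ≤ I.initSize
  enter : ∀ a, δ a = 1 → Enter S.mem (S.thread j) a ∧ ¬ Enter S'.mem s' a
  enter_stays : ∀ a, IsInner S.mem a → Covered S.mem a → Enter S'.mem s' a →
    Enter S.mem (S.thread j) a
  dlink : ∀ b c nd, DLink S'.mem b c → S.mem.node c = some nd →
    DLink S.mem b c ∧ ∃ nd, S.mem.node b = some nd
  route : ∀ R, Route R S.mem → ThreadRoute R (S.thread j) → ∃ R', Route R' S'.mem ∧
    (∀ a : Addr, a.1 ≠ S.mem.next → R' a = R a) ∧ ThreadRoute R' s'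

variable {m m' : Mem K V}

omit [LinearOrder K] in
theorem Resp.mono (ev : Evolve m m') {s : Pc K V} {a : Addr} (h : Resp m s a) : Resp m' s a := by
  cases s with
  | announce b q i =>
    obtain ⟨q, n, hq, ha⟩ := h
    exact ⟨q, n, hq.mono ev, ha⟩
  | bump => exact h
  | check => exact h
  | _ => exact h.elim

-- A child pointer to an old node comes from an old node that had it before. So the descendants by
-- child pointers, among old nodes, can only become fewer, and no idle bystander gains access to a
-- node.
omit [LinearOrder K] in
theorem below_of_dlink (hd : ∀ b c nd, DLink m' b c → m.node c = some nd →
      DLink m b c ∧ ∃ nd, m.node b = some nd) {b c : Addr}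
    (h : Relation.ReflTransGen (DLink m') b c) {nd : Node K V} (hc : m.node c = some nd) :
    Relation.ReflTransGen (DLink m) b c := by
  induction h generalizing nd with
  | refl => exact .refl
  | tail _ h ih =>
    obtain ⟨h1, nd', h2⟩ := hd _ _ _ h hc
    exact (ih h2).tail h1

omit [LinearOrder K] in
theorem Enter.anti (hd : ∀ b c nd, DLink m' b c → m.node c = some nd →
      DLink m b c ∧ ∃ nd, m.node b = some nd) {s : Pc K V} {a : Addr} (ha : IsInner m a)
    (h : Enter m' s a) : Enter m s a := by
  obtain ⟨I, hI⟩ := ha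
  cases s with
  | search => exact h.imp_left fun h => below_of_dlink hd h hI
  | update => exact h.imp_left fun h => below_of_dlink hd h hI
  | _ => exact h.elim

theorem ThreadInv.owes_resp {s : Pc K V} (hs : ThreadInv m s) {a : Addr} (h : s.Owes a) :
    Resp m s a := by
  cases s with
  | bump todo path => exact (hs.2.1.map Prod.fst).subset h
  | _ => exact h.elim

theorem ThreadInv.owes_isInner {s : Pc K V} (hs : ThreadInv m s) {a : Addr} (h : s.Owes a) :
    IsInner m a := by
  cases s with
  | bump todo path =>
    obtain ⟨n, hn⟩ := hs.1
    exact hn.isInner_of_mem ((hs.2.1.map Prod.fst).subset h)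
  | _ => exact h.elim

/-- An update is paid for twice: at uncovered nodes by a thread that becomes responsible, at covered
nodes by a thread that loses the possibility to update there. -/
theorem Effect.inv {S S' : State K V p} {j : Fin p} {s' : Pc K V} {δ : Addr → ℕ}
    (e : Effect S S' j s' δ) (h : Inv S) (hth : S'.thread = Function.update S.thread j s')
    (ev : Evolve S.mem S'.mem) (hmem : MemInv S'.mem) (hs' : ThreadInv S'.mem s') : Inv S' := by
  classical
  have hthr : ∀ k, ThreadInv S'.mem (S'.thread k) := by
    intro k
    rw [hth]
    by_cases hk : k = j
    · subst hk
      rwa [Function.update_self]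
    · rw [Function.update_of_ne hk]
      exact (h.thread k).mono ev
  refine ⟨hmem, hthr, e.pot, ?_, ?_, ?_⟩
  · intro a I' hI' hcov'
    by_cases ha : IsInner S.mem a
    · have hcov : ¬ Covered S.mem a := fun hc => hcov' (hc.mono ev)
      obtain ⟨I, hI⟩ := ha
      obtain ⟨J, hJ, -, hsz, -⟩ := ev.inner hI
      rw [hI'] at hJ
      cases hJ
      have h1 := h.free a I hI hcov
      have h2 := e.upd_old a ⟨I, hI⟩
      have h3 := le_num_update (th := S.thread) (j := j) (s := s')
        (P := fun s => Resp S.mem s a) (P' := fun s => Resp S'.mem s a) fun k hk => hk.mono ev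
      rw [← hth] at h3
      have h4 := e.resp a
      have h5 := e.le_one a
      have h6 := num_mono (th := S'.thread) (P := fun s => s.Owes a)
        (Q := fun s => Resp S'.mem s a) fun k => (hthr k).owes_resp
      by_cases hr : Resp S.mem (S.thread j) a
      · have h7 : δ a = 0 := by
          have : δ a ≠ 1 := fun h => (h4 h).1 hr
          omega
        rcases e.resp_stays a hcov' hr with hr' | ⟨J, hJ, hle⟩
        · rw [if_pos hr, if_pos hr'] at h3
          omega
        · rw [hI'] at hJ
          cases hJ
          -- The bound is renewed from scratch: the count is at most a quarter of the initial size,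
          -- and by `h6` all uncounted updates are owed by responsible threads.
          rw [upd, cnt_eq hI']
          omega
      · rw [if_neg hr] at h3
        by_cases hδ : δ a = 1
        · rw [if_pos (h4 hδ).2] at h3
          omega
        · omega
    · rw [e.upd_new a ⟨I', hI'⟩ ha]
      omega
  · intro a I' hI'
    have hp := num_le (fun s => Enter S'.mem s a) S'.thread
    by_cases ha : IsInner S.mem a
    · have h2 := e.upd_old a ha
      have h5 := e.le_one a
      have hanti := fun k => Enter.anti e.dlink ha (s := S.thread k)
      obtain ⟨I, hI⟩ := ha
      obtain ⟨J, hJ, -, hsz, -⟩ := ev.inner hI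
      rw [hI'] at hJ
      cases hJ
      -- At a covered node the sum of updates and potential entrants does not grow. At a node not
      -- covered before the step, both terms are bounded afresh, by the responsible threads and by
      -- `p`.
      by_cases hcov : Covered S.mem a
      · have h1 := h.enter a I hI
        have h3 := num_update_le (th := S.thread) (j := j) (s := s')
          (P := fun s => Enter S.mem s a) (P' := fun s => Enter S'.mem s a) hanti
        rw [← hth] at h3
        by_cases hδ : δ a = 1
        · obtain ⟨h6, h7⟩ := e.enter a hδ
          rw [if_pos h6, if_neg h7] at h3
          omega
        · have h6 := e.enter_stays a ⟨I, hI⟩ hcov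
          by_cases h7 : Enter S'.mem s' a
          · rw [if_pos (h6 h7), if_pos h7] at h3
            omega
          · rw [if_neg h7] at h3
            omega
      · have h1 := h.free a I hI hcov
        have h3 := num_le (fun s => Resp S.mem s a) S.thread
        by_cases hδ : δ a = 1
        -- The updating thread was not responsible before, so at most `p - 1` threads were; this
        -- leaves room for its update.
        · have h4 := le_num_update (th := S.thread) (j := j) (s := s')
            (P := fun s => Resp S.mem s a) (P' := fun s => Resp S'.mem s a) fun k hk => hk.mono ev
          obtain ⟨h6, h7⟩ := e.resp a hδ
          rw [if_neg h6, if_pos h7] at h4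
          have h8 := num_le (fun s => Resp S'.mem s a) (Function.update S.thread j s')
          omega
        · omega
    · rw [e.upd_new a ⟨I', hI'⟩ ha]
      omega
  · obtain ⟨R, hR, hRt⟩ := h.route
    obtain ⟨R', hR', hold, hRs⟩ := e.route R hR (hRt j)
    refine ⟨R', hR', fun k => ?_⟩
    rw [hth]
    by_cases hk : k = j
    · subst hk
      rwa [Function.update_self]
    · rw [Function.update_of_ne hk]
      exact (hRt k).congr h.mem (h.thread k) hold

omit [LinearOrder K] in
theorem QuietMem.node (h : QuietMem m m') {a : Addr} {I : Inner K}
    (ha : m.node a = some (.inner I)) : ∃ I', m'.node a = some (.inner I') ∧ I.Same I' ∧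
      I'.count = I.count := by
  rcases h with rfl | ⟨b, J, J', hb, hs, hc, rfl⟩
  · exact ⟨I, ha, ⟨rfl, rfl, rfl, id⟩, rfl⟩
  · by_cases hab : a = b
    · subst hab
      rw [hb] at ha
      cases ha
      exact ⟨J', by simp [Mem.write], hs, hc⟩
    · exact ⟨I, by simp [Mem.write, hab, ha], ⟨rfl, rfl, rfl, id⟩, rfl⟩

omit [LinearOrder K] in
/-- Writing fields of an inner node. -/
theorem node_write {a b : Addr} {I I' J' : Inner K} (ha : m.node a = some (.inner I))
    (h : (m.write a I').node b = some (.inner J')) :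
    ∃ J, m.node b = some (.inner J) ∧ (J' = J ∨ (b = a ∧ J = I ∧ J' = I')) := by
  by_cases hba : b = a
  · subst hba
    simp only [Mem.write, Function.update_self, Option.some.injEq, Node.inner.injEq] at h
    exact ⟨I, ha, .inr ⟨rfl, rfl, h.symm⟩⟩
  · simp only [Mem.write, Function.update_of_ne hba] at h
    exact ⟨J', h, .inl rfl⟩

omit [LinearOrder K] in
theorem dlink_write {a b c : Addr} {I I' : Inner K} (ha : m.node a = some (.inner I))
    (hs : I.Same I') (h : DLink (m.write a I') b c) :
    DLink m b c ∧ ∃ nd, m.node b = some nd := by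
  obtain ⟨J', i, hJ', hi⟩ := h
  obtain ⟨J, hJ, rfl | ⟨rfl, rfl, rfl⟩⟩ := node_write ha hJ'
  · exact ⟨⟨J', i, hJ, hi⟩, _, hJ⟩
  · exact ⟨⟨J, i, hJ, hs.children ▸ hi⟩, _, hJ⟩

omit [LinearOrder K] in
theorem QuietMem.isInner (h : QuietMem m m') {a : Addr} (ha : IsInner m' a) : IsInner m a := by
  rcases h with rfl | ⟨b, J, J', hb, hs, hc, rfl⟩
  · exact ha
  · obtain ⟨I, hI⟩ := ha
    obtain ⟨I', hI', -⟩ := node_write hb hI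
    exact ⟨I', hI'⟩

omit [LinearOrder K] in
theorem QuietMem.cnt (h : QuietMem m m') (a : Addr) : cnt m' a = cnt m a := by
  by_cases ha : IsInner m a
  · obtain ⟨I, hI⟩ := ha
    obtain ⟨I', hI', -, hc⟩ := h.node hI
    rw [cnt_eq hI, cnt_eq hI', hc]
  · have h0 : ∀ {m : Mem K V}, ¬ IsInner m a → CIST.cnt m a = 0 := by
      intro m h
      unfold CIST.cnt
      split
      · exact absurd ⟨_, by assumption⟩ h
      · rfl
    rw [h0 ha, h0 fun h' => ha (h.isInner h')]

theorem Quiet.effect {S S' : State K V p} {j : Fin p} {s' : Pc K V} (h : Inv S)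
    (hth : S'.thread = Function.update S.thread j s')
    (q : Quiet S.mem (S.thread j) S'.mem s') : Effect S S' j s' fun _ => 0 := by
  have hupd : ∀ a, upd S' a = upd S a := by
    intro a
    have := upd_eq hth a
    rw [if_neg (q.owes a), if_neg (q.owes' a), q.mem.cnt] at this
    omega
  have hdl : ∀ b c, DLink S'.mem b c → DLink S.mem b c ∧ ∃ nd, S.mem.node b = some nd := by
    intro b c hbc
    rcases q.mem with hm | ⟨a, I, I', ha, hs, -, hm⟩
    · rw [hm] at hbc
      obtain ⟨I, i, hI, hi⟩ := hbc
      exact ⟨⟨I, i, hI, hi⟩, _, hI⟩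
    · rw [hm] at hbc
      exact dlink_write ha hs hbc
  have hdl' : ∀ b c nd, DLink S'.mem b c → S.mem.node c = some nd →
      DLink S.mem b c ∧ ∃ nd, S.mem.node b = some nd := fun b c _ hbc _ => hdl b c hbc
  refine ⟨fun a _ => hupd a, fun a h1 h2 => absurd (q.mem.isInner h1) h2, ?_, fun _ => zero_le_one,
    fun _ h => absurd h zero_ne_one, fun a hcov hr => ?_, fun _ h => absurd h zero_ne_one,
    fun a ha hcov he => q.enter a hcov (he.anti hdl' ha), hdl', fun R hR ht => ⟨R, ?_, fun _ _ => rfl,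
    q.route R hR ht⟩⟩
  · rcases q.mem with hm | ⟨a, I, I', ha, hs, -, hm⟩
    · rw [hm, funext hupd]
      exact h.pot
    · rw [hm]
      exact h.pot.write h.mem ha hs hupd
  · have ev : Evolve S.mem S'.mem := by
      rcases q.mem with hm | ⟨a, I, I', ha, hs, -, hm⟩
      · rw [hm]
        exact .refl _
      · rw [hm]
        exact .write ha hs
    rcases q.resp a hr with hr' | hc | ⟨I, hI, hle⟩
    · exact .inl (hr'.mono ev)
    · exact absurd (hc.mono ev) hcov
    · obtain ⟨I', hI', hs, hcnt⟩ := q.mem.node hI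
      exact .inr ⟨I', hI', by rw [hcnt, hs.initSize]; exact hle⟩
  · rcases q.mem with hm | ⟨a, I, I', ha, hs, -, hm⟩
    · rw [hm]
      exact hR
    · rw [hm]
      exact hR.write ha hs

/-- The count grows by one while the debt of the thread shrinks by one. As debts are recorded by
membership, the latter needs that the node does not occur again in the list. -/
theorem bump_effect {S S' : State K V p} {j : Fin p} {a : Addr} {i : ℕ}
    {todo path : List (Addr × ℕ)} {I : Inner K} (h : Inv S)
    (hth : S'.thread = Function.update S.thread j (.bump todo path))
    (hs : S.thread j = .bump ((a, i) :: todo) path) (ha : S.mem.node a = some (.inner I))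
    (hm : S'.mem = S.mem.write a { I with count := I.count + 1 }) :
    Effect S S' j (.bump todo path) fun _ => 0 := by
  have hsame : I.Same { I with count := I.count + 1 } := ⟨rfl, rfl, rfl, id⟩
  have hnd : a ∉ todo.map Prod.fst := by
    have h1 := h.thread j
    rw [hs] at h1
    have h2 : ((a, i) :: todo).map Prod.fst <:+ path.map Prod.fst := h1.2.1.map _
    exact (List.nodup_cons.1 (h2.sublist.nodup h1.2.2)).1
  have hupd : ∀ b, upd S' b = upd S b := by
    intro b
    have := upd_eq hth b
    rw [hs] at this
    by_cases hba : b = a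
    · subst hba
      have h1 : S'.mem.node b = some (.inner { I with count := I.count + 1 }) := by
        rw [hm]; simp [Mem.write]
      rw [cnt_eq ha, cnt_eq h1, if_pos (show (Pc.bump ((b, i) :: todo) path : Pc K V).Owes b from List.mem_cons_self),
        if_neg (show ¬ (Pc.bump todo path : Pc K V).Owes b from hnd)] at this
      simp only at this
      omega
    · have h1 : cnt S'.mem b = cnt S.mem b := by
        rw [hm]; simp [cnt, Mem.write, hba]
      have h2 : (Pc.bump ((a, i) :: todo) path : Pc K V).Owes b ↔
          (Pc.bump todo path : Pc K V).Owes b := by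
        simp [Pc.Owes, hba]
      rw [h1] at this
      by_cases h3 : (Pc.bump todo path : Pc K V).Owes b
      · rw [if_pos h3, if_pos (h2.2 h3)] at this
        omega
      · rw [if_neg h3, if_neg fun h4 => h3 (h2.1 h4)] at this
        omega
  have hdl : ∀ b c nd, DLink S'.mem b c → S.mem.node c = some nd →
      DLink S.mem b c ∧ ∃ nd, S.mem.node b = some nd := by
    intro b c nd hbc _
    rw [hm] at hbc
    exact dlink_write ha hsame hbc
  refine ⟨fun b _ => hupd b, fun b h1 h2 => ?_, ?_, fun _ => zero_le_one,
    fun _ h => absurd h zero_ne_one, fun b _ hr => .inl ?_, fun _ h => absurd h zero_ne_one,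
    fun b _ _ he => he.elim, hdl, fun R hR ht => ⟨R, hm ▸ hR.write ha hsame, fun _ _ => rfl,
    trivial⟩⟩
  · rw [hm] at h1
    obtain ⟨J, hJ⟩ := h1
    obtain ⟨J', hJ', -⟩ := node_write ha hJ
    exact absurd ⟨J', hJ'⟩ h2
  · rw [hm]
    exact h.pot.write h.mem ha hsame hupd
  · rw [hs] at hr
    exact hr

omit [LinearOrder K] in
theorem Graft.cnt_old {n c : Addr} {I : Inner K} {i : ℕ} {fresh : List ℕ → Option (Node K V)}
    (g : Graft m m' n I i c fresh) (hinv : MemInv m) {a : Addr} (ha : IsInner m a) :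
    cnt m' a = cnt m a := by
  obtain ⟨J, hJ⟩ := ha
  by_cases han : a = n
  · subst han
    rw [g.hn] at hJ
    cases hJ
    rw [cnt_eq g.hn, cnt_eq g.hn']
    rfl
  · rw [cnt, cnt, g.old han (hinv.alloc hJ).ne]

omit [LinearOrder K] in
theorem Graft.dlink {n c : Addr} {I : Inner K} {i : ℕ} {fresh : List ℕ → Option (Node K V)}
    (g : Graft m m' n I i c fresh) (hinv : MemInv m)
    (hf : ∀ pos d nd, m.node d = some nd → ¬ DLink m' (m.next, pos) d) (b d : Addr)
    (nd : Node K V) (h : DLink m' b d) (hd : m.node d = some nd) :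
    DLink m b d ∧ ∃ nd, m.node b = some nd := by
  by_cases hb : b.1 = m.next
  · obtain ⟨b, pos⟩ := b
    simp only at hb
    subst hb
    exact absurd h (hf pos d nd hd)
  · obtain ⟨J', j, hJ', hj⟩ := h
    obtain ⟨J, hJ, -⟩ := g.slots hb hJ'
    rcases g.ptr_old hb (.inl ⟨J', hJ', hj⟩) with ⟨⟨J', hJ', hj⟩ | ⟨-, q, l, hq⟩, -⟩ | ⟨-, -, rfl⟩
    · exact ⟨⟨J', j, hJ', hj⟩, _, hJ'⟩
    · rw [hJ] at hq
      cases hq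
    · exact absurd (hinv.alloc hd) (lt_irrefl _)

omit [LinearOrder K] in
theorem Graft.dlink_publish {n c : Addr} {I : Inner K} {i : ℕ} {t : Tree K V}
    (g : Graft m m' n I i c (treeBlock t m.next)) (hinv : MemInv m) (pos : List ℕ) (d : Addr)
    (nd : Node K V) (hd : m.node d = some nd) : ¬ DLink m' (m.next, pos) d := by
  rintro ⟨J, j, hJ, hj⟩
  obtain ⟨rfl, -⟩ := g.treeBlock_ptr (.inl ⟨J, hJ, hj⟩)
  exact lt_irrefl _ (hinv.alloc hd)

omit [LinearOrder K] in
theorem Graft.cnt_publish {n c : Addr} {I : Inner K} {i : ℕ} {t : Tree K V}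
    (g : Graft m m' n I i c (treeBlock t m.next)) (pos : List ℕ) : cnt m' (m.next, pos) = 0 := by
  unfold cnt
  split
  · rename_i J hJ
    rw [g.new] at hJ
    obtain ⟨-, -, -, -, -, -, -, h, -⟩ := treeBlock_inner hJ
    exact h
  · rfl

omit [LinearOrder K] in
theorem Graft.new_of_not_isInner {n c : Addr} {I : Inner K} {i : ℕ}
    {fresh : List ℕ → Option (Node K V)} (g : Graft m m' n I i c fresh) {a : Addr}
    (h : IsInner m' a) (h' : ¬ IsInner m a) : a.1 = m.next := by
  by_contra hx
  have han : a ≠ n := by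
    rintro rfl
    exact h' ⟨I, g.hn⟩
  obtain ⟨J, hJ⟩ := h
  rw [g.old han hx] at hJ
  exact h' ⟨J, hJ⟩

theorem Graft.upd_fresh {S S' : State K V p} {j : Fin p} {s' : Pc K V} {n c : Addr} {I : Inner K}
    {i : ℕ} {t : Tree K V} (g : Graft S.mem S'.mem n I i c (treeBlock t S.mem.next)) (h : Inv S)
    (hth : S'.thread = Function.update S.thread j s')
    (hs' : ∀ a, s'.Owes a → IsInner S.mem a) (pos : List ℕ) : upd S' (S.mem.next, pos) = 0 := by
  rw [upd, g.cnt_publish, zero_add]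
  refine num_eq_zero fun k hk => ?_
  have : IsInner S.mem (S.mem.next, pos) := by
    rw [hth] at hk
    by_cases hkj : k = j
    · subst hkj
      rw [Function.update_self] at hk
      exact hs' _ hk
    · rw [Function.update_of_ne hkj] at hk
      exact (h.thread k).owes_isInner hk
  obtain ⟨J, hJ⟩ := this
  exact lt_irrefl _ (h.mem.alloc hJ)

/-- The thread may drop all its responsibilities, because the new descriptor covers `a` and with it
the rest of the remembered path. -/
theorem announce_effect {S S' : State K V p} {j : Fin p} {a n : Addr} {i : ℕ} {I : Inner K}
    (h : Inv S) (hth : S'.thread = Function.update S.thread j (.markCall (S.mem.next, []) none a []))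
    (hs : S.thread j = .announce a n i)
    (g : Graft S.mem S'.mem n I i a (descriptorBlock K V a n i)) (hmem : MemInv S'.mem) :
    Effect S S' j (.markCall (S.mem.next, []) none a []) fun _ => 0 := by
  have ht := h.thread j
  rw [hs] at ht
  have ev := g.evolve h.mem (g.descriptor_slotEvolves ht.2)
  have hupd : ∀ b, IsInner S.mem b → upd S' b = upd S b := by
    intro b hb
    have := upd_eq hth b
    rw [hs, g.cnt_old h.mem hb, if_neg (show ¬ (Pc.announce a n i : Pc K V).Owes b from id),
      if_neg (show ¬ (Pc.markCall _ none a [] : Pc K V).Owes b from id)] at this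
    omega
  have hD : S'.mem.node (S.mem.next, []) = some (.rebuild a n i) := by
    rw [g.new, descriptorBlock, if_pos rfl]
  refine ⟨hupd, fun b h1 h2 => ?_, g.pot_announce h.mem h.pot ht.2 hupd, fun _ => zero_le_one,
    fun _ h => absurd h zero_ne_one, fun b hb hr => absurd ?_ hb,
    fun _ h => absurd h zero_ne_one, fun b _ _ he => he.elim, g.dlink h.mem ?_, fun R hR _ => ?_⟩
  · have hx := g.new_of_not_isInner h1 h2
    obtain ⟨b, pos⟩ := b
    simp only at hx
    subst hx
    obtain ⟨J, hJ⟩ := h1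
    rw [g.new, descriptorBlock] at hJ
    split_ifs at hJ
    cases hJ
  · rw [hs] at hr
    obtain ⟨q, l, hq, hb⟩ := hr
    exact hmem.covered_of_chain (hq.mono ev) (.target hD) hb
  · rintro pos d nd - ⟨J, j, hJ, -⟩
    rw [g.new, descriptorBlock] at hJ
    split_ifs at hJ
    cases hJ
  · obtain ⟨R', hR', hold⟩ := hR.descriptor h.mem g
    exact ⟨R', hR', hold, trivial⟩

theorem update_effect {S S' : State K V p} {j : Fin p} {c : Cmd K V} {n child : Addr} {i : ℕ}
    {path : List (Addr × ℕ)} {t : Tree K V} {I : Inner K} (h : Inv S)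
    (hth : S'.thread = Function.update S.thread j (.bump path path))
    (hs : S.thread j = .update c n path i child t)
    (g : Graft S.mem S'.mem n I i child (treeBlock t S.mem.next)) :
    Effect S S' j (.bump path path) fun a => if a ∈ path.map Prod.fst then 1 else 0 := by
  have ht := h.thread j
  rw [hs] at ht
  obtain ⟨hpath, ⟨leaf, hleaf, hrep⟩, J, hJ, hi⟩ := ht
  rw [g.hn] at hJ
  cases hJ
  obtain ⟨hl, hgood, hup, hlow, hkeys⟩ := replacement_good hrep
  have ev := g.evolve h.mem (.inr (.inl ⟨leaf, hleaf, hl⟩))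
  have hstrong := (hpath.strong fun ⟨L, hL⟩ => hL.marked g.hn g.hm.2).1
  have howes : ∀ a, (Pc.bump path path : Pc K V).Owes a → IsInner S.mem a :=
    fun a ha => hpath.isInner_of_mem ha
  have hfresh := g.upd_fresh h hth howes
  have hupd : ∀ b, IsInner S.mem b →
      upd S' b = upd S b + if b ∈ path.map Prod.fst then 1 else 0 := by
    intro b hb
    have := upd_eq hth b
    rw [hs, g.cnt_old h.mem hb,
      if_neg (show ¬ (Pc.update c n path i child t : Pc K V).Owes b from id)] at this
    by_cases h2 : b ∈ path.map Prod.fst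
    · rw [if_pos (show (Pc.bump path path : Pc K V).Owes b from h2)] at this
      rw [if_pos h2]
      omega
    · rw [if_neg (show ¬ (Pc.bump path path : Pc K V).Owes b from h2)] at this
      rw [if_neg h2]
      omega
  refine ⟨hupd, fun b h1 h2 => ?_, ?_, fun a => ?_, fun a ha => ?_, fun a _ hr => ?_,
    fun a ha => ?_, fun b _ _ he => he.elim, g.dlink h.mem (g.dlink_publish h.mem),
    fun R hR hRt => ?_⟩
  · have hx := g.new_of_not_isInner h1 h2
    obtain ⟨b, pos⟩ := b
    simp only at hx
    subst hx
    exact hfresh pos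
  · exact g.pot_update ev h.mem h.pot hgood hstrong hupd hfresh hleaf hl hup hlow
  · split_ifs <;> omega
  · rw [hs]
    split_ifs at ha with ha'
    exact ⟨id, ha'⟩
  · rw [hs] at hr
    exact hr.elim
  · rw [hs]
    split_ifs at ha with ha'
    exact ⟨.inr ha', id⟩
  · rw [hs] at hRt
    have hchild := hR.slot g.hn g.hm.1
    obtain ⟨R', hR', hold⟩ := hR.publish h.mem g hgood fun e he => by
      rcases hkeys e he with he | ⟨x, hx⟩
      · rw [he]
        exact ⟨hRt, hi.symm⟩
      · rw [hx] at hleaf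
        exact (hchild _).1 (hR.single hleaf)
    exact ⟨R', hR', hold, trivial⟩

/-- The new tree has as many keys as the frozen subtree, a number between the two potentials of the
descriptor, so the surrounding inequalities survive although the updates of the new nodes start at
zero. -/
theorem install_effect {S S' : State K V p} {j : Fin p} {op n target : Addr} {i : ℕ}
    {r : Option (Cmd K V)} {t : Tree K V} {I : Inner K} (h : Inv S)
    (hth : S'.thread = Function.update S.thread j (.resume r))
    (hs : S.thread j = .install op r t) (hop : S.mem.node op = some (.rebuild target n i))
    (g : Graft S.mem S'.mem n I i op (treeBlock t S.mem.next)) (hmem : MemInv S'.mem) :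
    Effect S S' j (.resume r) fun _ => 0 := by
  have ht := h.thread j
  rw [hs] at ht
  obtain ⟨a, q, l, L, hop', hL, hlist, hgood⟩ := ht
  rw [hop] at hop'
  cases hop'
  have ev := g.evolve h.mem (.inr (.inr (.inr ⟨_, _, _, L, hop, hL⟩)))
  have hfresh := g.upd_fresh h hth fun a ha => absurd ha (not_owes_resume r a)
  have hupd : ∀ b, IsInner S.mem b → upd S' b = upd S b := by
    intro b hb
    have := upd_eq hth b
    rw [hs, g.cnt_old h.mem hb, if_neg (show ¬ (Pc.install op r t : Pc K V).Owes b from id),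
      if_neg (not_owes_resume r b)] at this
    omega
  have hcont : Contents S.mem op L := .rebuild hop hL.contents
  have hne : op ≠ rootAddr := by
    rintro rfl
    exact h.mem.root_ptr g.slot
  have hsize : t.size = L.length := by rw [Tree.size, hlist]
  obtain ⟨hlow, hup⟩ := h.pot.contents h.mem hcont hne
  refine ⟨hupd, fun b h1 h2 => ?_, ?_, fun _ => zero_le_one,
    fun _ h => absurd h zero_ne_one, fun b _ hr => ?_, fun _ h => absurd h zero_ne_one,
    fun b _ hc he => absurd he (hmem.not_enter_resume (hc.mono ev) r),
    g.dlink h.mem (g.dlink_publish h.mem), fun R hR _ => ?_⟩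
  · have hx := g.new_of_not_isInner h1 h2
    obtain ⟨b, pos⟩ := b
    simp only at hx
    subst hx
    exact hfresh pos
  · exact g.pot_install ev h.mem h.pot hgood hupd hfresh (by rw [hsize]; exact hlow)
      (by rw [hsize]; exact hup)
  · rw [hs] at hr
    exact hr.elim
  · obtain ⟨R', hR', hold⟩ := hR.publish h.mem g hgood fun e he =>
      (hR.slot g.hn g.hm.1 _).1 (hR.contents hcont e (hlist ▸ he))
    exact ⟨R', hR', hold, hR'.resume r⟩

theorem Inv.next {collab : Bool} {S S' : State K V p} (h : Inv S) (hn : S.Next collab S') :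
    Inv S' := by
  obtain ⟨j, s', hstep, hth⟩ := hn
  obtain ⟨ev, hmem, hs'⟩ := step_inv h.mem (h.thread j) (fun hc => hc.nodup h.mem h.pot) hstep
  rcases step_kinds h.mem (h.thread j) hstep with q | ⟨c, n, path, i, child, t, I, hs, rfl, hI, hm,
    he⟩ | ⟨a, i, todo, path, I, hs, rfl, hI, he⟩ | ⟨a, n, i, I, hs, rfl, hI, hm, he⟩ |
    ⟨op, r, t, target, n, i, I, hs, rfl, hop, hI, hm, he⟩
  · exact (q.effect h hth).inv h hth ev hmem hs'
  · exact (update_effect h hth hs (he ▸ Graft.publish h.mem t hI hm)).inv h hth ev hmem hs'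
  · exact (bump_effect h hth hs hI he).inv h hth ev hmem hs'
  · exact (announce_effect h hth hs (he ▸ Graft.descriptor h.mem hI hm) hmem).inv h hth ev hmem hs'
  · exact (install_effect h hth hs hop (he ▸ Graft.publish h.mem t hI hm) hmem).inv h hth ev
      hmem hs'

omit [LinearOrder K] in
theorem node_init {a : Addr} {nd : Node K V} (h : (Mem.init K V).node a = some nd) :
    (a = rootAddr ∧ ∃ I : Inner K, nd = .inner I ∧ I.keys = [] ∧ I.children = [(0, [0])] ∧
      I.status = Status.clean ∧ I.count = 0) ∨ (a = (0, [0]) ∧ nd = .empty) := by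
  obtain ⟨b, pos⟩ := a
  simp only [Mem.init, Mem.publish] at h
  split_ifs at h with hb
  subst hb
  match pos, h with
  | [], h =>
    simp only [Tree.subtree, Option.map_some, Option.some.injEq] at h
    exact .inl ⟨rfl, _, h.symm, rfl, rfl, rfl, rfl⟩
  | [0], h =>
    simp only [Tree.subtree, zero_lt_one, dite_true, Option.map_some, Option.some.injEq] at h
    exact .inr ⟨rfl, h.symm⟩
  | 0 :: x :: pos, h => simp [Tree.subtree] at h
  | (y + 1) :: pos, h => simp [Tree.subtree] at h

omit [LinearOrder K] in
theorem ptr_init {b c : Addr} {i : ℕ} (h : Ptr (Mem.init K V) b i c) :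
    b = rootAddr ∧ i = 0 ∧ c = (0, [0]) := by
  rcases h with ⟨I, hI, hi⟩ | ⟨-, q, j, hq⟩
  · rcases node_init hI with ⟨rfl, J, hJ, -, hch, -⟩ | ⟨-, h⟩
    · cases hJ
      rw [hch, List.getElem?_singleton] at hi
      split_ifs at hi with h0
      exact ⟨rfl, h0, (Option.some.inj hi).symm⟩
    · cases h
  · rcases node_init hq with ⟨-, J, hJ, -⟩ | ⟨-, h⟩
    · cases hJ
    · cases h

theorem Inv.init : Inv (State.init K V p) := by
  have hroot : (Mem.init K V).node rootAddr = some (.inner ⟨(Tree.inner [] 1 fun _ =>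
      (Tree.empty : Tree K V)).size, [], [(0, [0])], Status.clean, 0, 0⟩) := rfl
  have hleaf : (Mem.init K V).node (0, [0]) = some .empty := rfl
  have hinner : ∀ {a : Addr} {I : Inner K}, (Mem.init K V).node a = some (.inner I) →
      a = rootAddr ∧ I.keys = [] ∧ I.children = [(0, [0])] ∧ I.status = Status.clean ∧
        I.count = 0 := by
    intro a I h
    rcases node_init h with ⟨rfl, J, hJ, h⟩ | ⟨-, h⟩
    · cases hJ
      exact ⟨rfl, h⟩
    · cases h
  have hupd : ∀ a I, (Mem.init K V).node a = some (.inner I) → upd (State.init K V p) a = 0 := by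
    intro a I hI
    rw [upd, num_eq_zero fun j => id, add_zero]
    exact (cnt_eq hI).trans (hinner hI).2.2.2.2
  refine ⟨⟨fun {a nd} h => ?_, fun h => ?_, fun h h' => ?_, ⟨_, _, hroot, rfl⟩, fun h => ?_,
    fun h => ?_, fun h hs => ?_, fun h hs => ?_⟩, fun j => trivial, fun a I ha hI => ?_,
    fun a I hI _ => ?_, fun a I hI => ?_, fun _ _ => True, ⟨fun _ => trivial, fun h hc k => ?_,
    fun _ _ => Iff.rfl, fun _ => trivial⟩, fun _ => trivial⟩
  · rcases node_init h with ⟨rfl, -⟩ | ⟨rfl, -⟩ <;> exact Nat.zero_lt_one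
  · obtain ⟨-, -, rfl⟩ := ptr_init h
    exact ⟨_, hleaf⟩
  · obtain ⟨rfl, rfl, -⟩ := ptr_init h
    obtain ⟨rfl, rfl, -⟩ := ptr_init h'
    exact ⟨rfl, rfl⟩
  · obtain ⟨-, -, h⟩ := ptr_init h
    simp [rootAddr] at h
  · rcases node_init h with ⟨-, J, hJ, -⟩ | ⟨-, h⟩
    · cases hJ
    · cases h
  · exact absurd (hinner h).2.2.2.1 hs
  · rw [(hinner h).2.2.2.1] at hs
    cases hs
  · exact absurd (hinner hI).1 ha
  · rw [hupd a I hI]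
    omega
  · have : num (fun s => Enter (Mem.init K V) s a) (State.init K V p).thread = 0 :=
      num_eq_zero fun j => id
    show 4 * (_ + num (fun s => Enter (Mem.init K V) s a) (State.init K V p).thread) ≤ _
    rw [hupd a I hI, this]
    omega
  -- The root has no search keys, so every search takes its slot 0, and the constantly true route
  -- relation is admissible.
  · obtain ⟨rfl, h1, h2, -⟩ := hinner h
    obtain ⟨-, rfl, -⟩ := ptr_init (.inl ⟨_, h, hc⟩)
    simp [h1, searchIndex]

theorem State.Reachable.inv {collab : Bool} {S : State K V p} (h : S.Reachable collab) :
    Inv S := by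
  induction h with
  | refl => exact Inv.init
  | tail _ hn ih => exact ih.next hn

end Invariant

/-! ### From potentials to depth -/

section Depth

/-- A bound for the number of inner nodes on a path below a node with potential `x`: the potential
is at least halved while it is large, and it decreases when it is small. -/
def levels (p x : ℕ) : ℕ := min x (16 * p + 120) + Nat.log 2 x

/-- If s + w > 16p + 120, then w ≤ s/4 + 2p makes s so large that √s + 3 + w is at most half of s +
w, and the logarithm drops. Otherwise the strict decrease of the potential lowers the first summand.
-/
theorem levels_lt {p s w y : ℕ} (h1 : y + 1 ≤ s + w) (h2 : y ≤ Nat.sqrt s + 3 + w)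
    (h3 : 4 * w ≤ s + 8 * p) : levels p y + 1 ≤ levels p (s + w) := by
  unfold levels
  by_cases h : s + w ≤ 16 * p + 120
  · have := Nat.log_mono_right (b := 2) (show y ≤ s + w by omega)
    rw [min_eq_left h, min_eq_left (by omega)]
    omega
  · have h4 : 8 * Nat.sqrt s ≤ s + 16 := by
      have := Nat.sqrt_le s
      zify at this ⊢
      nlinarith [sq_nonneg ((Nat.sqrt s : ℤ) - 4)]
    have h5 : y * 2 ≤ s + w := by omega
    have h6 : Nat.log 2 y + 1 ≤ Nat.log 2 (s + w) := by
      rcases Nat.eq_zero_or_pos y with rfl | hy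
      · rw [Nat.log_zero_right]
        exact Nat.log_pos (by norm_num) (by omega)
      · rw [← Nat.log_mul_base (by norm_num) hy.ne']
        exact Nat.log_mono_right h5
    have h7 : min y (16 * p + 120) ≤ min (s + w) (16 * p + 120) :=
      min_le_min_right _ (by omega)
    omega

theorem levels_le {p n x : ℕ} (hx : x ≤ 2 * n + 6 * p) :
    (levels p x : ℝ) ≤ 17 * p + 123 + 2 * Real.log n := by
  -- Replacing n by at least 1 handles the empty tree, where the logarithm of 0 is read as 0.
  set N := max n 1 with hN
  have hN1 : 1 ≤ N := le_max_right _ _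
  have hlog : Nat.log 2 x ≤ 3 + p + Nat.log 2 N := by
    rcases Nat.eq_zero_or_pos x with rfl | hpos
    · simp
    refine Nat.lt_succ_iff.1 (Nat.log_lt_of_lt_pow hpos.ne' ?_)
    have h1 : N < 2 ^ (Nat.log 2 N + 1) := Nat.lt_pow_succ_log_self (by norm_num) N
    have h2 : p < 2 ^ p := Nat.lt_two_pow_self
    have h3 : n ≤ N := le_max_left _ _
    have h4 : N ≤ 2 ^ p * N := Nat.le_mul_of_pos_left _ (by positivity)
    have h5 : 2 ^ p ≤ 2 ^ p * N := Nat.le_mul_of_pos_right _ hN1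
    -- Here 8 = 2 + 6: both n and p are at most 2^p · N.
    calc x ≤ 8 * (2 ^ p * N) := by omega
      _ < 8 * (2 ^ p * 2 ^ (Nat.log 2 N + 1)) := by gcongr
      _ = 2 ^ (3 + p + Nat.log 2 N).succ := by rw [Nat.succ_eq_add_one]; ring
  have hreal : (Nat.log 2 N : ℝ) ≤ 2 * Real.log n := by
    have h1 : Real.log N = Real.log n := by
      rcases Nat.eq_zero_or_pos n with rfl | hn
      · simp [hN]
      · rw [hN, max_eq_left (show 1 ≤ n from hn)]
    have h2 : (Nat.log 2 N : ℝ) ≤ Real.logb 2 N := by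
      have := Real.natLog_le_logb N 2
      simpa using this
    have h3 : 0 ≤ Real.log N := Real.log_nonneg (by exact_mod_cast hN1)
    have h4 : (1 : ℝ) / 2 ≤ Real.log 2 := by linarith [Real.log_two_gt_d9]
    rw [← h1]
    refine h2.trans ?_
    rw [Real.logb, div_le_iff₀ (by linarith)]
    nlinarith
  have h1 : levels p x ≤ 16 * p + 120 + (3 + p + Nat.log 2 N) := by
    have := min_le_right x (16 * p + 120)
    unfold levels
    omega
  have h2 : (levels p x : ℝ) ≤ 16 * p + 120 + (3 + p + Nat.log 2 N) := by exact_mod_cast h1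
  linarith

open Classical in
/-- A bound for the length of the paths below a node. -/
noncomputable def height (p : ℕ) (m : Mem K V) (w : Addr → ℕ) (a : Addr) : ℕ :=
  2 * levels p (pot m w 1 a).toNat + if ∃ t q j, m.node a = some (.rebuild t q j) then 1 else 0

variable {p : ℕ} {m : Mem K V} {w : Addr → ℕ}

theorem pot_nonneg (a : Addr) : 0 ≤ pot m w 1 a := by
  unfold pot
  split
  · exact le_rfl
  · exact zero_le_one
  · positivity
  · split
    · positivity
    · exact le_rfl
  · exact le_rfl

theorem pot_toNat {a c : Addr} {I : Inner K} (h : Leads m c a) (ha : m.node a = some (.inner I)) :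
    (pot m w 1 c).toNat = I.initSize + w a := by
  rw [pot_leads h ha]
  omega

theorem height_inner {a : Addr} {I : Inner K} (h : m.node a = some (.inner I)) :
    height p m w a = 2 * levels p (I.initSize + w a) := by
  rw [height, pot_toNat (.inl rfl) h, if_neg (by rw [h]; simp), add_zero]

/-- Each inner node accounts for two pointers, so that a descriptor above a child has its own unit.
-/
theorem Pot.height_child (hp : Pot m w)
    (hw : ∀ a I, m.node a = some (.inner I) → 4 * w a ≤ I.initSize + 8 * p) {a c : Addr}
    {I : Inner K} (ha : a ≠ rootAddr) (hI : m.node a = some (.inner I)) (hc : c ∈ I.children) :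
    height p m w c + 1 ≤ height p m w a := by
  have h1 := (hp a I ha hI).lt c hc
  have h2 := (hp a I ha hI).le c hc
  have h0 := pot_nonneg (m := m) (w := w) c
  have h3 := levels_lt (p := p) (y := (pot m w 1 c).toNat) (s := I.initSize) (w := w a)
    (by omega) (by omega) (hw a I hI)
  rw [height_inner hI, height]
  split_ifs <;> omega

theorem MemInv.height_target (hinv : MemInv m) {D t q : Addr} {j : ℕ}
    (h : m.node D = some (.rebuild t q j)) : height p m w t + 1 = height p m w D := by
  obtain ⟨J, hJ⟩ := hinv.target_inner h
  rw [height_inner hJ, height, pot_toNat (.inr ⟨q, j, h⟩) hJ, if_pos ⟨_, _, _, h⟩]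

/-- The root is exempt from the inequalities, so heights are compared with that of its only child,
at the cost of one pointer. -/
theorem MemInv.path_le (hinv : MemInv m) (hp : Pot m w)
    (hw : ∀ a I, m.node a = some (.inner I) → 4 * w a ≤ I.initSize + 8 * p) {R : Inner K}
    {r : Addr} (hR : m.node rootAddr = some (.inner R)) (hr : R.children = [r]) {l : ℕ} {a : Addr}
    (h : m.Path l a) : (a = rootAddr ∧ l = 0) ∨
      (a ≠ rootAddr ∧ l + height p m w a ≤ 1 + height p m w r) := by
  induction h with
  | root => exact .inl ⟨rfl, rfl⟩
  | @child l a c I h hI hc ih =>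
    right
    refine ⟨?_, ?_⟩
    · rintro rfl
      obtain ⟨j, hj⟩ := List.getElem?_of_mem hc
      exact hinv.root_ptr (.inl ⟨I, hI, hj⟩)
    · rcases ih with ⟨rfl, rfl⟩ | ⟨ha, hle⟩
      · rw [hR] at hI
        cases hI
        rw [hr, List.mem_singleton] at hc
        rw [hc]
      · have := hp.height_child hw ha hI hc
        omega
  | @target l D t q j h hD ih =>
    right
    refine ⟨?_, ?_⟩
    · rintro rfl
      exact hinv.root_ptr (.inr ⟨rfl, q, j, hD⟩)
    · rcases ih with ⟨rfl, rfl⟩ | ⟨ha, hle⟩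
      · rw [hR] at hD
        cases hD
      · have := hinv.height_target (p := p) (w := w) hD
        omega

/-- The height falls along every pointer below the root, so the memory is well-founded there and the
leaves can be listed by recursion. -/
theorem MemInv.exists_contents (hinv : MemInv m) (hp : Pot m w)
    (hw : ∀ a I, m.node a = some (.inner I) → 4 * w a ≤ I.initSize + 8 * p) (N : ℕ) :
    ∀ a nd, m.node a = some nd → a ≠ rootAddr → height p m w a ≤ N → ∃ L, Contents m a L := by
  induction N using Nat.strong_induction_on with
  | _ N ih =>
    intro a nd hnd ha hN
    cases nd with
    | empty => exact ⟨_, .empty hnd⟩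
    | single k x => exact ⟨_, .single hnd⟩
    | rebuild t q j =>
      obtain ⟨J, hJ⟩ := hinv.target_inner hnd
      have := hinv.height_target (p := p) (w := w) hnd
      have ht : t ≠ rootAddr := by
        rintro rfl
        exact hinv.root_ptr (.inr ⟨rfl, q, j, hnd⟩)
      obtain ⟨L, hL⟩ := ih _ (by omega) t _ hJ ht le_rfl
      exact ⟨L, .rebuild hnd hL⟩
    | inner I =>
      have : ∀ c, ∃ L, c ∈ I.children → Contents m c L := by
        intro c
        by_cases hc : c ∈ I.children
        · obtain ⟨j, hj⟩ := List.getElem?_of_mem hc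
          obtain ⟨nd, hnd'⟩ := hinv.ptr_alloc (.inl ⟨I, hnd, hj⟩)
          have hcr : c ≠ rootAddr := by
            rintro rfl
            exact hinv.root_ptr (.inl ⟨I, hnd, hj⟩)
          have := hp.height_child hw ha hnd hc
          obtain ⟨L, hL⟩ := ih _ (by omega) c _ hnd' hcr le_rfl
          exact ⟨L, fun _ => hL⟩
        · exact ⟨[], fun h => absurd h hc⟩
      choose f hf using this
      exact ⟨_, .inner f hnd hf⟩

theorem Contents.of_path {L : List (K × V)} (hL : Contents m rootAddr L) {l : ℕ} {a : Addr}
    (h : m.Path l a) : ∃ L', Contents m a L' ∧ L' ⊆ L := by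
  induction h with
  | root => exact ⟨L, hL, List.Subset.refl _⟩
  | child h hI hc ih =>
    obtain ⟨L', hL', hsub⟩ := ih
    cases hL' with
    | inner f hI' hf =>
      rw [hI] at hI'
      cases hI'
      exact ⟨_, hf _ hc, fun e he => hsub (List.mem_flatMap.2 ⟨_, hc, he⟩)⟩
    | _ => simp_all
  | target h hD ih =>
    obtain ⟨L', hL', hsub⟩ := ih
    cases hL' with
    | rebuild hD' hf =>
      rw [hD] at hD'
      cases hD'
      exact ⟨_, hf, hsub⟩
    | _ => simp_all

theorem Contents.exists_path {a : Addr} {L : List (K × V)} (hL : Contents m a L) {l : ℕ}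
    (h : m.Path l a) {e : K × V} (he : e ∈ L) :
    ∃ l' b, m.Path l' b ∧ m.node b = some (.single e.1 e.2) := by
  induction hL generalizing l with
  | empty => simp at he
  | single ha =>
    rw [List.mem_singleton] at he
    subst he
    exact ⟨l, _, h, ha⟩
  | rebuild ha _ ih => exact ih (.target h ha) he
  | inner f ha _ ih =>
    obtain ⟨c, hc, he⟩ := List.mem_flatMap.1 he
    exact ih c hc (.child h ha hc) he

theorem Contents.keySet_eq {L : List (K × V)} (hL : Contents m rootAddr L) :
    m.keySet = {k | k ∈ L.map Prod.fst} := by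
  ext k
  constructor
  · rintro ⟨l, a, x, hl, ha⟩
    obtain ⟨L', hL', hsub⟩ := hL.of_path hl
    obtain rfl := hL'.unique (.single ha)
    exact List.mem_map.2 ⟨(k, x), hsub (List.mem_singleton.2 rfl), rfl⟩
  · intro hk
    obtain ⟨e, he, rfl⟩ := List.mem_map.1 hk
    obtain ⟨l, b, hb, hnd⟩ := hL.exists_path .root he
    exact ⟨l, b, e.2, hb, hnd⟩

theorem Inv.depth [LinearOrder K] {S : State K V p} (h : Inv S) (hp1 : 1 ≤ p) :
    S.mem.keySet.Finite ∧ ∃ d : ℕ, S.mem.HasDepth d ∧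
      (d : ℝ) ≤ 300 * ((p : ℝ) + Real.log (S.mem.keySet.ncard : ℝ)) := by
  have hw : ∀ a I, S.mem.node a = some (.inner I) → 4 * upd S a ≤ I.initSize + 8 * p := by
    intro a I hI
    have := h.enter a I hI
    omega
  obtain ⟨R, r, hR, hr⟩ := h.mem.root
  have hptr : Ptr S.mem rootAddr 0 r := .inl ⟨R, hR, by rw [hr]; rfl⟩
  obtain ⟨nd, hnd⟩ := h.mem.ptr_alloc hptr
  have hne : r ≠ rootAddr := by
    rintro rfl
    exact h.mem.root_ptr hptr
  obtain ⟨L, hL⟩ := h.mem.exists_contents h.pot hw _ r nd hnd hne le_rfl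
  have hroot : Contents S.mem rootAddr L := by
    have := Contents.inner (fun _ => L) hR (by rw [hr]; simpa using hL)
    simpa [hr] using this
  have hkeys := hroot.keySet_eq
  have hnodup : (L.map Prod.fst).Nodup := by
    obtain ⟨Rt, hRt, -⟩ := h.route
    exact hRt.nodup hroot
  have hcoe : S.mem.keySet = ((L.map Prod.fst).toFinset : Set K) := by
    rw [hkeys, List.coe_toFinset]
  have hcard : S.mem.keySet.ncard = L.length := by
    rw [hcoe, Set.ncard_coe_finset, List.toFinset_card_of_nodup hnodup, List.length_map]
  refine ⟨hcoe ▸ Finset.finite_toSet _, ?_⟩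
  have hbound : ∀ l ∈ {l : ℕ | ∃ a, S.mem.Path l a}, l ≤ 1 + height p S.mem (upd S) r := by
    rintro l ⟨a, hl⟩
    rcases h.mem.path_le h.pot hw hR hr hl with ⟨-, rfl⟩ | ⟨-, h'⟩ <;> omega
  have hbdd : BddAbove {l : ℕ | ∃ a, S.mem.Path l a} := ⟨_, hbound⟩
  have hmem : sSup {l : ℕ | ∃ a, S.mem.Path l a} ∈ {l : ℕ | ∃ a, S.mem.Path l a} :=
    Nat.sSup_mem ⟨0, rootAddr, .root⟩ hbdd
  refine ⟨_, ⟨hmem, fun l hl => le_csSup hbdd hl⟩, ?_⟩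
  have hd := hbound _ hmem
  set d := sSup {l : ℕ | ∃ a, S.mem.Path l a}
  -- From s − w ≤ n and w ≤ s/4 + 2p one gets s ≤ (4n + 8p)/3, and then s + w ≤ (5n + 16p)/3.
  have hx : (CIST.pot S.mem (upd S) 1 r).toNat ≤ 2 * L.length + 6 * p := by
    obtain ⟨-, hlow⟩ := h.pot.contents h.mem hL hne
    rcases h.mem.leaf_or_leads hnd with hl | ⟨a, hl, I, hI⟩
    · rw [pot_leaf hnd hl] at hlow ⊢
      omega
    · rw [pot_leads hl hI] at hlow ⊢
      have := hw a I hI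
      omega
  have hlev := levels_le hx
  have hd' : d ≤ 2 + 2 * levels p (CIST.pot S.mem (upd S) 1 r).toNat := by
    rw [height] at hd
    split_ifs at hd <;> omega
  have hd'' : (d : ℝ) ≤ 2 + 2 * levels p (CIST.pot S.mem (upd S) 1 r).toNat := by exact_mod_cast hd'
  have hlog : 0 ≤ Real.log (L.length : ℝ) := Real.log_natCast_nonneg _
  have hp : (1 : ℝ) ≤ p := by exact_mod_cast hp1
  rw [hcard]
  -- The bound is 2 + 2(17p + 123 + 2 log n) = 34p + 248 + 4 log n, and p ≥ 1 absorbs the constant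
  -- into 282p.
  linarith

end Depth

end CIST

theorem mainTheorem4 :
    ∃ C : ℝ, ∀ (K : Type u) (V : Type v) [LinearOrder K] (collab : Bool) (p : ℕ), 1 ≤ p →
      ∀ S : CIST.State K V p, S.Reachable collab →
        S.mem.keySet.Finite ∧
          ∃ d : ℕ, S.mem.HasDepth d ∧
            (d : ℝ) ≤ C * ((p : ℝ) + Real.log (S.mem.keySet.ncard : ℝ)) :=
  ⟨300, fun _ _ _ _ _ hp _ hS => hS.inv.depth hp⟩
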